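/- **Theorem (Discrete local lower bound).** Let $d\in\{2,3\}$, let $\Omega\subset\mathbb R^d$ be a bounded open set with Lipschitz boundary, and let $\ell\ge 1$. Let $\mathcal A$ be a symmetric-matrix-valued function with $a_1|\xi|^2\le \mathcal A(x)\xi\cdot\xi\le a_2|\xi|^2$ for all $\xi\in\mathbb R^d$, $x\in\Omega$, and let $\mathcal B$ be a measurable scalar function with $b_1\le\mathcal B\le b_2$ in $\Omega$, for some constants $a_1,a_2,b_1,b_2>0$. Put $a(u,v)=\int_\Omega\mathcal A\nabla u\cdot\nabla v$, $b(u,v)=\int_\Omega\mathcal B uv$, $\|v\|_b=b(v,v)^{1/2}$; $\|\cdot\|_D$ denotes the $L^2(D)$-norm. Let $\mathcal T$ be a conforming triangulation of $\Omega$ into $d$-simplices such that $\mathcal A$ is Lipschitz continuous inside each element (its discontinuities are aligned with the sides of $\mathcal T$), and let $\kappa_{\mathcal T}=\max_{T\in\mathcal T}\operatorname{diam}(T)/\rho_T$, where $\rho_T$ is the radius of the largest ball contained in $T$. Let $h_T=|T|^{1/d}$ and $$\mathbb V_{\mathcal T}=\{v\in H^1_0(\Omega): v|_T\in\mathbb P_\ell(T)\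 \ \forall\,T\in\mathcal T\},$$ where $\mathbb P_k$ denotes the polynomials of degree at most $k$. For $v\in\mathbb V_{\mathcal T}$ and $\mu\in\mathbb R$ let $R(\mu,v)|_T=-\nabla\cdot(\mathcal A\nabla v)-\mu\mathcal B v$ on each $T\in\mathcal T$; let $J(v)|_S=(\mathcal A\nabla v)|_{T_1}\cdot n_1+(\mathcal A\nabla v)|_{T_2}\cdot n_2$ on each interior side $S$ (the common edge if $d=2$, or face if $d=3$, of two elements $T_1,T_2$ with outward unit normals $n_1,n_2$ on $S$), and $J(v)=0$ on $\partial\Omega$; and let $$\eta(\mu,v;T)=\big(h_T^2\|R(\mu,v)\|_T^2+h_T\|J(v)\|_{\partial T}^2\big)^{1/2}.$$ For $T\in\mathcal T$ let $\mathcal N(T)=\{T'\in\mathcal T:T'\cap T\ne\emptyset\}$ and $\omega(T)=\bigcup_{T'\in\mathcal N(T)}T'$. Let $\mathcal T_*$ be a conforming triangulation of $\Omega$ obtained from $\mathcal T$ by newest-vertex bisection if $d=2$, or by Kossaczký's bisection if $d=3$, in which every element of $\mathcal N(T)$ has been bisected (at least) $n_d$ times, where $n_2=3$ and $n_3=6$.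 Let $\lambda_{\mathcal T}\in\mathbb R$ and $u_{\mathcal T}\in\mathbb V_{\mathcal T}$ satisfy $$a(u_{\mathcal T},v)=\lambda_{\mathcal T}\,b(u_{\mathcal T},v)\quad\forall\,v\in\mathbb V_{\mathcal T},\qquad \|u_{\mathcal T}\|_b=1,$$ let $\mathbb W$ be a linear subspace of $H^1_0(\Omega)$ with $\mathbb V_{\mathcal T_*}\subset\mathbb W$, and let $\mu\in\mathbb R$ and $w\in\mathbb W$ satisfy $$a(w,v)=\mu\,b(w,v)\quad\forall\,v\in\mathbb W,\qquad \|w\|_b=1.$$ Then $$\eta(\lambda_{\mathcal T},u_{\mathcal T};T)\le C\Big(\|\nabla(w-u_{\mathcal T})\|_{\omega(T)}+h_T\|\mu w-\lambda_{\mathcal T}u_{\mathcal T}\|_{\omega(T)}+h_T\|R-\overline R\|_{\omega(T)}+h_T^{1/2}\|J-\overline J\|_{\partial T}\Big),$$ where $R=R(\lambda_{\mathcal T},u_{\mathcal T})$, $J=J(u_{\mathcal T})$, $\overline R|_{T'}$ is the $L^2(T')$-projection of $R$ onto $\mathbb P_{\ell-1}$ for every $T'\in\mathcal N(T)$, and $\overline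 J|_S$ is the $L^2(S)$-projection of $J$ onto $\mathbb P_{\ell-1}$ for every side $S\subset\partial T$. The constant $C$ depends only on $d$, $\ell$, $\mathcal A$, $\mathcal B$, $\Omega$ and an upper bound for $\kappa_{\mathcal T}$. -/

import Mathlib

open MeasureTheory
open scoped ContDiff NNReal Topology

noncomputable section

namespace EigenFEM

/-- The space `ℝ^d` with its Euclidean norm. -/
abbrev E (d : ℕ) : Type := EuclideanSpace ℝ (Fin d)

/-! ### The domain -/

/-- Near each of its boundary points, and after a choice of a "vertical" unit vector `e`, the set
`Ω` is the strict epigraph of a Lipschitz function of the component orthogonal to `e`. -/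
def HasLipschitzBoundary {d : ℕ} (Ω : Set (E d)) : Prop :=
  ∀ x ∈ frontier Ω, ∃ e : E d, ‖e‖ = 1 ∧ ∃ r : ℝ, 0 < r ∧ ∃ (L : ℝ≥0) (γ : E d → ℝ),
    LipschitzWith L γ ∧
      ∀ y ∈ Metric.ball x r, (y ∈ Ω ↔ γ (y - inner ℝ e y • e) < inner ℝ e y)

/-! ### The space `H¹₀(Ω)` -/

/-- Pairs (function, vector field) of square integrable objects on `ℝ^d`. -/
abbrev L2Pair (d : ℕ) : Type :=
  Lp ℝ 2 (volume : Measure (E d)) × Lp (E d) 2 (volume : Measure (E d))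

/-- The pairs `(φ, ∇φ)` with `φ ∈ C_c^∞(Ω)`. -/
def testPairs {d : ℕ} (Ω : Set (E d)) : Set (L2Pair d) :=
  {p | ∃ φ : E d → ℝ, ContDiff ℝ ∞ φ ∧ HasCompactSupport φ ∧ tsupport φ ⊆ Ω ∧
    (p.1 : E d → ℝ) =ᵐ[volume] φ ∧ (p.2 : E d → E d) =ᵐ[volume] gradient φ}

/-- `H¹₀(Ω)`, the closure of `C_c^∞(Ω)` in the norm of `H¹`. A member `v` is stored as the pair
`(v, ∇v)` of the function and its weak gradient, both extended by zero outside `Ω`; the set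
`testPairs Ω` is already a linear subspace, so that the span only bundles it. -/
def H10 {d : ℕ} (Ω : Set (E d)) : Submodule ℝ (L2Pair d) :=
  (Submodule.span ℝ (testPairs Ω)).topologicalClosure

/-! ### The bilinear forms and Galerkin eigenpairs -/

/-- `a₁ |ξ|² ≤ A(x) ξ · ξ ≤ a₂ |ξ|²` on `Ω`, with `A(x)` symmetric. -/
def IsUniformlyElliptic {d : ℕ} (Ω : Set (E d)) (A : E d → Matrix (Fin d) (Fin d) ℝ)
    (a₁ a₂ : ℝ) : Prop :=
  ∀ x ∈ Ω, (A x).IsSymm ∧ ∀ ξ : Fin d → ℝ,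
    a₁ * (ξ ⬝ᵥ ξ) ≤ (A x).mulVec ξ ⬝ᵥ ξ ∧ (A x).mulVec ξ ⬝ᵥ ξ ≤ a₂ * (ξ ⬝ᵥ ξ)

/-- `a(u, v) = ∫_Ω A ∇u · ∇v`. -/
def aForm {d : ℕ} (Ω : Set (E d)) (A : E d → Matrix (Fin d) (Fin d) ℝ) (u v : L2Pair d) : ℝ :=
  ∫ x in Ω, (A x).mulVec (u.2 x).ofLp ⬝ᵥ (v.2 x).ofLp

/-- `b(u, v) = ∫_Ω B u v`. -/
def bForm {d : ℕ} (Ω : Set (E d)) (B : E d → ℝ) (u v : L2Pair d) : ℝ :=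
  ∫ x in Ω, B x * u.1 x * v.1 x

/-- `(μ, w)` with `w ∈ W` satisfies `a(w, v) = μ b(w, v)` for all `v ∈ W`, and `b(w, w)^{1/2} = 1`. -/
def IsGalerkinEigenpair {d : ℕ} (Ω : Set (E d)) (A : E d → Matrix (Fin d) (Fin d) ℝ)
    (B : E d → ℝ) (W : Submodule ℝ (L2Pair d)) (μ : ℝ) (w : L2Pair d) : Prop :=
  w ∈ W ∧ (∀ v ∈ W, aForm Ω A w v = μ * bForm Ω B w v) ∧ √(bForm Ω B w w) = 1

/-! ### Simplices, bisection and triangulations -/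

/-- A `d`-simplex given by its ordered vertices, with a type in `{0, 1, 2}`. The order and the type
prescribe how the simplex is bisected (the type is irrelevant for `d = 2`). -/
structure LSimplex (d : ℕ) where
  vert : Fin (d + 1) → E d
  type : Fin 3

namespace LSimplex

variable {d : ℕ}

/-- The closed simplex. -/
def carrier (K : LSimplex d) : Set (E d) := convexHull ℝ (Set.range K.vert)

/-- `h_K = |K|^{1/d}`. -/
def h (K : LSimplex d) : ℝ := (volume.real K.carrier) ^ (1 / (d : ℝ))

/-- The radius of the largest ball contained in the simplex. -/
def rho (K : LSimplex d) : ℝ := sSup {r | 0 ≤ r ∧ ∃ x, Metric.closedBall x r ⊆ K.carrier}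

/-- The vertices of the side opposite to the `i`-th vertex. -/
def sideVert (K : LSimplex d) (i : Fin (d + 1)) : Set (E d) := K.vert '' {i}ᶜ

/-- The (closed) side opposite to the `i`-th vertex. -/
def side (K : LSimplex d) (i : Fin (d + 1)) : Set (E d) := convexHull ℝ (K.sideVert i)

/-- The outward unit normal of the simplex on its side opposite to the `i`-th vertex: the unique
unit vector that is orthogonal to the side and points away from that vertex. -/
def normal (K : LSimplex d) (i : Fin (d + 1)) : E d :=
  Classical.epsilon fun n => ‖n‖ = 1 ∧
    (∀ j k, j ≠ i → k ≠ i → inner ℝ n (K.vert j - K.vert k) = 0) ∧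
    ∀ j, j ≠ i → inner ℝ n (K.vert i - K.vert j) < 0

/-- The ordered vertices of the two children. The edge from vertex `0` to vertex `1` is halved.
For `d = 2` the newest vertex is always the last one and the refinement edge is opposite to it
(newest-vertex bisection); for `d = 3` this is the bisection of Kossaczký. -/
def childVert : (d : ℕ) → Fin 3 → Bool → (Fin (d + 1) → E d) → (Fin (d + 1) → E d)
  | 2, _, false, z => ![z 2, z 0, midpoint ℝ (z 0) (z 1)]
  | 2, _, true, z => ![z 1, z 2, midpoint ℝ (z 0) (z 1)]
  | 3, _, false, z => ![z 0, z 2, z 3, midpoint ℝ (z 0) (z 1)]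
  | 3, 0, true, z => ![z 1, z 3, z 2, midpoint ℝ (z 0) (z 1)]
  | 3, _, true, z => ![z 1, z 2, z 3, midpoint ℝ (z 0) (z 1)]
  | _, _, _, z => z

/-- The two children of a simplex; the type is increased by one modulo three. -/
def child (K : LSimplex d) (c : Bool) : LSimplex d where
  vert := childVert d K.type c K.vert
  type := K.type + 1

/-- `K.IsDescendant n K'`: the simplex `K'` arises from `K` by `n` successive bisections. -/
inductive IsDescendant (K : LSimplex d) : ℕ → LSimplex d → Prop
  | refl : IsDescendant K 0 K
  | step (n : ℕ) (K' : LSimplex d) (c : Bool) :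
      IsDescendant K n K' → IsDescendant K (n + 1) (K'.child c)

end LSimplex

/-- The number `n_d` of bisections: `3` for `d = 2` and `6` for `d = 3`. -/
def nBisect (d : ℕ) : ℕ := if d = 2 then 3 else 6

/-- Conforming triangulations of `Ω`: finitely many nondegenerate simplices that cover the closure
of `Ω`, any two of which intersect in the full common face spanned by their common vertices (which
is empty if there are none); no simplex occurs twice with different labels. -/
structure IsTriangulation {d : ℕ} (Ω : Set (E d)) (M : Finset (LSimplex d)) : Prop where
  nondegenerate : ∀ K ∈ M, AffineIndependent ℝ K.vert
  unique_label : ∀ K ∈ M, ∀ K' ∈ M, Set.range K.vert = Set.range K'.vert → K = K'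
  cover : ⋃ K ∈ M, K.carrier = closure Ω
  conforming : ∀ K ∈ M, ∀ K' ∈ M,
    K.carrier ∩ K'.carrier = convexHull ℝ (Set.range K.vert ∩ Set.range K'.vert)

variable {d : ℕ}

/-- `κ_M = max_K diam(K) / ρ_K`. -/
def regularity (M : Finset (LSimplex d)) : ℝ :=
  ⨆ K : {K // K ∈ M}, Metric.diam K.1.carrier / K.1.rho

open Classical in
/-- The neighbours of `K`: the elements that intersect `K`, including `K` itself. -/
def neighbors (M : Finset (LSimplex d)) (K : LSimplex d) : Finset (LSimplex d) :=
  M.filter fun K' => (K'.carrier ∩ K.carrier).Nonempty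

/-- The patch of `K`, the union of its neighbours. -/
def patch (M : Finset (LSimplex d)) (K : LSimplex d) : Set (E d) :=
  ⋃ K' ∈ neighbors M K, K'.carrier

/-- `M'` arises from `M` by bisections, and every element of `N` is bisected at least `n` times:
each element of `M'` is a descendant of an element of `M`, and of generation at least `n` when
it descends from an element of `N`. -/
def IsBisectionRefinement (M M' N : Finset (LSimplex d)) (n : ℕ) : Prop :=
  (∀ K' ∈ M', ∃ K ∈ M, ∃ m, K.IsDescendant m K') ∧
    ∀ K ∈ N, ∀ K' ∈ M', ∀ m, K.IsDescendant m K' → n ≤ m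

/-- `A` is Lipschitz continuous inside every element, that is, its discontinuities are aligned with
the sides of the triangulation. -/
def IsAligned (M : Finset (LSimplex d)) (A : E d → Matrix (Fin d) (Fin d) ℝ) : Prop :=
  ∀ K ∈ M, ∀ i j, ∃ L : ℝ≥0, LipschitzOnWith L (fun x => A x i j) (interior K.carrier)

/-! ### Finite element spaces -/

/-- The value of a polynomial in `d` variables at a point of `ℝ^d`. -/
def pval (p : MvPolynomial (Fin d) ℝ) (x : E d) : ℝ := MvPolynomial.eval x.ofLp p

/-- The gradient of a polynomial. -/
def pgrad (p : MvPolynomial (Fin d) ℝ) (x : E d) : Fin d → ℝ :=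
  fun i => pval (MvPolynomial.pderiv i p) x

/-- The finite element space of the functions of `H¹₀(Ω)` that are polynomials of degree at most
`ℓ` on each element. -/
def feSpace (Ω : Set (E d)) (ℓ : ℕ) (M : Finset (LSimplex d)) : Submodule ℝ (L2Pair d) where
  carrier := {v | v ∈ H10 Ω ∧ ∀ K ∈ M, ∃ p : MvPolynomial (Fin d) ℝ, p.totalDegree ≤ ℓ ∧
    (v.1 : E d → ℝ) =ᵐ[volume.restrict K.carrier] pval p}
  zero_mem' := by
    refine ⟨Submodule.zero_mem _, fun K _ => ⟨0, by simp, ?_⟩⟩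
    filter_upwards [ae_restrict_of_ae (Lp.coeFn_zero ℝ 2 (volume : Measure (E d)))] with x hx
    simp only [Prod.fst_zero, hx, Pi.zero_apply, pval, map_zero]
  add_mem' := by
    rintro u v ⟨hu, hu'⟩ ⟨hv, hv'⟩
    refine ⟨Submodule.add_mem _ hu hv, fun K hK => ?_⟩
    obtain ⟨p, hp, hp'⟩ := hu' K hK
    obtain ⟨q, hq, hq'⟩ := hv' K hK
    refine ⟨p + q, (MvPolynomial.totalDegree_add p q).trans (max_le hp hq), ?_⟩
    filter_upwards [ae_restrict_of_ae (Lp.coeFn_add u.1 v.1), hp', hq'] with x hx h1 h2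
    simp only [Prod.fst_add, hx, Pi.add_apply, h1, h2, pval, map_add]
  smul_mem' := by
    rintro c u ⟨hu, hu'⟩
    refine ⟨Submodule.smul_mem _ c hu, fun K hK => ?_⟩
    obtain ⟨p, hp, hp'⟩ := hu' K hK
    refine ⟨c • p, (MvPolynomial.totalDegree_smul_le c p).trans hp, ?_⟩
    filter_upwards [ae_restrict_of_ae (Lp.coeFn_smul c u.1), hp'] with x hx h1
    simp only [Prod.smul_fst, hx, Pi.smul_apply, h1, pval, MvPolynomial.smul_eval, smul_eq_mul]

/-- The polynomial that represents the finite element function `v` on the element `K`. -/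
def localPoly (v : L2Pair d) (K : LSimplex d) : MvPolynomial (Fin d) ℝ :=
  Classical.epsilon fun p => (v.1 : E d → ℝ) =ᵐ[volume.restrict K.carrier] pval p

/-! ### Residuals, projections and the estimator -/

/-- The `L²` norm with respect to the measure `ν`. -/
def l2norm {F : Type*} [NormedAddCommGroup F] (ν : Measure (E d)) (f : E d → F) : ℝ :=
  (eLpNorm f 2 ν).toReal

/-- The surface measure on the side of `K` opposite to the `i`-th vertex. -/
def sideMeasure (K : LSimplex d) (i : Fin (d + 1)) : Measure (E d) :=
  (Measure.euclideanHausdorffMeasure (d - 1)).restrict (K.side i)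

/-- The divergence of a vector field. -/
def divergence (F : E d → Fin d → ℝ) (x : E d) : ℝ :=
  ∑ i, fderiv ℝ (fun y => F y i) x (EuclideanSpace.single i 1)

/-- The element residual `R(μ, v) = -∇·(A∇v) - μ B v` on the element `K`. The field `A∇v` is
Lipschitz continuous inside `K`, so that its divergence exists almost everywhere. -/
def elemResidual (A : E d → Matrix (Fin d) (Fin d) ℝ) (B : E d → ℝ) (μ : ℝ) (v : L2Pair d)
    (K : LSimplex d) (x : E d) : ℝ :=
  -divergence (fun y => (A y).mulVec (pgrad (localPoly v K) y)) x
    - μ * B x * pval (localPoly v K) x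

/-- The continuous extension of `A` from the interior of `K` to the closed simplex `K`. -/
def traceCoeff (A : E d → Matrix (Fin d) (Fin d) ℝ) (K : LSimplex d) (x : E d) :
    Matrix (Fin d) (Fin d) ℝ :=
  Matrix.of fun i j => extendFrom (interior K.carrier) (fun y => A y i j) x

/-- The outward flux `(A∇v)|_K · n` on the side of `K` opposite to the `i`-th vertex. -/
def flux (A : E d → Matrix (Fin d) (Fin d) ℝ) (v : L2Pair d) (K : LSimplex d)
    (i : Fin (d + 1)) (x : E d) : ℝ :=
  (traceCoeff A K x).mulVec (pgrad (localPoly v K) x) ⬝ᵥ (K.normal i).ofLp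

open Classical in
/-- The jump residual on the side of `K` opposite to the `i`-th vertex. For an interior side, that
is, a side shared by `K` and another element, it is the sum of the outward fluxes of the elements
that have this side; it is zero on the boundary of the domain. -/
def jump (A : E d → Matrix (Fin d) (Fin d) ℝ) (M : Finset (LSimplex d)) (v : L2Pair d)
    (K : LSimplex d) (i : Fin (d + 1)) (x : E d) : ℝ :=
  if ∃ K' ∈ M, K' ≠ K ∧ ∃ j, K'.sideVert j = K.sideVert i then
    ∑ K' ∈ M, ∑ j, if K'.sideVert j = K.sideVert i then flux A v K' j x else 0
  else 0

/-- The `L²(ν)`-orthogonal projection of `f` onto the polynomials of degree at most `k`. -/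
def l2proj (ν : Measure (E d)) (k : ℕ) (f : E d → ℝ) : E d → ℝ :=
  pval (Classical.epsilon fun q : MvPolynomial (Fin d) ℝ => q.totalDegree ≤ k ∧
    ∀ p : MvPolynomial (Fin d) ℝ, p.totalDegree ≤ k → ∫ x, (f x - pval q x) * pval p x ∂ν = 0)

/-- The local estimator, `η(μ, v; K)² = h_K² ‖R(μ, v)‖_K² + h_K ‖J(v)‖_{∂K}²`. -/
def estimator (A : E d → Matrix (Fin d) (Fin d) ℝ) (B : E d → ℝ) (M : Finset (LSimplex d))
    (μ : ℝ) (v : L2Pair d) (K : LSimplex d) : ℝ :=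
  √(K.h ^ 2 * l2norm (volume.restrict K.carrier) (elemResidual A B μ v K) ^ 2
    + K.h * ∑ i, l2norm (sideMeasure K i) (jump A M v K i) ^ 2)

/-- The norm over the patch of `K` of `R - R̄`, where `R̄` is on each neighbour `K'` of `K` the
`L²(K')`-projection of `R = R(μ, v)` onto the polynomials of degree at most `k`. -/
def elemOsc (A : E d → Matrix (Fin d) (Fin d) ℝ) (B : E d → ℝ) (M : Finset (LSimplex d))
    (k : ℕ) (μ : ℝ) (v : L2Pair d) (K : LSimplex d) : ℝ :=
  √(∑ K' ∈ neighbors M K, l2norm (volume.restrict K'.carrier)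
    (elemResidual A B μ v K'
      - l2proj (volume.restrict K'.carrier) k (elemResidual A B μ v K')) ^ 2)

/-- The norm over `∂K` of `J - J̄`, where `J̄` is on each side `S` of `K` the `L²(S)`-projection of
`J = J(v)` onto the polynomials of degree at most `k`. -/
def jumpOsc (A : E d → Matrix (Fin d) (Fin d) ℝ) (M : Finset (LSimplex d))
    (k : ℕ) (v : L2Pair d) (K : LSimplex d) : ℝ :=
  √(∑ i, l2norm (sideMeasure K i)
    (jump A M v K i - l2proj (sideMeasure K i) k (jump A M v K i)) ^ 2)

end EigenFEM

end

open MeasureTheory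
open scoped ContDiff NNReal Topology

noncomputable section

namespace EigenFEM

variable {d : ℕ}

section

/-! ### Hyperplanes and the divergence theorem in a half-space -/

/-! The theorem is the bubble-function argument for the efficiency of residual estimators, with
bubbles taken from the refined finite element space, so that the equation for `w` can be tested with
them. Let `v` be a Lipschitz function supported in one element, or in two elements with a common
side, that is a polynomial of degree at most `ℓ` on every descendant of generation `nBisect d`. Then
`v` lies in the space of the refinement, hence in `W`, and the equation for `w` turns the sum over
the elements of `∫ A∇u·∇v - λ B u v` into `-∫ A∇(w-u)·∇v + ∫ B (μw-λu) v`. This gives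
`abs_residual_le`. Integration by parts on each element (`integral_parts_elem`) rewrites the same
sum with the element residual and the flux through one side. With `v` the bubble of an element times
the projected residual one bounds `R` (`IsDiscreteProblem.elem_bound`); with `v` the bubble of a
side times an extension of the projected jump one bounds `J` (`IsDiscreteProblem.side_bound`). The
norm equivalences and inverse estimates come from one reference simplex by affine transport
(`exists_bubbleEstimates`); shape regularity turns them into bounds in `h_T`
(`exists_shape_constant`).

The bubbles are explicit: positive parts of minima of `1` and integer linear forms in the
barycentric coordinates, one list of forms for each type of simplex. That they are linear on all
descendants of generation `nBisect d` is a finite statement about integers (`allDesc_elemForms`,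
`allDesc_sideForms`). A factor of degree `ℓ - 1` then raises the degree to `ℓ` at most.

The two halves of a side bubble must have the same trace on the common side. For `d = 2` this is
automatic. For `d = 3` the trace depends on which vertex of the face is opposite to the edge halved
first, and the labels of neighbouring elements are not assumed to be compatible. Conformity of the
refinement forces the agreement (`apex_match`): otherwise two different medians of the face would
both be resolved, their intersection, the barycentre, would be a vertex of the refinement, and its
coordinates `1/3` would have to be dyadic.

Two analytic facts support this. Since the test functions vanish on the relevant half-space outside
the simplex, the divergence theorem for half-spaces suffices (`integral_halfSpace_lineDeriv`). And a
Lipschitz function of compact support that vanishes outside `Ω` belongs to `H¹₀(Ω)`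
(`repH10_of_lipschitz`). -/

theorem exists_hyperplane_coordinates {m : ℕ} (n : E (m + 1)) (hn : ‖n‖ = 1) :
    ∃ ι : E m →ₗᵢ[ℝ] E (m + 1), (∀ y, inner ℝ n (ι y) = 0) ∧
      (∀ x : E (m + 1), ∃ y, x = inner ℝ n x • n + ι y) ∧
      MeasurePreserving (fun p : ℝ × E m => p.1 • n + ι p.2) (volume.prod volume) volume := by
  obtain ⟨b, hb⟩ := Orthonormal.exists_orthonormalBasis_extension_of_card_eq (𝕜 := ℝ)
    (E := E (m + 1)) (ι := Fin (m + 1)) (by simp) (v := fun _ => n) (s := {0})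
    (by
      constructor
      · intro i; simpa using hn
      · intro i j hij; exact absurd (Subsingleton.elim i j) hij)
  have hb0 : b 0 = n := hb 0 rfl
  let ιl : E m →ₗ[ℝ] E (m + 1) :=
    { toFun := fun y => ∑ j : Fin m, y j • b j.succ
      map_add' := fun x y => by simp [add_smul, Finset.sum_add_distrib]
      map_smul' := fun c y => by simp [mul_smul, Finset.smul_sum] }
  have hιl : ∀ y, ιl y = ∑ j : Fin m, y j • b j.succ := fun y => rfl
  have key : ∀ (s : ℝ) (y : E m), s • n + ιl y =
      b.repr.symm (WithLp.toLp 2 (Fin.cons s y.ofLp : Fin (m + 1) → ℝ)) := by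
    intro s y
    rw [← b.sum_repr_symm, Fin.sum_univ_succ, hb0, hιl]
    simp
  have hnorm : ∀ y, ‖ιl y‖ = ‖y‖ := by
    intro y
    have h0 := key 0 y
    rw [zero_smul, zero_add] at h0
    rw [h0, LinearIsometryEquiv.norm_map, EuclideanSpace.norm_eq, EuclideanSpace.norm_eq,
      Fin.sum_univ_succ]
    simp
  refine ⟨⟨ιl, hnorm⟩, ?_, ?_, ?_⟩
  · intro y
    change inner ℝ n (ιl y) = 0
    rw [hιl, inner_sum]
    refine Finset.sum_eq_zero fun j _ => ?_
    rw [inner_smul_right, ← hb0, b.inner_eq_ite]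
    simp [(Fin.succ_ne_zero j).symm]
  · intro x
    refine ⟨WithLp.toLp 2 fun j => b.repr x j.succ, ?_⟩
    change x = inner ℝ n x • n + ιl _
    rw [hιl]
    conv_lhs => rw [← b.sum_repr x, Fin.sum_univ_succ, hb0]
    rw [b.repr_apply_apply, hb0]
  · have h1 : MeasurePreserving (fun p : ℝ × E m => (p.1, p.2.ofLp)) (volume.prod volume)
        (volume.prod volume) :=
      (MeasurePreserving.id volume).prod (PiLp.volume_preserving_ofLp (Fin m))
    have h2 := (volume_preserving_piFinSuccAbove (fun _ : Fin (m + 1) => ℝ) 0).symm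
    have h3 := PiLp.volume_preserving_toLp (Fin (m + 1))
    have h4 := b.measurePreserving_repr_symm
    have h := h4.comp (h3.comp (h2.comp h1))
    convert h using 1
    funext p
    change p.1 • n + ιl p.2 = _
    rw [key]
    simp only [MeasurableEquiv.piFinSuccAbove, Function.comp]
    congr 2
    funext j
    refine Fin.cases ?_ (fun j => ?_) j <;> simp [Fin.consEquiv]

/-- An isometry carries Hausdorff measure to the Hausdorff measure of its range, and on `E m` itself
this is Lebesgue measure. Surface integrals over hyperplanes thus become ordinary integrals. -/
theorem map_hyperplane_volume {m : ℕ} (n : E (m + 1)) (hn : ‖n‖ = 1) (ι : E m →ₗᵢ[ℝ] E (m + 1))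
    (h0 : ∀ y, inner ℝ n (ι y) = 0) (h1 : ∀ x : E (m + 1), ∃ y, x = inner ℝ n x • n + ι y) (c : ℝ) :
    (volume : Measure (E m)).map (fun y => c • n + ι y) =
      (Measure.euclideanHausdorffMeasure m).restrict {x | inner ℝ n x = c} := by
  have hi : Isometry (fun y => c • n + ι y) := (isometry_add_left (c • n)).comp ι.isometry
  have hr : Set.range (fun y => c • n + ι y) = {x | inner ℝ n x = c} := by
    ext x
    constructor
    · rintro ⟨y, rfl⟩
      simp [inner_add_right, inner_smul_right, h0, hn]
    · intro hx
      obtain ⟨y, hy⟩ := h1 x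
      refine ⟨y, ?_⟩
      rw [Set.mem_ofPred_eq] at hx
      rw [hx] at hy
      exact hy.symm
  rw [← hr, ← hi.map_euclideanHausdorffMeasure, EuclideanSpace.euclideanHausdorffMeasure_eq_volume]

/-- Translating `g` by `t e` amounts to moving the half-space by `t ⟨e, n⟩` along its normal. The
difference quotients of `g` over the half-space are therefore those of `s ↦ ∫_{⟨n,x⟩ ≤ s} g`, whose
derivative at `c` is the integral over the slice by Fubini and the fundamental theorem of calculus.
-/
theorem integral_halfSpace_lineDeriv {m : ℕ} (n : E (m + 1)) (hn : ‖n‖ = 1) (c : ℝ) (C : ℝ≥0)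
    (g : E (m + 1) → ℝ) (hg : LipschitzWith C g) (hgc : HasCompactSupport g) (e : E (m + 1)) :
    ∫ x in {x | inner ℝ n x ≤ c}, lineDeriv ℝ g x e =
      inner ℝ e n * ∫ x in {x | inner ℝ n x = c}, g x ∂Measure.euclideanHausdorffMeasure m := by
  obtain ⟨ι, h0, h1, hmp⟩ := exists_hyperplane_coordinates n hn
  set φ : ℝ → ℝ := fun s => ∫ y, g (s • n + ι y) with hφ
  have hgi : Integrable g := hg.continuous.integrable_of_hasCompactSupport hgc
  have hmeas : ∀ s : ℝ, MeasurableSet {x : E (m + 1) | inner ℝ n x ≤ s} := fun s =>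
    (isClosed_le (by fun_prop) continuous_const).measurableSet
  have hΨ : Continuous (fun p : ℝ × E m => p.1 • n + ι p.2) := by fun_prop
  have hgp : Integrable (fun p : ℝ × E m => g (p.1 • n + ι p.2)) (volume.prod volume) :=
    hmp.integrable_comp_of_integrable hgi
  obtain ⟨R, hR⟩ := hgc.isCompact.isBounded.subset_closedBall 0
  have hzero : ∀ x, R < ‖x‖ → g x = 0 := fun x hx => by
    by_contra h
    have := hR (subset_tsupport g h)
    rw [mem_closedBall_zero_iff] at this
    linarith
  have hΦ : ∀ s, ∫ x in {x | inner ℝ n x ≤ s}, g x = ∫ r in Set.Iic s, φ r := by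
    intro s
    rw [← hmp.map_eq, setIntegral_map (hmeas s) hg.continuous.aestronglyMeasurable
      hΨ.aemeasurable]
    have : (fun p : ℝ × E m => p.1 • n + ι p.2) ⁻¹' {x | inner ℝ n x ≤ s} =
        Set.Iic s ×ˢ Set.univ := by
      ext p
      simp [inner_add_right, inner_smul_right, h0, hn]
    rw [this, setIntegral_prod _ hgp.integrableOn]
    simp [hφ]
  -- By orthogonality `‖s • n + ι y‖ ≥ ‖y‖`, so one ball in `y` serves for all `s`.
  have hφc : Continuous φ := by
    have : φ = fun s => ∫ y in Metric.closedBall 0 R, g (s • n + ι y) := by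
      funext s
      rw [hφ]
      refine (setIntegral_eq_integral_of_forall_compl_eq_zero fun y hy => hzero _ ?_).symm
      rw [mem_closedBall_zero_iff, not_le] at hy
      refine hy.trans_le ?_
      have h2 : ‖s • n + ι y‖ ^ 2 = ‖s • n‖ ^ 2 + ‖ι y‖ ^ 2 := by
        have := norm_add_sq_real (s • n) (ι y)
        rw [real_inner_smul_left, h0] at this
        simpa using this
      rw [ι.norm_map] at h2
      exact le_of_sq_le_sq (by nlinarith [sq_nonneg ‖s • n‖]) (norm_nonneg _)
    rw [this]
    exact continuous_parametric_integral_of_continuous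
      (show Continuous (Function.uncurry fun (s : ℝ) (y : E m) => g (s • n + ι y)) from
        hg.continuous.comp hΨ) (isCompact_closedBall 0 R)
  have hφi : Integrable φ := hgp.integral_prod_left
  have hder : HasDerivAt (fun s => ∫ x in {x | inner ℝ n x ≤ s}, g x) (φ c) c := by
    have h2 : (fun s => ∫ x in {x | inner ℝ n x ≤ s}, g x) =
        fun s => (∫ r in c..s, φ r) + ∫ r in Set.Iic c, φ r := by
      funext s
      rw [hΦ, ← intervalIntegral.integral_Iic_sub_Iic hφi.integrableOn hφi.integrableOn]
      ring
    rw [h2]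
    exact (intervalIntegral.integral_hasDerivAt_right (hφc.intervalIntegrable _ _)
      hφc.stronglyMeasurable.stronglyMeasurableAtFilter hφc.continuousAt).add_const _
  have hside : ∫ x in {x | inner ℝ n x = c}, g x ∂Measure.euclideanHausdorffMeasure m = φ c := by
    rw [← map_hyperplane_volume n hn ι h0 h1 c, integral_map (by fun_prop)
      hg.continuous.aestronglyMeasurable]
  rw [hside]
  have hbm : MeasurableSet (Metric.closedBall (0 : E (m + 1)) (R + ‖e‖)) := measurableSet_closedBall
  set H : Set (E (m + 1)) := {x | inner ℝ n x ≤ c} with hH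
  have hHm : MeasurableSet H := hmeas c
  -- The limit theorem for difference quotients needs an integrable weight, and the half-space has
  -- infinite measure. The radius `R + ‖e‖` contains the supports of all translates by `t • e` with
  -- `0 < t ≤ 1`.
  have hwi : Integrable ((H ∩ Metric.closedBall 0 (R + ‖e‖)).indicator
      (fun _ : E (m + 1) => (1 : ℝ))) := by
    refine (integrable_indicator_iff (hHm.inter hbm)).2 (integrableOn_const ?_)
    exact ((measure_mono Set.inter_subset_right).trans_lt measure_closedBall_lt_top).ne
  have hlim := hg.integral_inv_smul_sub_mul_tendsto_integral_lineDeriv_mul hwi e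
  have hL : ∫ x, lineDeriv ℝ g x e * (H ∩ Metric.closedBall 0 (R + ‖e‖)).indicator
      (fun _ : E (m + 1) => (1 : ℝ)) x = ∫ x in H, lineDeriv ℝ g x e := by
    rw [← integral_indicator hHm]
    congr 1
    funext x
    by_cases hx : x ∈ H
    · by_cases hx2 : x ∈ Metric.closedBall (0 : E (m + 1)) (R + ‖e‖)
      · rw [Set.indicator_of_mem (Set.mem_inter hx hx2), Set.indicator_of_mem hx, mul_one]
      · have : lineDeriv ℝ g x e = 0 := by
          have hev : g =ᶠ[𝓝 x] fun _ => (0 : ℝ) := by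
            have ho : IsOpen {x : E (m + 1) | R < ‖x‖} := isOpen_lt continuous_const continuous_norm
            have hxo : x ∈ {x : E (m + 1) | R < ‖x‖} := by
              rw [mem_closedBall_zero_iff, not_le] at hx2
              exact lt_of_le_of_lt (le_add_of_nonneg_right (norm_nonneg e)) hx2
            filter_upwards [ho.mem_nhds hxo] with y hy using hzero y hy
          rw [hev.lineDeriv_eq]
          simp [lineDeriv]
        simp [this, hx]
    · rw [Set.indicator_of_notMem hx, Set.indicator_of_notMem fun h => hx h.1, mul_zero]
  rw [hL] at hlim
  refine tendsto_nhds_unique hlim ?_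
  have hsl : HasDerivAt (fun t : ℝ => ∫ x in {x | inner ℝ n x ≤ c + t * inner ℝ e n}, g x)
      (inner ℝ e n * φ c) 0 := by
    have h3 : HasDerivAt (fun t : ℝ => c + t * inner ℝ e n) (inner ℝ e n) 0 := by
      simpa using ((hasDerivAt_id (0 : ℝ)).mul_const (inner ℝ e n)).const_add c
    have := HasDerivAt.comp (0 : ℝ) (h₂ := fun s => ∫ x in {x | inner ℝ n x ≤ s}, g x)
      (by simpa using hder) h3
    simpa [mul_comm, Function.comp_def] using this
  refine hsl.tendsto_slope_zero_right.congr' ?_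
  filter_upwards [Ioc_mem_nhdsGT zero_lt_one] with t ht
  have hshift : ∫ x in {x | inner ℝ n x ≤ c + t * inner ℝ e n}, g x = ∫ x in H, g (x + t • e) := by
    rw [← integral_indicator (hmeas _), ← integral_indicator hHm,
      ← integral_add_right_eq_self _ (t • e)]
    congr 1
    funext x
    have : x + t • e ∈ {x : E (m + 1) | inner ℝ n x ≤ c + t * inner ℝ e n} ↔ x ∈ H := by
      simp [hH, inner_add_right, inner_smul_right, real_inner_comm]
    by_cases hx : x ∈ H
    · rw [Set.indicator_of_mem (this.2 hx), Set.indicator_of_mem hx]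
    · rw [Set.indicator_of_notMem (fun h => hx (this.1 h)), Set.indicator_of_notMem hx]
  have hgs : Integrable fun x => g (x + t • e) := hgi.comp_add_right (t • e)
  simp only [zero_add, zero_mul, add_zero]
  rw [hshift, ← integral_sub hgs.integrableOn hgi.integrableOn, ← integral_smul,
    ← integral_indicator hHm]
  congr 1
  funext x
  by_cases hx : x ∈ H
  · by_cases hx2 : x ∈ Metric.closedBall (0 : E (m + 1)) (R + ‖e‖)
    · rw [Set.indicator_of_mem (Set.mem_inter hx hx2), Set.indicator_of_mem hx, mul_one]
    · rw [mem_closedBall_zero_iff, not_le] at hx2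
      have hz1 : g x = 0 := hzero x (lt_of_le_of_lt (le_add_of_nonneg_right (norm_nonneg e)) hx2)
      have hz2 : g (x + t • e) = 0 := by
        refine hzero _ ?_
        have h5 := norm_sub_le (x + t • e) (t • e)
        rw [add_sub_cancel_right, norm_smul, Real.norm_of_nonneg ht.1.le] at h5
        nlinarith [ht.2, norm_nonneg e]
      simp [hz1, hz2, hx]
  · rw [Set.indicator_of_notMem hx, Set.indicator_of_notMem fun h => hx h.1, mul_zero]

end

section

/-! ### Piecewise linear bubble functions in barycentric coordinates -/


/-- The value of a linear form with integer coefficients. -/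
def formVal (f : Fin (d + 1) → ℤ) (x : Fin (d + 1) → ℝ) : ℝ := ∑ j, (f j : ℝ) * x j

/-- The minimum of `1` and of finitely many linear forms. -/
def capMin (L : List (Fin (d + 1) → ℤ)) (x : Fin (d + 1) → ℝ) : ℝ :=
  L.foldr (fun f r => min (formVal f x) r) 1

/-- The positive part of `capMin`. -/
def bubble (L : List (Fin (d + 1) → ℤ)) (x : Fin (d + 1) → ℝ) : ℝ := max 0 (capMin L x)

theorem capMin_le_one (L : List (Fin (d + 1) → ℤ)) (x : Fin (d + 1) → ℝ) : capMin L x ≤ 1 := by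
  induction L with
  | nil => simp [capMin]
  | cons f L ih => exact (min_le_right _ _).trans ih

theorem capMin_le (L : List (Fin (d + 1) → ℤ)) (x : Fin (d + 1) → ℝ) {f : Fin (d + 1) → ℤ}
    (hf : f ∈ L) : capMin L x ≤ formVal f x := by
  induction L with
  | nil => simp at hf
  | cons g L ih =>
    rcases List.mem_cons.1 hf with rfl | h
    · exact min_le_left _ _
    · exact (min_le_right _ _).trans (ih h)

theorem le_capMin {L : List (Fin (d + 1) → ℤ)} {x : Fin (d + 1) → ℝ} {c : ℝ} (hc : c ≤ 1)
    (h : ∀ f ∈ L, c ≤ formVal f x) : c ≤ capMin L x := by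
  induction L with
  | nil => simpa [capMin] using hc
  | cons g L ih =>
    exact le_min (h g (by simp)) (ih fun f hf => h f (by simp [hf]))

theorem bubble_nonneg (L : List (Fin (d + 1) → ℤ)) (x : Fin (d + 1) → ℝ) : 0 ≤ bubble L x :=
  le_max_left _ _

theorem bubble_le_one (L : List (Fin (d + 1) → ℤ)) (x : Fin (d + 1) → ℝ) : bubble L x ≤ 1 :=
  max_le zero_le_one (capMin_le_one L x)

theorem formVal_pos_of_bubble_ne_zero {L : List (Fin (d + 1) → ℤ)} {x : Fin (d + 1) → ℝ}
    (h : bubble L x ≠ 0) {f : Fin (d + 1) → ℤ} (hf : f ∈ L) : 0 < formVal f x := by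
  have : 0 < bubble L x := lt_of_le_of_ne (bubble_nonneg L x) (Ne.symm h)
  rcases lt_max_iff.1 this with h | h
  · exact absurd h (lt_irrefl _)
  · exact h.trans_le (capMin_le L x hf)

theorem continuous_formVal (f : Fin (d + 1) → ℤ) : Continuous (formVal f) := by
  unfold formVal
  fun_prop

theorem continuous_bubble (L : List (Fin (d + 1) → ℤ)) : Continuous (bubble L) := by
  unfold bubble
  refine continuous_const.max ?_
  induction L with
  | nil => exact continuous_const
  | cons f L ih => exact (continuous_formVal f).min ih

theorem formVal_sum {ι : Type*} (s : Finset ι) (f : Fin (d + 1) → ℤ) (w : ι → ℝ)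
    (V : ι → Fin (d + 1) → ℝ) :
    formVal f (fun j => ∑ k ∈ s, w k * V k j) = ∑ k ∈ s, w k * formVal f (V k) := by
  simp only [formVal, Finset.mul_sum]
  rw [Finset.sum_comm]
  refine Finset.sum_congr rfl fun k _ => Finset.sum_congr rfl fun j _ => by ring

/-! ### Integer coordinates of the descendants of a simplex -/

/-- The integer counterpart of `LSimplex.childVert`; all coordinates are scaled by two. -/
def childCoord : (d : ℕ) → Fin 3 → Bool → (Fin (d + 1) → Fin (d + 1) → ℤ) →
    (Fin (d + 1) → Fin (d + 1) → ℤ)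
  | 2, _, false, z => ![2 * z 2, 2 * z 0, z 0 + z 1]
  | 2, _, true, z => ![2 * z 1, 2 * z 2, z 0 + z 1]
  | 3, _, false, z => ![2 * z 0, 2 * z 2, 2 * z 3, z 0 + z 1]
  | 3, 0, true, z => ![2 * z 1, 2 * z 3, 2 * z 2, z 0 + z 1]
  | 3, _, true, z => ![2 * z 1, 2 * z 2, 2 * z 3, z 0 + z 1]
  | _, _, _, z => z

/-- `P` holds for the integer coordinates of all descendants of generation `n`. -/
def allDesc (P : (Fin (d + 1) → Fin (d + 1) → ℤ) → Bool) :
    ℕ → Fin 3 → (Fin (d + 1) → Fin (d + 1) → ℤ) → Bool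
  | 0, _, z => P z
  | n + 1, t, z =>
    allDesc P n (t + 1) (childCoord d t false z) && allDesc P n (t + 1) (childCoord d t true z)

/-- The integer value of a linear form. -/
def formInt (f z : Fin (d + 1) → ℤ) : ℤ := ∑ j, f j * z j

/-- A criterion for `bubble L` to be linear on the simplex with the vertices `z / N`. -/
def linearOn (L : List (Fin (d + 1) → ℤ)) (N : ℤ) (z : Fin (d + 1) → Fin (d + 1) → ℤ) : Bool :=
  (L.any fun f => decide (∀ k, formInt f (z k) ≤ 0)) ||
  (L.any fun f => decide (∀ k, 0 ≤ formInt f (z k) ∧ formInt f (z k) ≤ N) &&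
    L.all fun g => decide (∀ k, formInt f (z k) ≤ formInt g (z k)))

/-- The difference of the coordinates `a` and `b` does not change sign on the part with vanishing
`i`-th coordinate. -/
def signOn (i a b : Fin (d + 1)) (z : Fin (d + 1) → Fin (d + 1) → ℤ) : Bool :=
  decide (∀ k, z k i = 0 → z k b ≤ z k a) || decide (∀ k, z k i = 0 → z k a ≤ z k b)

/-- The integer coordinates of the vertices of a simplex with respect to itself. -/
def unitCoord (d : ℕ) : Fin (d + 1) → Fin (d + 1) → ℤ := fun i j => if i = j then 1 else 0

namespace LSimplex

theorem childVert_coord (hd : d = 2 ∨ d = 3) (b : AffineBasis (Fin (d + 1)) ℝ (E d)) (t : Fin 3)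
    (c : Bool) (v : Fin (d + 1) → E d) (z : Fin (d + 1) → Fin (d + 1) → ℤ) (N : ℝ)
    (h : ∀ k j, N * b.coord j (v k) = z k j) (k j : Fin (d + 1)) :
    2 * N * b.coord j (childVert d t c v k) = childCoord d t c z k j := by
  have hm : ∀ x y, b.coord j (midpoint ℝ x y) = (b.coord j x + b.coord j y) / 2 := by
    intro x y
    rw [AffineMap.map_midpoint, midpoint_eq_smul_add]
    simp [div_eq_inv_mul]
  have h2 : ∀ k, 2 * N * b.coord j (v k) = ((2 * z k) j : ℤ) := by
    intro k
    rw [mul_assoc, h]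
    simp
  have h3 : 2 * N * b.coord j (midpoint ℝ (v 0) (v 1)) = ((z 0 + z 1) j : ℤ) := by
    rw [hm]
    have e0 := h 0 j
    have e1 := h 1 j
    simp only [Pi.add_apply, Int.cast_add]
    linear_combination e0 + e1
  rcases hd with rfl | rfl
  · cases c
    · fin_cases k
      exacts [h2 2, h2 0, h3]
    · fin_cases k
      exacts [h2 1, h2 2, h3]
  · cases c
    · fin_cases k
      exacts [h2 0, h2 2, h2 3, h3]
    · fin_cases t
      · fin_cases k
        exacts [h2 1, h2 3, h2 2, h3]
      · fin_cases k
        exacts [h2 1, h2 2, h2 3, h3]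
      · fin_cases k
        exacts [h2 1, h2 2, h2 3, h3]

/-- The relation appends bisections at the end of the chain, whereas `allDesc` recurses from the
root; this reverses the order. -/
theorem IsDescendant.exists_child {K D : LSimplex d} {n : ℕ} (h : K.IsDescendant (n + 1) D) :
    ∃ c, (K.child c).IsDescendant n D := by
  induction n generalizing D with
  | zero =>
    cases h with
    | step n K' c h =>
      cases h
      exact ⟨c, .refl⟩
  | succ n ih =>
    cases h with
    | step n K' c h =>
      obtain ⟨c', h'⟩ := ih h
      exact ⟨c', .step _ _ _ h'⟩

theorem IsDescendant.exists_intermediate {K D : LSimplex d} {n m : ℕ} (h : K.IsDescendant m D)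
    (hnm : n ≤ m) : ∃ D', K.IsDescendant n D' ∧ D'.IsDescendant (m - n) D := by
  induction h with
  | refl =>
    obtain rfl : n = 0 := by omega
    exact ⟨K, .refl, .refl⟩
  | step m K' c h ih =>
    rcases Nat.lt_or_ge m n with hlt | hge
    · obtain rfl : n = m + 1 := by omega
      exact ⟨_, .step _ _ _ h, by simpa using IsDescendant.refl⟩
    · obtain ⟨D', h1, h2⟩ := ih hge
      refine ⟨D', h1, ?_⟩
      rw [Nat.sub_add_comm hge]
      exact .step _ _ _ h2

theorem childVert_mem (t : Fin 3) (c : Bool) (v : Fin (d + 1) → E d) (k : Fin (d + 1)) :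
    childVert d t c v k ∈ convexHull ℝ (Set.range v) := by
  have h1 : ∀ k, v k ∈ convexHull ℝ (Set.range v) := fun k => subset_convexHull ℝ _ ⟨k, rfl⟩
  have h2 : ∀ i j, midpoint ℝ (v i) (v j) ∈ convexHull ℝ (Set.range v) := fun i j =>
    (convex_convexHull ℝ _).midpoint_mem (h1 i) (h1 j)
  match d, t, c, v, k, h1, h2 with
  | 0, _, _, _, _, h1, _ => exact h1 _
  | 1, _, _, _, _, h1, _ => exact h1 _
  | 2, _, c, v, k, h1, h2 =>
    cases c <;> fin_cases k <;> first | exact h1 _ | exact h2 _ _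
  | 3, t, c, v, k, h1, h2 =>
    cases c
    · fin_cases k <;> first | exact h1 _ | exact h2 _ _
    · fin_cases t <;> fin_cases k <;> first | exact h1 _ | exact h2 _ _
  | _ + 4, _, _, _, _, h1, _ => exact h1 _

theorem IsDescendant.carrier_subset {K D : LSimplex d} {n : ℕ} (h : K.IsDescendant n D) :
    D.carrier ⊆ K.carrier := by
  induction h with
  | refl => exact subset_rfl
  | step n K' c h ih =>
    refine Set.Subset.trans (convexHull_min ?_ (convex_convexHull ℝ _)) ih
    rintro _ ⟨k, rfl⟩
    exact childVert_mem _ _ _ _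

theorem IsDescendant.exists_coord (hd : d = 2 ∨ d = 3) (b : AffineBasis (Fin (d + 1)) ℝ (E d))
    (P : (Fin (d + 1) → Fin (d + 1) → ℤ) → Bool) {D : LSimplex d} {n : ℕ} :
    ∀ {K : LSimplex d} (z : Fin (d + 1) → Fin (d + 1) → ℤ) (N : ℝ),
      (∀ k j, N * b.coord j (K.vert k) = z k j) → allDesc P n K.type z = true →
      K.IsDescendant n D →
        ∃ z', P z' = true ∧ ∀ k j, 2 ^ n * N * b.coord j (D.vert k) = z' k j := by
  induction n with
  | zero =>
    intro K z N hz hP hK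
    cases hK
    exact ⟨z, hP, by simpa using hz⟩
  | succ n ih =>
    intro K z N hz hP hK
    obtain ⟨c, hc⟩ := hK.exists_child
    have hP' : allDesc P n (K.child c).type (childCoord d K.type c z) = true := by
      rw [allDesc, Bool.and_eq_true] at hP
      cases c
      · exact hP.1
      · exact hP.2
    obtain ⟨z', h1, h2⟩ := ih (K := K.child c) _ (2 * N)
      (fun k j => childVert_coord hd b K.type c K.vert z N hz k j) hP' hc
    refine ⟨z', h1, fun k j => ?_⟩
    rw [← h2 k j]
    ring

/-- This transfers a finite check on integers to actual simplices. With the trivial predicate it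
says that the vertices of descendants have dyadic barycentric coordinates. -/
theorem exists_coord_of_isDescendant (hd : d = 2 ∨ d = 3) {K D : LSimplex d}
    (b : AffineBasis (Fin (d + 1)) ℝ (E d)) (hb : ⇑b = K.vert) {n : ℕ} (h : K.IsDescendant n D)
    (P : (Fin (d + 1) → Fin (d + 1) → ℤ) → Bool)
    (hP : allDesc P n K.type (unitCoord d) = true) :
    ∃ z, P z = true ∧ ∀ k j, 2 ^ n * b.coord j (D.vert k) = (z k j : ℤ) := by
  have := IsDescendant.exists_coord hd b P (unitCoord d) 1 (fun k j => by
    rw [← hb, b.coord_apply]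
    simp [unitCoord, eq_comm]) hP h
  simpa using this

theorem allDesc_true (n : ℕ) (t : Fin 3) (z : Fin (d + 1) → Fin (d + 1) → ℤ) :
    allDesc (fun _ => true) n t z = true := by
  induction n generalizing t z with
  | zero => rfl
  | succ n ih => simp [allDesc, ih]

theorem exists_weights_of_mem_carrier {D : LSimplex d} {x : E d} (hx : x ∈ D.carrier) :
    ∃ w : Fin (d + 1) → ℝ, (∀ k, 0 ≤ w k) ∧ ∑ k, w k = 1 ∧ ∑ k, w k • D.vert k = x := by
  have hc : Convex ℝ {x : E d | ∃ w : Fin (d + 1) → ℝ, (∀ k, 0 ≤ w k) ∧ ∑ k, w k = 1 ∧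
      ∑ k, w k • D.vert k = x} := by
    rintro _ ⟨w, hw0, hw1, rfl⟩ _ ⟨w', hw0', hw1', rfl⟩ a b ha hb hab
    refine ⟨fun k => a * w k + b * w' k, fun k => ?_, ?_, ?_⟩
    · have := hw0 k
      have := hw0' k
      positivity
    · rw [Finset.sum_add_distrib, ← Finset.mul_sum, ← Finset.mul_sum, hw1, hw1']
      linarith
    · simp [add_smul, mul_smul, Finset.sum_add_distrib, Finset.smul_sum]
  refine convexHull_min ?_ hc hx
  rintro _ ⟨k, rfl⟩
  exact ⟨Pi.single k 1, fun j => by by_cases h : j = k <;> simp [Pi.single_apply, h], by simp,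
    by simp [Pi.single_apply]⟩

theorem coord_sum (b : AffineBasis (Fin (d + 1)) ℝ (E d)) (w : Fin (d + 1) → ℝ)
    (hw : ∑ k, w k = 1) (v : Fin (d + 1) → E d) (j : Fin (d + 1)) :
    b.coord j (∑ k, w k • v k) = ∑ k, w k * b.coord j (v k) := by
  have h1 := Finset.univ.map_affineCombination v w hw (b.coord j)
  rw [Finset.affineCombination_eq_linear_combination _ _ _ hw,
    Finset.affineCombination_eq_linear_combination _ _ _ hw] at h1
  simpa using h1

theorem formVal_coords (b : AffineBasis (Fin (d + 1)) ℝ (E d)) (w : Fin (d + 1) → ℝ)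
    (hw : ∑ k, w k = 1) (v : Fin (d + 1) → E d) (f : Fin (d + 1) → ℤ) :
    formVal f (b.coords (∑ k, w k • v k)) = ∑ k, w k * formVal f (b.coords (v k)) := by
  rw [← formVal_sum]
  congr 1
  funext j
  rw [AffineBasis.coords_apply, coord_sum b w hw]
  rfl

/-- Inequalities between linear forms pass from the vertices to the whole descendant by convexity.
Either some form is nonpositive there and the bubble vanishes, or one form has values in `[0, 1]`
and lies below all the others, and the bubble coincides with it. -/
theorem bubble_eq_formVal (hd : d = 2 ∨ d = 3) {K D : LSimplex d}
    (b : AffineBasis (Fin (d + 1)) ℝ (E d)) (hb : ⇑b = K.vert) {n : ℕ} (h : K.IsDescendant n D)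
    (L : List (Fin (d + 1) → ℤ)) (hL : allDesc (linearOn L (2 ^ n)) n K.type (unitCoord d) = true) :
    ∃ f : Fin (d + 1) → ℤ, ∀ x ∈ D.carrier, bubble L (b.coords x) = formVal f (b.coords x) := by
  obtain ⟨z, hz, hzc⟩ := exists_coord_of_isDescendant hd b hb h _ hL
  have hN : (0 : ℝ) < 2 ^ n := by positivity
  have hval : ∀ f k, 2 ^ n * formVal f (b.coords (D.vert k)) = (formInt f (z k) : ℤ) := by
    intro f k
    simp only [formVal, formInt, Finset.mul_sum, Int.cast_sum, Int.cast_mul, ← hzc,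
      AffineBasis.coords_apply]
    exact Finset.sum_congr rfl fun j _ => by ring
  have hle : ∀ f k {c : ℤ}, formInt f (z k) ≤ c → 2 ^ n * formVal f (b.coords (D.vert k)) ≤ c := by
    intro f k c hc
    rw [hval]
    exact_mod_cast hc
  simp only [linearOn, Bool.or_eq_true, List.any_eq_true, Bool.and_eq_true, List.all_eq_true,
    decide_eq_true_eq] at hz
  rcases hz with ⟨f, hf, hf0⟩ | ⟨f, hf, hf0, hfg⟩
  · refine ⟨0, fun x hx => ?_⟩
    obtain ⟨w, hw0, hw1, rfl⟩ := exists_weights_of_mem_carrier hx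
    have h1 : formVal f (b.coords (∑ k, w k • D.vert k)) ≤ 0 := by
      rw [formVal_coords b w hw1]
      refine Finset.sum_nonpos fun k _ => mul_nonpos_of_nonneg_of_nonpos (hw0 k) ?_
      have h2 : 2 ^ n * formVal f (b.coords (D.vert k)) ≤ 0 := by exact_mod_cast hle f k (hf0 k)
      exact nonpos_of_mul_nonpos_right h2 hN
    rw [bubble, max_eq_left ((capMin_le L _ hf).trans h1)]
    simp [formVal]
  · refine ⟨f, fun x hx => ?_⟩
    obtain ⟨w, hw0, hw1, rfl⟩ := exists_weights_of_mem_carrier hx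
    have h0 : 0 ≤ formVal f (b.coords (∑ k, w k • D.vert k)) := by
      rw [formVal_coords b w hw1]
      refine Finset.sum_nonneg fun k _ => mul_nonneg (hw0 k) ?_
      have h2 : 0 ≤ 2 ^ n * formVal f (b.coords (D.vert k)) := by
        rw [hval]
        exact_mod_cast (hf0 k).1
      exact nonneg_of_mul_nonneg_right h2 hN
    have h1 : formVal f (b.coords (∑ k, w k • D.vert k)) ≤ 1 := by
      rw [formVal_coords b w hw1, ← hw1]
      refine Finset.sum_le_sum fun k _ => mul_le_of_le_one_right (hw0 k) ?_
      have h2 : 2 ^ n * formVal f (b.coords (D.vert k)) ≤ 2 ^ n * 1 := by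
        have := hle f k (hf0 k).2
        simpa using this
      exact le_of_mul_le_mul_left h2 hN
    have h2 : capMin L (b.coords (∑ k, w k • D.vert k)) =
        formVal f (b.coords (∑ k, w k • D.vert k)) := by
      refine le_antisymm (capMin_le L _ hf) (le_capMin h1 fun g hg => ?_)
      rw [formVal_coords b w hw1, formVal_coords b w hw1]
      refine Finset.sum_le_sum fun k _ => mul_le_mul_of_nonneg_left ?_ (hw0 k)
      have h2 : 2 ^ n * formVal f (b.coords (D.vert k)) ≤
        2 ^ n * formVal g (b.coords (D.vert k)) := by
        rw [hval, hval]
        exact_mod_cast hfg g hg k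
      exact le_of_mul_le_mul_left h2 hN
    rw [bubble, h2, max_eq_right h0]

/-- The `i`-th coordinate is nonnegative on the descendant, so a point where it vanishes is a convex
combination of those vertices alone at which it vanishes. These are the vertices that `signOn`
inspects. -/
theorem sign_of_isDescendant (hd : d = 2 ∨ d = 3) {K D : LSimplex d}
    (b : AffineBasis (Fin (d + 1)) ℝ (E d)) (hb : ⇑b = K.vert) {n : ℕ} (h : K.IsDescendant n D)
    (i j l : Fin (d + 1)) (hL : allDesc (signOn i j l) n K.type (unitCoord d) = true) :
    (∀ x ∈ D.carrier, b.coord i x = 0 → b.coord l x ≤ b.coord j x) ∨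
      (∀ x ∈ D.carrier, b.coord i x = 0 → b.coord j x ≤ b.coord l x) := by
  obtain ⟨z, hz, hzc⟩ := exists_coord_of_isDescendant hd b hb h _ hL
  have hN : (0 : ℝ) < 2 ^ n := by positivity
  have hcar : ∀ m k, 0 ≤ b.coord m (D.vert k) := by
    intro m k
    have h1 : D.vert k ∈ K.carrier := h.carrier_subset (subset_convexHull ℝ _ ⟨k, rfl⟩)
    rw [carrier, ← hb, b.convexHull_eq_nonneg_coord] at h1
    exact h1 m
  have key : ∀ j l, (∀ k, z k i = 0 → z k l ≤ z k j) →
      ∀ x ∈ D.carrier, b.coord i x = 0 → b.coord l x ≤ b.coord j x := by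
    intro j l hjl x hx hxi
    obtain ⟨w, hw0, hw1, rfl⟩ := exists_weights_of_mem_carrier hx
    rw [coord_sum b w hw1] at hxi
    rw [coord_sum b w hw1, coord_sum b w hw1]
    refine Finset.sum_le_sum fun k _ => ?_
    have h0 := (Finset.sum_eq_zero_iff_of_nonneg
      (fun k _ => mul_nonneg (hw0 k) (hcar i k))).1 hxi k (Finset.mem_univ k)
    rcases mul_eq_zero.1 h0 with h1 | h1
    · simp [h1]
    · refine mul_le_mul_of_nonneg_left ?_ (hw0 k)
      have h2 : z k i = 0 := by
        have := hzc k i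
        rw [h1, mul_zero] at this
        exact_mod_cast this.symm
      have h3 : 2 ^ n * b.coord l (D.vert k) ≤ 2 ^ n * b.coord j (D.vert k) := by
        rw [hzc, hzc]
        exact_mod_cast hjl k h2
      exact le_of_mul_le_mul_left h3 hN
  simp only [signOn, Bool.or_eq_true, decide_eq_true_eq] at hz
  rcases hz with hz | hz
  · exact Or.inl (key j l hz)
  · exact Or.inr (key l j hz)

end LSimplex

/-! ### The element and side bubbles -/

/-- The linear forms that define the element bubble. -/
def elemForms : (d : ℕ) → Fin 3 → List (Fin (d + 1) → ℤ)
  | 2, _ => [![4, 0, 0], ![0, 4, 0], ![-2, 2, 2], ![2, -2, 2]]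
  | 3, 0 => [![-4, 4, 4, 0], ![-2, 6, 2, -2], ![0, 0, 0, 4], ![0, 0, 4, 0], ![2, 2, -2, 2],
      ![2, 2, 2, -2], ![4, -4, 0, 4], ![6, -2, -2, 2]]
  | 3, 1 => [![-4, 4, 4, 0], ![-2, 6, -2, 2], ![0, 0, 0, 4], ![2, 2, 2, -2], ![4, -4, 4, 0],
      ![6, -2, -2, 2]]
  | 3, 2 => [![-4, 4, 4, 4], ![-2, -2, 6, 2], ![0, 0, 0, 4], ![0, 8, 0, 0], ![2, -6, 2, 2],
      ![2, 2, 2, -2], ![4, 4, -4, 0], ![6, -2, -2, -2]]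
  | _, _ => []

/-- The linear forms that define the bubble of the side opposite to a vertex. -/
def sideForms : (d : ℕ) → Fin 3 → Fin (d + 1) → List (Fin (d + 1) → ℤ)
  | 2, _, 0 => [![-2, 2, 0], ![0, 0, 2]]
  | 2, _, 1 => [![2, -2, 0], ![0, 0, 2]]
  | 2, _, 2 => [![2, 0, 0], ![0, 2, 0]]
  | 3, 0, 0 => [![-6, 2, 2, -2], ![-4, 4, 0, 0], ![-2, -2, 2, 2], ![0, 0, 0, 4]]
  | 3, 0, 1 => [![-2, -2, 2, 2], ![0, 0, 4, 0], ![2, -6, -2, 2], ![4, -4, 0, 0]]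
  | 3, 0, 2 => [![-2, 2, 2, 2], ![0, 4, 0, 0], ![2, -2, -2, 2], ![4, 0, 0, 0]]
  | 3, 0, 3 => [![-2, 2, 2, -2], ![0, 4, 0, 0], ![2, -2, 2, 2], ![4, 0, 0, 0]]
  | 3, 1, 0 => [![-4, 4, 0, 0], ![-2, 2, -2, 2], ![0, 0, 4, 0], ![2, -2, 2, 2]]
  | 3, 1, 1 => [![-2, 2, 2, 2], ![0, 0, 4, 0], ![2, -2, -2, 2], ![4, -4, 0, 0]]
  | 3, 1, 2 => [![-2, 2, -2, 2], ![0, 4, 0, 0], ![2, -2, -2, 2], ![4, 0, 0, 0]]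
  | 3, 1, 3 => [![-2, 2, 2, -2], ![0, 4, 0, 0], ![2, -2, 2, -2], ![4, 0, 0, 0]]
  | 3, 2, 0 => [![-4, 4, 0, 0], ![-2, -2, 2, 2], ![0, 0, 4, 0], ![2, 2, -2, 2]]
  | 3, 2, 1 => [![-2, -2, 2, 2], ![0, 0, 4, 0], ![2, 2, -2, 2], ![4, -4, 0, 0]]
  | 3, 2, 2 => [![-2, 2, 2, 2], ![0, 0, 0, 2], ![0, 4, 0, 0], ![2, -2, 2, 2], ![2, 2, -2, 0],
      ![4, 0, 0, 0]]
  | 3, 2, 3 => [![-2, 2, 2, 0], ![0, 4, 0, 0], ![2, -2, 2, 0], ![4, 0, 0, 0]]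
  | _, _, _ => []

/-- The vertex of the face opposite to `i` of a tetrahedron that is opposite to the edge of the
face that is halved first. -/
def apex : Fin 3 → Fin 4 → Fin 4
  | 0, 0 => 2
  | _, 3 => 2
  | _, _ => 3

/-- A finite integer computation over `2 ^ nBisect d` descendants for each type. The numbers `3` and
`6` of bisections enter here and in the two checks below. -/
theorem allDesc_elemForms (hd : d = 2 ∨ d = 3) (t : Fin 3) :
    allDesc (linearOn (elemForms d t) (2 ^ nBisect d)) (nBisect d) t (unitCoord d) = true := by
  rcases hd with rfl | rfl <;> revert t <;> decide +kernel

theorem allDesc_sideForms (hd : d = 2 ∨ d = 3) (t : Fin 3) (i : Fin (d + 1)) :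
    allDesc (linearOn (sideForms d t i) (2 ^ nBisect d)) (nBisect d) t (unitCoord d) = true := by
  rcases hd with rfl | rfl <;> revert t i <;> decide +kernel

/-- The first cut of a face runs along the median through its apex, on which the other two
coordinates agree. Hence no descendant of generation six crosses this median within the face. -/
theorem allDesc_signOn (t : Fin 3) (i a b : Fin 4) (hai : a ≠ i) (hbi : b ≠ i) (hac : a ≠ apex t i)
    (hbc : b ≠ apex t i) : allDesc (signOn i a b) (nBisect 3) t (unitCoord 3) = true := by
  revert t i a b
  decide +kernel

theorem elemBubble_pos (hd : d = 2 ∨ d = 3) (t : Fin 3) (x : Fin (d + 1) → ℝ)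
    (h : bubble (elemForms d t) x ≠ 0) (j : Fin (d + 1)) : 0 < x j := by
  have h1 := fun f hf => formVal_pos_of_bubble_ne_zero (f := f) h hf
  rcases hd with rfl | rfl
  · simp [elemForms, formVal, Fin.sum_univ_succ] at h1
    fin_cases j <;> simp <;> linarith
  · fin_cases t <;> simp [elemForms, formVal, Fin.sum_univ_succ] at h1 <;> fin_cases j <;> simp <;>
      linarith

/-- The sign condition on `x i` restricts the claim to the half-space of the simplex. Beyond the
side the formula is not used, since the neighbour provides its own half of the test function. -/
theorem sideBubble_pos (hd : d = 2 ∨ d = 3) (t : Fin 3) (i : Fin (d + 1)) (x : Fin (d + 1) → ℝ)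
    (hi : 0 ≤ x i) (h : bubble (sideForms d t i) x ≠ 0) (j : Fin (d + 1)) (hj : j ≠ i) :
    0 < x j := by
  have h1 := fun f hf => formVal_pos_of_bubble_ne_zero (f := f) h hf
  rcases hd with rfl | rfl
  · fin_cases i <;> simp [sideForms, formVal, Fin.sum_univ_succ] at h1 hi <;>
      fin_cases j <;> simp at hj ⊢ <;> linarith
  · fin_cases t <;> fin_cases i <;> simp [sideForms, formVal, Fin.sum_univ_succ] at h1 hi <;>
      fin_cases j <;> simp at hj ⊢ <;> linarith

theorem le_capMin_iff {L : List (Fin (d + 1) → ℤ)} {x : Fin (d + 1) → ℝ} {c : ℝ} :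
    c ≤ capMin L x ↔ c ≤ 1 ∧ ∀ f ∈ L, c ≤ formVal f x :=
  ⟨fun h => ⟨h.trans (capMin_le_one L x), fun _ hf => h.trans (capMin_le L x hf)⟩,
    fun h => le_capMin h.1 h.2⟩

theorem bubble_pos_iff {L : List (Fin (d + 1) → ℤ)} {x : Fin (d + 1) → ℝ} :
    0 < bubble L x ↔ ∀ f ∈ L, 0 < formVal f x := by
  refine ⟨fun h f hf => formVal_pos_of_bubble_ne_zero h.ne' hf, fun h => ?_⟩
  refine lt_max_of_lt_right ?_
  induction L with
  | nil => simp [capMin]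
  | cons g L ih => exact lt_min (h g (by simp)) (ih fun f hf => h f (by simp [hf]))

/-- The trace is the hat function of the midpoint of the edge, symmetric in its endpoints. The two
neighbours of an edge therefore agree without any condition on their labels. -/
theorem sideBubble_trace_two (t : Fin 3) (i a b : Fin 3) (hai : a ≠ i) (hbi : b ≠ i) (hab : a ≠ b)
    (x : Fin 3 → ℝ) (hi : x i = 0) :
    bubble (sideForms 2 t i) x = max 0 (min 1 (min (2 * x a) (2 * x b))) := by
  unfold bubble
  congr 1
  refine eq_of_forall_le_iff fun c => ?_
  rw [le_capMin_iff]
  fin_cases i <;> simp at hi <;> fin_cases a <;> simp at hai <;> fin_cases b <;>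
    simp at hbi hab <;> simp [sideForms, formVal, Fin.sum_univ_succ, hi] <;> tauto

/-- The trace of the side bubbles of a tetrahedron; `c` is the coordinate of the apex. -/
def pyramid (a b c : ℝ) : ℝ :=
  max 0 (min 1 (min (4 * a) (min (4 * b) (min (2 * (b + c - a)) (2 * (a + c - b))))))

theorem pyramid_comm (a b c : ℝ) : pyramid a b c = pyramid b a c := by
  unfold pyramid
  congr 1
  refine eq_of_forall_le_iff fun c => ?_
  simp only [le_min_iff]
  tauto

/-- Although the lists of forms differ between types and sides, on the face they define the same
function once the apex is singled out. Two neighbours agree on their common face as soon as their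
apices do. -/
theorem sideBubble_trace_three (t : Fin 3) (i a b : Fin 4) (hai : a ≠ i) (hbi : b ≠ i)
    (hac : a ≠ apex t i) (hbc : b ≠ apex t i) (hab : a ≠ b) (x : Fin 4 → ℝ) (hi : x i = 0) :
    bubble (sideForms 3 t i) x = pyramid (x a) (x b) (x (apex t i)) := by
  wlog h : a < b generalizing a b
  · rw [pyramid_comm]
    exact this b a hbi hai hbc hac hab.symm (lt_of_le_of_ne (not_lt.1 h) hab.symm)
  unfold bubble pyramid
  congr 1
  refine eq_of_forall_le_iff fun c => ?_
  rw [le_capMin_iff]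
  fin_cases t <;> fin_cases i <;> simp [apex] at hi hac hbc <;>
    fin_cases a <;> simp at hai hac <;> fin_cases b <;> simp at hbi hbc hab h <;>
    simp [sideForms, formVal, Fin.sum_univ_succ, hi, apex] <;>
    grind

theorem bubble_pos_of_formInt {L : List (Fin (d + 1) → ℤ)} {z : Fin (d + 1) → ℤ}
    (hz : 0 < ∑ j, z j) (h : L.all fun f => decide (0 < formInt f z)) :
    (∑ j, (z j : ℝ) / (∑ j, z j : ℤ) = 1) ∧
      0 < bubble L (fun j => (z j : ℝ) / (∑ j, z j : ℤ)) := by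
  have hN : (0 : ℝ) < (∑ j, z j : ℤ) := by exact_mod_cast hz
  refine ⟨?_, bubble_pos_iff.2 fun f hf => ?_⟩
  · rw [← Finset.sum_div, Int.cast_sum, div_self]
    rw [Int.cast_sum] at hN
    exact hN.ne'
  · have h1 : formVal f (fun j => (z j : ℝ) / (∑ j, z j : ℤ)) =
        (formInt f z : ℤ) / (∑ j, z j : ℤ) := by
      simp only [formVal, formInt, Int.cast_sum, Int.cast_mul, Finset.sum_div, mul_div_assoc]
    rw [h1]
    simp only [List.all_eq_true, decide_eq_true_eq] at h
    exact div_pos (by exact_mod_cast h f hf) hN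

theorem exists_elemBubble_pos (hd : d = 2 ∨ d = 3) (t : Fin 3) :
    ∃ x : Fin (d + 1) → ℝ, ∑ j, x j = 1 ∧ 0 < bubble (elemForms d t) x := by
  rcases hd with rfl | rfl
  -- Here and for `d = 3` the chosen weights give the peak of the bubble, where all forms have the
  -- value `1`.
  · exact ⟨_, bubble_pos_of_formInt (z := ![1, 1, 2]) (by decide) (by revert t; decide)⟩
  · refine ⟨_, bubble_pos_of_formInt (z := if t = 2 then ![3, 1, 2, 2] else 1)
      (by revert t; decide) (by revert t; decide)⟩

theorem exists_sideBubble_pos (hd : d = 2 ∨ d = 3) (t : Fin 3) (i : Fin (d + 1)) :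
    ∃ x : Fin (d + 1) → ℝ, x i = 0 ∧ ∑ j, x j = 1 ∧ 0 < bubble (sideForms d t i) x := by
  rcases hd with rfl | rfl
  · exact ⟨_, by simp, bubble_pos_of_formInt (z := fun j => if j = i then 0 else 1)
      (by revert i; decide) (by revert t i; decide)⟩
  -- The point halfway between the apex and the midpoint of the opposite edge of the face, where the
  -- pyramid has height `1`.
  · exact ⟨_, by simp, bubble_pos_of_formInt
      (z := fun j => if j = i then 0 else if j = apex t i then 2 else 1)
      (by revert t i; decide) (by revert t i; decide)⟩

end

section

/-! ### Lipschitz functions in `H¹₀` -/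

theorem gradient_apply (f : E d → ℝ) (x : E d) (i : Fin d) :
    gradient f x i = fderiv ℝ f x (EuclideanSpace.single i 1) := by
  have h := InnerProductSpace.toDual_symm_apply (𝕜 := ℝ) (x := EuclideanSpace.single i (1 : ℝ))
    (y := fderiv ℝ f x)
  rw [EuclideanSpace.inner_single_right] at h
  simpa [gradient] using h

theorem norm_gradient (f : E d → ℝ) (x : E d) : ‖gradient f x‖ = ‖fderiv ℝ f x‖ := by
  simp [gradient]

theorem measurable_gradient (f : E d → ℝ) : Measurable (gradient f) :=
  ((InnerProductSpace.toDual ℝ (E d)).symm.continuous.measurable).comp (measurable_fderiv ℝ f)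

theorem norm_gradient_le {f : E d → ℝ} {C : ℝ≥0} (hf : LipschitzWith C f) (x : E d) :
    ‖gradient f x‖ ≤ C := by
  rw [norm_gradient]
  exact norm_fderiv_le_of_lipschitz ℝ hf

theorem gradient_congr {f g : E d → ℝ} {x : E d} (h : f =ᶠ[𝓝 x] g) :
    gradient f x = gradient g x := by
  simp [gradient, h.fderiv_eq]

theorem gradient_eq_zero_of_eventuallyEq {f : E d → ℝ} {x : E d} (h : f =ᶠ[𝓝 x] 0) :
    gradient f x = 0 := by
  rw [gradient_congr h]
  simp [gradient]

/-- The gradient of a Lipschitz function vanishes almost everywhere on its zero set. -/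
theorem ae_gradient_eq_zero {f : E d → ℝ} {C : ℝ≥0} (hf : LipschitzWith C f) :
    ∀ᵐ x, f x = 0 → gradient f x = 0 := by
  have habs : LipschitzWith (1 * C) (fun x => |f x|) :=
    LipschitzWith.comp (by simpa using lipschitzWith_one_norm (E := ℝ)) hf
  filter_upwards [habs.ae_differentiableAt] with x hx h0
  -- At a zero of `f` the function `|f|` is minimal, so its derivative vanishes there. Since `|f|`
  -- and `f` have the same size, this derivative statement passes to `f`.
  have hmin : IsLocalMin (fun x => |f x|) x := by
    refine Filter.Eventually.of_forall fun y => ?_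
    simp [h0]
  have hd : HasFDerivAt (fun x => |f x|) (0 : E d →L[ℝ] ℝ) x := by
    rw [← hmin.fderiv_eq_zero]
    exact hx.hasFDerivAt
  have hd' : HasFDerivAt f (0 : E d →L[ℝ] ℝ) x := by
    rw [hasFDerivAt_iff_isLittleO] at hd ⊢
    refine (Asymptotics.IsBigO.of_norm_le fun y => ?_).trans_isLittleO hd
    simp [h0]
  simp [gradient, hd'.fderiv]

/-- Every pair of classes represented by `f` and `G` belongs to `H¹₀(Ω)`. -/
def RepH10 (Ω : Set (E d)) (f : E d → ℝ) (G : E d → E d) : Prop :=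
  ∀ p : L2Pair d, (p.1 : E d → ℝ) =ᵐ[volume] f → (p.2 : E d → E d) =ᵐ[volume] G → p ∈ H10 Ω

theorem memLp_of_bound_of_eq_zero {F : Type*} [NormedAddCommGroup F] {f : E d → F} {B R : ℝ}
    (hf : AEStronglyMeasurable f) (hB : ∀ x, ‖f x‖ ≤ B) (hR : ∀ x, R < ‖x‖ → f x = 0) :
    MemLp f 2 := by
  have h1 : f = (Metric.closedBall (0 : E d) R).indicator f := by
    funext x
    by_cases hx : x ∈ Metric.closedBall (0 : E d) R
    · rw [Set.indicator_of_mem hx]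
    · rw [Set.indicator_of_notMem hx]
      rw [mem_closedBall_zero_iff, not_le] at hx
      exact hR x hx
  rw [h1, memLp_indicator_iff_restrict measurableSet_closedBall]
  haveI : IsFiniteMeasure ((volume : Measure (E d)).restrict (Metric.closedBall 0 R)) :=
    ⟨by simpa using measure_closedBall_lt_top⟩
  exact MemLp.of_bound hf.restrict B (Filter.Eventually.of_forall hB)

theorem tendsto_eLpNorm_of_bound {F : Type*} [NormedAddCommGroup F] {f : ℕ → E d → F} {g : E d → F}
    {B R : ℝ} (hf : ∀ k, AEStronglyMeasurable (f k)) (hg : AEStronglyMeasurable g)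
    (hB : ∀ k x, ‖f k x‖ ≤ B) (hR : ∀ k x, R < ‖x‖ → f k x = 0)
    (hlim : ∀ᵐ x, Filter.Tendsto (fun k => f k x) Filter.atTop (𝓝 (g x))) :
    Filter.Tendsto (fun k => eLpNorm (f k - g) 2) Filter.atTop (𝓝 0) := by
  have h2 : ∀ k, eLpNorm (f k - g) 2 = (∫⁻ x, ‖f k x - g x‖ₑ ^ (2 : ℝ)) ^ (1 / (2 : ℝ)) := by
    intro k
    rw [eLpNorm_eq_lintegral_rpow_enorm_toReal (by simp) (by simp)]
    simp
  have hgB : ∀ᵐ x, ‖g x‖ ≤ B := by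
    filter_upwards [hlim] with x hx
    exact le_of_tendsto hx.norm (Filter.Eventually.of_forall fun k => hB k x)
  have hgR : ∀ᵐ x, R < ‖x‖ → g x = 0 := by
    filter_upwards [hlim] with x hx hxR
    refine tendsto_nhds_unique hx ?_
    simp [hR _ x hxR]
  have h3 : Filter.Tendsto (fun k => ∫⁻ x, ‖f k x - g x‖ₑ ^ (2 : ℝ)) Filter.atTop (𝓝 0) := by
    have h4 := tendsto_lintegral_of_dominated_convergence' (μ := (volume : Measure (E d)))
      (F := fun k x => ‖f k x - g x‖ₑ ^ (2 : ℝ)) (f := fun _ => 0)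
      ((Metric.closedBall (0 : E d) R).indicator fun _ => (ENNReal.ofReal (2 * B)) ^ (2 : ℝ))
      (fun k => ((hf k).sub hg).enorm.pow_const _) ?_ ?_ ?_
    · simpa using h4
    · intro k
      filter_upwards [hgB, hgR] with x hx1 hx2
      by_cases hx : x ∈ Metric.closedBall (0 : E d) R
      · rw [Set.indicator_of_mem hx]
        gcongr
        rw [← ofReal_norm]
        refine ENNReal.ofReal_le_ofReal ((norm_sub_le _ _).trans ?_)
        have := hB k x
        linarith
      · rw [mem_closedBall_zero_iff, not_le] at hx
        simp [hR k x hx, hx2 hx]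
    · rw [lintegral_indicator measurableSet_closedBall]
      simp only [lintegral_const, Measure.restrict_apply_univ]
      exact ENNReal.mul_ne_top (ENNReal.rpow_ne_top_of_nonneg (by norm_num) ENNReal.ofReal_ne_top)
        measure_closedBall_lt_top.ne
    · filter_upwards [hlim] with x hx
      have h5 : Filter.Tendsto (fun k => f k x - g x) Filter.atTop (𝓝 0) := by
        simpa using hx.sub_const (g x)
      have h6 := (h5.enorm).ennrpow_const (2 : ℝ)
      simpa using h6
  simp_rw [h2]
  simpa using h3.ennrpow_const (1 / 2 : ℝ)

/-- Uniform bounds and a common bounded support upgrade almost everywhere convergence to convergence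
in `L²` of both components, and `H10 Ω` is closed. -/
theorem RepH10.of_tendsto {Ω : Set (E d)} {f : ℕ → E d → ℝ} {G : ℕ → E d → E d} {f' : E d → ℝ}
    {G' : E d → E d} {B R : ℝ} (hf : ∀ k, AEStronglyMeasurable (f k))
    (hG : ∀ k, AEStronglyMeasurable (G k)) (hf' : AEStronglyMeasurable f')
    (hG' : AEStronglyMeasurable G') (hfB : ∀ k x, ‖f k x‖ ≤ B) (hGB : ∀ k x, ‖G k x‖ ≤ B)
    (hfR : ∀ k x, R < ‖x‖ → f k x = 0) (hGR : ∀ k x, R < ‖x‖ → G k x = 0)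
    (hflim : ∀ᵐ x, Filter.Tendsto (fun k => f k x) Filter.atTop (𝓝 (f' x)))
    (hGlim : ∀ᵐ x, Filter.Tendsto (fun k => G k x) Filter.atTop (𝓝 (G' x)))
    (h : ∀ k, RepH10 Ω (f k) (G k)) : RepH10 Ω f' G' := by
  intro p hp1 hp2
  have hm1 := fun k => memLp_of_bound_of_eq_zero (hf k) (hfB k) (hfR k)
  have hm2 := fun k => memLp_of_bound_of_eq_zero (hG k) (hGB k) (hGR k)
  have hfm : MemLp f' 2 := (memLp_congr_ae hp1).1 (Lp.memLp p.1)
  have hGm : MemLp G' 2 := (memLp_congr_ae hp2).1 (Lp.memLp p.2)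
  have hp : p = (hfm.toLp f', hGm.toLp G') := by
    refine Prod.ext ?_ ?_
    · exact Lp.ext (hp1.trans hfm.coeFn_toLp.symm)
    · exact Lp.ext (hp2.trans hGm.coeFn_toLp.symm)
  rw [hp]
  have hlim : Filter.Tendsto (fun k => (((hm1 k).toLp (f k), (hm2 k).toLp (G k)) : L2Pair d))
      Filter.atTop (𝓝 (hfm.toLp f', hGm.toLp G')) := by
    refine Filter.Tendsto.prodMk_nhds ?_ ?_
    · exact (Lp.tendsto_Lp_iff_tendsto_eLpNorm'' _ hm1 _ hfm).2
        (tendsto_eLpNorm_of_bound hf hf' hfB hfR hflim)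
    · exact (Lp.tendsto_Lp_iff_tendsto_eLpNorm'' _ hm2 _ hGm).2
        (tendsto_eLpNorm_of_bound hG hG' hGB hGR hGlim)
  refine (Submodule.isClosed_topologicalClosure _).mem_of_tendsto hlim ?_
  exact Filter.Eventually.of_forall fun k =>
    h k _ (hm1 k).coeFn_toLp (hm2 k).coeFn_toLp

theorem repH10_of_contDiff {Ω : Set (E d)} {φ : E d → ℝ} (h1 : ContDiff ℝ ∞ φ)
    (h2 : HasCompactSupport φ) (h3 : tsupport φ ⊆ Ω) : RepH10 Ω φ (gradient φ) := fun _ hp1 hp2 =>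
  Submodule.le_topologicalClosure _ (Submodule.subset_span ⟨φ, h1, h2, h3, hp1, hp2⟩)

open scoped Convolution in
-- The derivative first falls on the smooth kernel; integration by parts for Lipschitz functions
-- moves it to `f`. Hence the gradients of mollifications are mollifications of the gradient.
theorem fderiv_convolution_lipschitz {φ f : E d → ℝ} {C : ℝ≥0} (hφ : ContDiff ℝ ∞ φ)
    (hφc : HasCompactSupport φ) (hf : LipschitzWith C f) (x e : E d) :
    fderiv ℝ (φ ⋆[ContinuousLinearMap.lsmul ℝ ℝ, volume] f) x e =
      (φ ⋆[ContinuousLinearMap.lsmul ℝ ℝ, volume] fun y => lineDeriv ℝ f y e) x := by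
  have hd := hφc.hasFDerivAt_convolution_left (ContinuousLinearMap.lsmul ℝ ℝ)
    (hφ.of_le (by norm_cast)) (hf.continuous.locallyIntegrable (μ := volume)) x
  rw [hd.fderiv]
  have hφ1 : ContDiff ℝ 1 φ := hφ.of_le (by norm_cast)
  obtain ⟨D, hD⟩ := ContDiff.lipschitzWith_of_hasCompactSupport hφc hφ1 one_ne_zero
  have hrefl : LipschitzWith C (fun t => f (x - t)) := by
    have := hf.comp ((LipschitzWith.const x).sub LipschitzWith.id)
    simpa [Function.comp_def] using this
  -- The convolution contains the reflected function `t ↦ f (x - t)`, whose derivative along `-e` is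
  -- that of `f` along `e`.
  have key := hrefl.integral_lineDeriv_mul_eq (μ := volume) hD hφc (-e)
  have hce : (fderiv ℝ φ ⋆[(ContinuousLinearMap.lsmul ℝ ℝ).precompL (E d), volume] f) x e =
      ∫ t, lineDeriv ℝ φ t e * f (x - t) := by
    rw [convolution_def, ContinuousLinearMap.integral_apply]
    · congr 1
      funext t
      rw [((hφ1.differentiable one_ne_zero) t).lineDeriv_eq_fderiv]
      simp [ContinuousLinearMap.precompL]
    · exact (hφc.fderiv ℝ).convolutionExists_left _ (hφ1.continuous_fderiv one_ne_zero)
        (hf.continuous.locallyIntegrable) x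
  rw [hce, convolution_def]
  rw [neg_neg] at key
  rw [← key]
  congr 1
  funext t
  have hl : lineDeriv ℝ (fun t => f (x - t)) t (-e) = lineDeriv ℝ f (x - t) e := by
    simp only [lineDeriv]
    congr 1
    funext s
    congr 1
    rw [smul_neg]
    abel
  rw [hl]
  simp [mul_comm]

/-- Mollification: the supports stay in a closed neighbourhood of `tsupport f` inside `Ω`, averaging
preserves the bounds on values and derivatives, and the gradients converge almost everywhere by
Lebesgue differentiation. -/
theorem repH10_of_tsupport {Ω : Set (E d)} (hΩ : IsOpen Ω) {f : E d → ℝ} {C : ℝ≥0}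
    (hf : LipschitzWith C f) (hfc : HasCompactSupport f) (hs : tsupport f ⊆ Ω) :
    RepH10 Ω f (gradient f) := by
  obtain ⟨δ, hδ, hδΩ⟩ := hfc.isCompact.exists_cthickening_subset_open hΩ hs
  obtain ⟨R, hR⟩ := (hfc.isCompact.cthickening (r := δ)).isBounded.subset_closedBall 0
  obtain ⟨B, hB⟩ := hf.continuous.bounded_above_of_compact_support hfc
  -- The inner radius is half of the outer one: the differentiation theorem for bump functions
  -- requires a bounded ratio of the radii.
  let φ : ℕ → ContDiffBump (0 : E d) := fun k =>
    ⟨δ / (k + 2) / 2, δ / (k + 2), by positivity, by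
      have : 0 < δ / ((k : ℝ) + 2) := by positivity
      linarith⟩
  have hφδ : ∀ k, (φ k).rOut ≤ δ := fun k => by
    change δ / ((k : ℝ) + 2) ≤ δ
    refine div_le_self hδ.le ?_
    have : (0 : ℝ) ≤ k := Nat.cast_nonneg k
    linarith
  have hφ0 : Filter.Tendsto (fun k => (φ k).rOut) Filter.atTop (𝓝 0) := by
    change Filter.Tendsto (fun k : ℕ => δ / ((k : ℝ) + 2)) Filter.atTop (𝓝 0)
    exact Filter.Tendsto.div_atTop tendsto_const_nhds
      (Filter.tendsto_atTop_add_const_right _ _ tendsto_natCast_atTop_atTop)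
  have hφ2 : ∀ᶠ k in Filter.atTop, (φ k).rOut ≤ 2 * (φ k).rIn := by
    refine Filter.Eventually.of_forall fun k => ?_
    change δ / ((k : ℝ) + 2) ≤ 2 * (δ / ((k : ℝ) + 2) / 2)
    linarith
  let F : ℕ → E d → ℝ := fun k =>
    convolution ((φ k).normed volume) f (ContinuousLinearMap.lsmul ℝ ℝ) volume
  have hsm : ∀ k, ContDiff ℝ ∞ ((φ k).normed volume) := fun k => (φ k).contDiff_normed
  have hcs : ∀ k, HasCompactSupport ((φ k).normed volume) := fun k => (φ k).hasCompactSupport_normed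
  have hFd : ∀ k, ContDiff ℝ ∞ (F k) := fun k =>
    (hcs k).contDiff_convolution_left _ (hsm k) hf.continuous.locallyIntegrable
  have hFs : ∀ k, Function.support (F k) ⊆ Metric.cthickening δ (tsupport f) := by
    intro k x hx
    obtain ⟨a, ha, b, hb, rfl⟩ := support_convolution_subset _ hx
    rw [(φ k).support_normed_eq, mem_ball_zero_iff] at ha
    refine Metric.mem_cthickening_of_dist_le _ b δ _ (subset_tsupport f hb) ?_
    simp only [dist_eq_norm, add_sub_cancel_right]
    exact ha.le.trans (hφδ k)
  have hFts : ∀ k, tsupport (F k) ⊆ Metric.cthickening δ (tsupport f) := fun k =>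
    closure_minimal (hFs k) Metric.isClosed_cthickening
  have hFc : ∀ k, HasCompactSupport (F k) := fun k =>
    (hfc.isCompact.cthickening (r := δ)).of_isClosed_subset (isClosed_tsupport _) (hFts k)
  have havg : ∀ (k : ℕ) (g : E d → ℝ) (D : ℝ) (x : E d), (∀ y, |g y| ≤ D) →
      |convolution ((φ k).normed volume) g (ContinuousLinearMap.lsmul ℝ ℝ) volume x| ≤ D := by
    intro k g D x hg
    rw [convolution_def]
    have h1 : ‖∫ t, (ContinuousLinearMap.lsmul ℝ ℝ) ((φ k).normed volume t) (g (x - t))‖ ≤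
        ∫ t, (φ k).normed volume t * D := by
      refine norm_integral_le_of_norm_le ((φ k).integrable_normed.mul_const D) ?_
      refine Filter.Eventually.of_forall fun t => ?_
      simp only [ContinuousLinearMap.lsmul_apply, norm_smul, Real.norm_eq_abs,
        abs_of_nonneg ((φ k).nonneg_normed t)]
      exact mul_le_mul_of_nonneg_left (hg _) ((φ k).nonneg_normed t)
    rw [integral_mul_const, (φ k).integral_normed, one_mul] at h1
    exact h1
  have hgr : ∀ k x i, gradient (F k) x i = convolution ((φ k).normed volume)
      (fun y => lineDeriv ℝ f y (EuclideanSpace.single i 1)) (ContinuousLinearMap.lsmul ℝ ℝ)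
        volume x := fun k x i => by
    rw [gradient_apply]
    exact fderiv_convolution_lipschitz (hsm k) (hcs k) hf x _
  have hlineB : ∀ i y, |lineDeriv ℝ f y (EuclideanSpace.single i 1)| ≤ C := by
    intro i y
    have := norm_lineDeriv_le_of_lipschitz ℝ hf (x₀ := y) (v := EuclideanSpace.single i 1)
    simpa using this
  refine RepH10.of_tendsto (f := F) (G := fun k => gradient (F k)) (B := max B (√d * C)) (R := R)
    (fun k => (hFd k).continuous.aestronglyMeasurable)
    (fun k => (measurable_gradient _).aestronglyMeasurable)
    hf.continuous.aestronglyMeasurable (measurable_gradient f).aestronglyMeasurable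
      ?_ ?_ ?_ ?_ ?_ ?_
    (fun k => repH10_of_contDiff (hFd k) (hFc k) ((hFts k).trans hδΩ))
  · intro k x
    exact (havg k f B x hB).trans (le_max_left _ _)
  · intro k x
    refine le_trans ?_ (le_max_right _ _)
    rw [EuclideanSpace.norm_eq]
    refine Real.sqrt_le_iff.2 ⟨by positivity, ?_⟩
    calc ∑ i, ‖gradient (F k) x i‖ ^ 2 ≤ ∑ i : Fin d, (C : ℝ) ^ 2 := by
          refine Finset.sum_le_sum fun i _ => ?_
          rw [hgr]
          exact pow_le_pow_left₀ (norm_nonneg _) (havg k _ _ x (hlineB i)) 2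
      _ = (√d * C) ^ 2 := by
          rw [mul_pow, Real.sq_sqrt (Nat.cast_nonneg d)]
          simp
  · intro k x hx
    by_contra h
    have := hR (hFs k h)
    rw [mem_closedBall_zero_iff] at this
    linarith
  · intro k x hx
    refine gradient_eq_zero_of_eventuallyEq ?_
    have ho : IsOpen {x : E d | R < ‖x‖} := isOpen_lt continuous_const continuous_norm
    filter_upwards [ho.mem_nhds hx] with y hy
    by_contra h
    have := hR (hFs k h)
    rw [mem_closedBall_zero_iff] at this
    exact absurd hy (not_lt.2 this)
  · exact Filter.Eventually.of_forall fun x =>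
      ContDiffBump.convolution_tendsto_right_of_continuous hφ0 hf.continuous x
  · have h1 : ∀ i, ∀ᵐ x, Filter.Tendsto (fun k => gradient (F k) x i) Filter.atTop
        (𝓝 (lineDeriv ℝ f x (EuclideanSpace.single i 1))) := by
      intro i
      simp_rw [hgr]
      exact ContDiffBump.ae_convolution_tendsto_right_of_locallyIntegrable hφ0 hφ2
        (hf.locallyIntegrable_lineDeriv _)
    filter_upwards [ae_all_iff.2 h1, hf.ae_differentiableAt] with x hx hdx
    have h2 : Filter.Tendsto (fun k => (gradient (F k) x).ofLp) Filter.atTop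
        (𝓝 (gradient f x).ofLp) := by
      rw [tendsto_pi_nhds]
      intro i
      have := hx i
      rw [hdx.lineDeriv_eq_fderiv, ← gradient_apply] at this
      exact this
    exact ((PiLp.continuous_toLp 2 _).tendsto _).comp h2

/-- A compactly supported Lipschitz function that vanishes outside the open set `Ω` belongs to
`H¹₀(Ω)`. -/
theorem repH10_of_lipschitz {Ω : Set (E d)} (hΩ : IsOpen Ω) {f : E d → ℝ} {C : ℝ≥0}
    (hf : LipschitzWith C f) (hfc : HasCompactSupport f) (hs : Function.support f ⊆ Ω) :
    RepH10 Ω f (gradient f) := by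
  obtain ⟨R, hR⟩ := hfc.isCompact.isBounded.subset_closedBall 0
  obtain ⟨B, hB⟩ := hf.continuous.bounded_above_of_compact_support hfc
  let ε : ℕ → ℝ := fun k => 1 / ((k : ℝ) + 1)
  have hε : ∀ k, 0 < ε k := fun k => Nat.one_div_pos_of_nat
  -- Soft thresholding. The support of `S k ∘ f` lies in the compact set `{ε k ≤ |f|}`, which is
  -- contained in `Ω` whatever the boundary looks like.
  let S : ℕ → ℝ → ℝ := fun k t => t - max (-ε k) (min (ε k) t)
  have hS : ∀ k, LipschitzWith 2 (S k) := by
    intro k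
    have h1 : LipschitzWith 1 fun t : ℝ => max (-ε k) (min (ε k) t) :=
      (LipschitzWith.id.const_min _).const_max _
    have := LipschitzWith.id.sub h1
    rwa [one_add_one_eq_two] at this
  have hS0 : ∀ k t, |t| ≤ ε k → S k t = 0 := by
    intro k t ht
    have := abs_le.1 ht
    simp only [S]
    rw [min_eq_right this.2, max_eq_right this.1, sub_self]
  have hS1 : ∀ k t, ε k ≤ t → S k t = t - ε k := by
    intro k t ht
    simp only [S]
    rw [min_eq_left ht, max_eq_right (by linarith [hε k])]
  have hS2 : ∀ k t, t ≤ -ε k → S k t = t + ε k := by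
    intro k t ht
    simp only [S]
    rw [min_eq_right (by linarith [hε k]), max_eq_left ht, sub_neg_eq_add]
  have hSle : ∀ k t, |S k t| ≤ |t| := by
    intro k t
    have := hε k
    rcases le_total t (-ε k) with h | h
    · rw [hS2 k t h, abs_of_nonpos (by linarith), abs_of_nonpos (by linarith)]
      linarith
    · rcases le_total (ε k) t with h' | h'
      · rw [hS1 k t h', abs_of_nonneg (by linarith), abs_of_nonneg (by linarith)]
        linarith
      · rw [hS0 k t (abs_le.2 ⟨h, h'⟩), abs_zero]
        exact abs_nonneg t
  have hlip : ∀ k, LipschitzWith (2 * C) (fun x => S k (f x)) := fun k => (hS k).comp hf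
  have hts : ∀ k, tsupport (fun x => S k (f x)) ⊆ {x | ε k ≤ |f x|} := by
    intro k
    refine closure_minimal (fun x hx => ?_) (isClosed_le continuous_const hf.continuous.abs)
    by_contra h
    exact hx (hS0 k _ (not_le.1 h).le)
  have hts' : ∀ k, {x | ε k ≤ |f x|} ⊆ Function.support f := by
    intro k x hx h0
    simp only [Set.mem_ofPred_eq, h0, abs_zero] at hx
    exact absurd (hε k) (not_lt.2 hx)
  have hcs : ∀ k, HasCompactSupport (fun x => S k (f x)) := fun k =>
    hfc.isCompact.of_isClosed_subset (isClosed_tsupport _)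
      (((hts k).trans (hts' k)).trans (subset_tsupport f))
  have hout : ∀ k x, R < ‖x‖ → S k (f x) = 0 := by
    intro k x hx
    refine hS0 k _ ?_
    have : f x = 0 := by
      by_contra h
      have := hR (subset_tsupport f h)
      rw [mem_closedBall_zero_iff] at this
      linarith
    rw [this, abs_zero]
    exact (hε k).le
  have hε0 : Filter.Tendsto ε Filter.atTop (𝓝 0) := tendsto_one_div_add_atTop_nhds_zero_nat
  refine RepH10.of_tendsto (f := fun k x => S k (f x)) (G := fun k => gradient fun x => S k (f x))
    (B := max B (2 * C : ℝ≥0)) (R := R) (fun k => (hlip k).continuous.aestronglyMeasurable)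
    (fun k => (measurable_gradient _).aestronglyMeasurable) hf.continuous.aestronglyMeasurable
    (measurable_gradient f).aestronglyMeasurable
    (fun k x => ((hSle k _).trans (hB x)).trans (le_max_left _ _))
    (fun k x => (norm_gradient_le (hlip k) x).trans (le_max_right _ _)) hout ?_ ?_ ?_
    (fun k => repH10_of_tsupport hΩ (hlip k) (hcs k) (((hts k).trans (hts' k)).trans hs))
  · intro k x hx
    refine gradient_eq_zero_of_eventuallyEq ?_
    have ho : IsOpen {x : E d | R < ‖x‖} := isOpen_lt continuous_const continuous_norm
    filter_upwards [ho.mem_nhds hx] with y hy using hout k y hy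
  · refine Filter.Eventually.of_forall fun x => ?_
    rw [tendsto_iff_dist_tendsto_zero]
    refine squeeze_zero (fun k => dist_nonneg) (fun k => ?_) hε0
    rw [Real.dist_eq]
    simp only [S, sub_sub_cancel_left, abs_neg]
    exact abs_le.2 ⟨le_max_left _ _, max_le (by linarith [hε k]) (min_le_left _ _)⟩
  -- Near a zero of `f` the truncation vanishes, and the gradient of `f` is zero at almost every
  -- such point. Elsewhere the truncation eventually differs from `f` by a constant near `x`.
  · filter_upwards [ae_gradient_eq_zero hf] with x hx
    by_cases h0 : f x = 0
    · rw [hx h0]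
      refine tendsto_const_nhds.congr fun k => ?_
      refine (gradient_eq_zero_of_eventuallyEq ?_).symm
      have ho : {x | |f x| < ε k} ∈ 𝓝 x :=
        (isOpen_lt hf.continuous.abs continuous_const).mem_nhds (by simpa [h0] using hε k)
      filter_upwards [ho] with y hy using hS0 k _ (le_of_lt hy)
    · have hev : ∀ᶠ k in Filter.atTop, ε k < |f x| := hε0.eventually_lt_const (abs_pos.2 h0)
      refine tendsto_const_nhds.congr' ?_
      filter_upwards [hev] with k hk
      rcases lt_abs.1 hk with h | h
      · have ho : {x | ε k < f x} ∈ 𝓝 x :=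
          (isOpen_lt continuous_const hf.continuous).mem_nhds h
        have : (fun x => S k (f x)) =ᶠ[𝓝 x] fun x => f x - ε k := by
          filter_upwards [ho] with y hy using hS1 k _ (le_of_lt hy)
        rw [gradient_congr this]
        simp [gradient, fderiv_sub_const]
      · have ho : {x | ε k < -f x} ∈ 𝓝 x :=
          (isOpen_lt continuous_const hf.continuous.neg).mem_nhds h
        have : (fun x => S k (f x)) =ᶠ[𝓝 x] fun x => f x + ε k := by
          filter_upwards [ho] with y hy
          exact hS2 k _ (by have : ε k < -f y := hy; linarith)
        rw [gradient_congr this]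
        simp [gradient, fderiv_add_const]

/-! ### The gradient of polynomials and weak gradients -/

theorem hasFDerivAt_pval (p : MvPolynomial (Fin d) ℝ) (x : E d) :
    HasFDerivAt (pval p) (∑ i, pgrad p x i • (EuclideanSpace.proj i : E d →L[ℝ] ℝ)) x := by
  induction p using MvPolynomial.induction_on with
  | C a =>
    have h1 : pval (MvPolynomial.C a : MvPolynomial (Fin d) ℝ) = fun _ => a := by
      funext y
      simp [pval]
    rw [h1]
    convert! hasFDerivAt_const a x
    simp [pgrad, pval]
  | add p q hp hq =>
    have h1 : pval (p + q) = pval p + pval q := by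
      funext y
      simp [pval]
    rw [h1]
    convert! hp.add hq using 1
    rw [← Finset.sum_add_distrib]
    refine Finset.sum_congr rfl fun i _ => ?_
    simp [pgrad, pval, add_smul]
  | mul_X p j hp =>
    have h1 : pval (p * MvPolynomial.X j) =
      fun y => pval p y * (EuclideanSpace.proj j : E d →L[ℝ] ℝ) y := by
      funext y
      simp [pval]
    rw [h1]
    convert! hp.mul (EuclideanSpace.proj j : E d →L[ℝ] ℝ).hasFDerivAt using 1
    ext e
    simp only [sum_apply, add_apply,
      smul_apply, pgrad, pval, Derivation.leibniz, MvPolynomial.pderiv_X,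
      smul_eq_mul, map_add, map_mul, MvPolynomial.eval_X, add_mul, Finset.sum_add_distrib,
      PiLp.proj_apply, Finset.mul_sum]
    congr 1
    · rw [Finset.sum_eq_single j]
      · simp
      · intro i _ hij
        simp [Pi.single_apply, hij.symm]
      · simp
    · exact Finset.sum_congr rfl fun i _ => by ring

theorem continuous_pval (p : MvPolynomial (Fin d) ℝ) : Continuous (pval p) :=
  continuous_iff_continuousAt.2 fun x => (hasFDerivAt_pval p x).continuousAt

theorem fderiv_pval_single (p : MvPolynomial (Fin d) ℝ) (x : E d) (i : Fin d) :
    fderiv ℝ (pval p) x (EuclideanSpace.single i 1) = pgrad p x i := by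
  rw [(hasFDerivAt_pval p x).fderiv]
  simp [sum_apply, Pi.single_apply]

theorem contDiff_pval (p : MvPolynomial (Fin d) ℝ) : ContDiff ℝ ∞ (pval p) := by
  induction p using MvPolynomial.induction_on with
  | C a =>
    have h1 : pval (MvPolynomial.C a : MvPolynomial (Fin d) ℝ) = fun _ => a := by
      funext y
      simp [pval]
    rw [h1]
    exact contDiff_const
  | add p q hp hq =>
    have h1 : pval (p + q) = pval p + pval q := by
      funext y
      simp [pval]
    rw [h1]
    exact hp.add hq
  | mul_X p j hp =>
    have h1 : pval (p * MvPolynomial.X j) =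
      fun y => pval p y * (EuclideanSpace.proj j : E d →L[ℝ] ℝ) y := by
      funext y
      simp [pval]
    rw [h1]
    exact hp.mul (EuclideanSpace.proj j : E d →L[ℝ] ℝ).contDiff

end

/-! ### Weak gradients of members of `H¹₀`, Lipschitz domains and simplices -/

section

/-- The identity says that a continuous linear functional vanishes at `p`. It vanishes on the test
pairs by classical integration by parts, hence on their closure. This ties the second component of a
member of `H10 Ω` to the first. -/
theorem integral_weak_gradient {Ω : Set (E d)} {p : L2Pair d} (hp : p ∈ H10 Ω) {φ : E d → ℝ}
    (hφ : ContDiff ℝ ∞ φ) (hφc : HasCompactSupport φ) (i : Fin d) :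
    ∫ x, φ x * p.2 x i = -∫ x, fderiv ℝ φ x (EuclideanSpace.single i 1) * p.1 x := by
  have hφ1 : ContDiff ℝ 1 φ := hφ.of_le (by norm_cast)
  have hdc : Continuous fun x => fderiv ℝ φ x (EuclideanSpace.single i 1) :=
    (hφ1.continuous_fderiv one_ne_zero).clm_apply continuous_const
  have hdcs : HasCompactSupport fun x => fderiv ℝ φ x (EuclideanSpace.single i 1) :=
    hφc.fderiv_apply ℝ _
  have hm1 : MemLp (fun x => fderiv ℝ φ x (EuclideanSpace.single i 1)) 2 (volume : Measure (E d)) :=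
    hdc.memLp_of_hasCompactSupport hdcs
  have hm2 : MemLp (fun x => φ x • (EuclideanSpace.single i 1 : E d)) 2 (volume : Measure (E d)) :=
    (hφ.continuous.smul continuous_const).memLp_of_hasCompactSupport hφc.smul_right
  let ℓ : L2Pair d → ℝ := fun p => inner ℝ (hm2.toLp _) p.2 + inner ℝ (hm1.toLp _) p.1
  have hℓ : ∀ p : L2Pair d, ℓ p = (∫ x, φ x * p.2 x i) +
      ∫ x, fderiv ℝ φ x (EuclideanSpace.single i 1) * p.1 x := by
    intro p
    simp only [ℓ, L2.inner_def]
    congr 1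
    · refine integral_congr_ae ?_
      filter_upwards [hm2.coeFn_toLp] with x hx
      rw [hx, real_inner_smul_left, EuclideanSpace.inner_single_left]
      simp
    · refine integral_congr_ae ?_
      filter_upwards [hm1.coeFn_toLp] with x hx
      rw [hx]
      simp [mul_comm]
  have hcont : Continuous ℓ := by
    refine Continuous.add ?_ ?_
    · exact continuous_const.inner continuous_snd
    · exact continuous_const.inner continuous_fst
  let N : Submodule ℝ (L2Pair d) :=
    { carrier := {p | ℓ p = 0}
      add_mem' := by
        intro a b ha hb
        simp only [Set.mem_ofPred_eq, ℓ, Prod.fst_add, Prod.snd_add, inner_add_right] at *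
        linarith
      zero_mem' := by simp [ℓ]
      smul_mem' := by
        intro c a ha
        simp only [Set.mem_ofPred_eq, ℓ, Prod.smul_fst, Prod.smul_snd, inner_smul_right] at *
        rw [← mul_add, ha, mul_zero] }
  have hle : H10 Ω ≤ N := by
    refine Submodule.topologicalClosure_minimal _ (Submodule.span_le.2 ?_)
      (isClosed_eq hcont continuous_const)
    rintro q ⟨ψ, hψ, hψc, -, hq1, hq2⟩
    change ℓ q = 0
    rw [hℓ]
    have hψ1 : ContDiff ℝ 1 ψ := hψ.of_le (by norm_cast)
    have e1 : ∫ x, φ x * q.2 x i = ∫ x, φ x * fderiv ℝ ψ x (EuclideanSpace.single i 1) := by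
      refine integral_congr_ae ?_
      filter_upwards [hq2] with x hx
      rw [hx, gradient_apply]
    have e2 : ∫ x, fderiv ℝ φ x (EuclideanSpace.single i 1) * q.1 x =
        ∫ x, fderiv ℝ φ x (EuclideanSpace.single i 1) * ψ x := by
      refine integral_congr_ae ?_
      filter_upwards [hq1] with x hx
      rw [hx]
    have hdψ : Continuous fun x => fderiv ℝ ψ x (EuclideanSpace.single i 1) :=
      (hψ1.continuous_fderiv one_ne_zero).clm_apply continuous_const
    rw [e1, e2, integral_mul_fderiv_eq_neg_fderiv_mul_of_integrable]
    · ring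
    · exact (hdc.mul hψ.continuous).integrable_of_hasCompactSupport hdcs.mul_right
    · exact (hφ.continuous.mul hdψ).integrable_of_hasCompactSupport hφc.mul_right
    · exact (hφ.continuous.mul hψ.continuous).integrable_of_hasCompactSupport hφc.mul_right
    · exact fun x _ => hφ1.differentiable one_ne_zero x
    · exact fun x _ => hψ1.differentiable one_ne_zero x
  have := hle hp
  change ℓ p = 0 at this
  rw [hℓ] at this
  linarith

/-- Testing with smooth functions supported in `U`, the weak gradient and the gradient of the
polynomial have the same integrals; the fundamental lemma of the calculus of variations identifies
them. -/
theorem ae_snd_eq_pgrad {Ω U : Set (E d)} (hU : IsOpen U) {p : L2Pair d} (hp : p ∈ H10 Ω)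
    (q : MvPolynomial (Fin d) ℝ) (hq : (p.1 : E d → ℝ) =ᵐ[volume.restrict U] pval q) :
    ∀ᵐ x ∂volume.restrict U, (p.2 x).ofLp = pgrad q x := by
  have hloc : ∀ i, LocallyIntegrable (fun x => p.2 x i) (volume : Measure (E d)) := by
    intro i
    have h1 : MemLp (fun x => p.2 x i) 2 (volume : Measure (E d)) :=
      (EuclideanSpace.proj i : E d →L[ℝ] ℝ).comp_memLp' (Lp.memLp p.2)
    exact h1.locallyIntegrable (by norm_num)
  have hcg : ∀ i, Continuous fun x => pgrad q x i := fun i => continuous_pval _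
  have key : ∀ i, ∀ᵐ x, x ∈ U → p.2 x i - pgrad q x i = 0 := by
    intro i
    refine hU.ae_eq_zero_of_integral_contDiff_smul_eq_zero
      (((hloc i).sub (hcg i).locallyIntegrable).locallyIntegrableOn U) ?_
    intro φ hφ hφc hφU
    have hφ1 : ContDiff ℝ 1 φ := hφ.of_le (by norm_cast)
    have hdc : Continuous fun x => fderiv ℝ φ x (EuclideanSpace.single i 1) :=
      (hφ1.continuous_fderiv one_ne_zero).clm_apply continuous_const
    have hdcs : HasCompactSupport fun x => fderiv ℝ φ x (EuclideanSpace.single i 1) :=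
      hφc.fderiv_apply ℝ _
    have hi1 : Integrable fun x => φ x * p.2 x i :=
      (hloc i).integrable_smul_left_of_hasCompactSupport hφ.continuous hφc
    have hi2 : Integrable fun x => φ x * pgrad q x i :=
      (hφ.continuous.mul (hcg i)).integrable_of_hasCompactSupport hφc.mul_right
    simp only [smul_eq_mul, Pi.sub_apply, mul_sub]
    rw [integral_sub hi1 hi2, integral_weak_gradient hp hφ hφc]
    have e1 : ∫ x, fderiv ℝ φ x (EuclideanSpace.single i 1) * p.1 x =
        ∫ x, fderiv ℝ φ x (EuclideanSpace.single i 1) * pval q x := by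
      refine integral_congr_ae ?_
      filter_upwards [(ae_restrict_iff' hU.measurableSet).1 hq] with x hx
      by_cases hxU : x ∈ U
      · rw [hx hxU]
      · have : fderiv ℝ φ x = 0 := by
          by_contra h
          exact hxU (hφU (support_fderiv_subset ℝ h))
        simp [this]
    have e2 : ∫ x, φ x * pgrad q x i =
      -∫ x, fderiv ℝ φ x (EuclideanSpace.single i 1) * pval q x := by
      simp_rw [← fderiv_pval_single]
      refine integral_mul_fderiv_eq_neg_fderiv_mul_of_integrable ?_ ?_ ?_ ?_ ?_
      · exact (hdc.mul (continuous_pval q)).integrable_of_hasCompactSupport hdcs.mul_right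
      · simp_rw [fderiv_pval_single]
        exact hi2
      · exact (hφ.continuous.mul (continuous_pval q)).integrable_of_hasCompactSupport hφc.mul_right
      · exact fun x _ => hφ1.differentiable one_ne_zero x
      · exact fun x _ => (contDiff_pval q).differentiable (by simp) x
    rw [e1, e2]
    ring
  rw [ae_restrict_iff' hU.measurableSet]
  filter_upwards [ae_all_iff.2 key] with x hx hxU
  funext i
  linarith [hx i hxU]

/-! ### Lipschitz domains and simplices -/

/-- A Lipschitz domain lies on one side of its boundary: just below the graph there are points with
a neighbourhood disjoint from `Ω`, so no boundary point is interior to the closure. This is needed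
because triangulations cover `closure Ω` whereas the coefficients are controlled on `Ω` only. -/
theorem interior_closure_eq {Ω : Set (E d)} (hΩ : IsOpen Ω) (hlip : HasLipschitzBoundary Ω) :
    interior (closure Ω) = Ω := by
  refine subset_antisymm (fun x hx => ?_) (hΩ.subset_interior_closure)
  by_contra hxΩ
  have hxf : x ∈ frontier Ω := by
    rw [frontier, hΩ.interior_eq]
    exact ⟨interior_subset hx, hxΩ⟩
  obtain ⟨e, he, r, hr, L, γ, hγ, hiff⟩ := hlip x hxf
  have hlow : inner ℝ e x ≤ γ (x - inner ℝ e x • e) := by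
    by_contra h
    exact hxΩ ((hiff x (Metric.mem_ball_self hr)).2 (not_le.1 h))
  have hc : Continuous fun t : ℝ => x - t • e := by fun_prop
  have h1 : ∀ᶠ t in 𝓝 (0 : ℝ), x - t • e ∈ interior (closure Ω) ∩ Metric.ball x r := by
    refine hc.continuousAt.eventually_mem ?_
    refine (isOpen_interior.inter Metric.isOpen_ball).mem_nhds ?_
    simpa using ⟨hx, hr⟩
  obtain ⟨δ, hδ, hball⟩ := Metric.eventually_nhds_iff.1 h1
  have h2 := @hball (δ / 2) (by simpa [abs_of_pos hδ] using by linarith)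
  set y := x - (δ / 2) • e with hy
  have hey : inner ℝ e y = inner ℝ e x - δ / 2 := by
    rw [hy, inner_sub_right, inner_smul_right, real_inner_self_eq_norm_sq, he]
    ring
  have hproj : y - inner ℝ e y • e = x - inner ℝ e x • e := by
    rw [hey, hy, sub_smul]
    abel
  have hopen : {z : E d | inner ℝ e z < γ (z - inner ℝ e z • e)} ∈ 𝓝 y := by
    refine (isOpen_lt (by fun_prop) (hγ.continuous.comp (by fun_prop))).mem_nhds ?_
    change inner ℝ e y < γ (y - inner ℝ e y • e)
    rw [hproj, hey]
    linarith
  obtain ⟨z, ⟨hz1, hz2⟩, hz3⟩ := mem_closure_iff_nhds.1 (interior_subset h2.1) _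
    (Filter.inter_mem hopen (Metric.isOpen_ball.mem_nhds h2.2))
  exact absurd ((hiff z hz2).1 hz3) (not_lt.2 (le_of_lt hz1))

namespace LSimplex

/-- The vertices of a nondegenerate simplex as an affine basis. -/
def basis (K : LSimplex d) (hK : AffineIndependent ℝ K.vert) :
    AffineBasis (Fin (d + 1)) ℝ (E d) :=
  ⟨K.vert, hK, by rw [hK.affineSpan_eq_top_iff_card_eq_finrank_add_one]; simp⟩

@[simp]
theorem coe_basis (K : LSimplex d) (hK : AffineIndependent ℝ K.vert) : ⇑(K.basis hK) = K.vert := rfl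

variable {K : LSimplex d}

theorem carrier_eq (hK : AffineIndependent ℝ K.vert) :
    K.carrier = {x | ∀ i, 0 ≤ (K.basis hK).coord i x} :=
  (K.basis hK).convexHull_eq_nonneg_coord

theorem interior_carrier_eq (hK : AffineIndependent ℝ K.vert) :
    interior K.carrier = {x | ∀ i, 0 < (K.basis hK).coord i x} :=
  (K.basis hK).interior_convexHull

theorem isCompact_carrier (K : LSimplex d) : IsCompact K.carrier :=
  (Set.finite_range K.vert).isCompact_convexHull ℝ

theorem convex_carrier (K : LSimplex d) : Convex ℝ K.carrier := convex_convexHull ℝ _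

theorem vert_mem_carrier (K : LSimplex d) (i : Fin (d + 1)) : K.vert i ∈ K.carrier :=
  subset_convexHull ℝ _ ⟨i, rfl⟩

theorem nonempty_interior (hK : AffineIndependent ℝ K.vert) : (interior K.carrier).Nonempty :=
  ⟨_, (K.basis hK).centroid_mem_interior_convexHull⟩

theorem closure_interior (hK : AffineIndependent ℝ K.vert) :
    closure (interior K.carrier) = K.carrier := by
  rw [(convex_carrier K).closure_interior_eq_closure_of_nonempty_interior (nonempty_interior hK),
    (isCompact_carrier K).isClosed.closure_eq]

theorem interior_ae_eq (K : LSimplex d) : interior K.carrier =ᵐ[volume] K.carrier :=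
  interior_ae_eq_of_null_frontier (K.convex_carrier.addHaar_frontier volume)

theorem restrict_interior (K : LSimplex d) :
    (volume : Measure (E d)).restrict (interior K.carrier) = volume.restrict K.carrier :=
  Measure.restrict_congr_set K.interior_ae_eq

end LSimplex

theorem IsTriangulation.carrier_subset {Ω : Set (E d)} {M : Finset (LSimplex d)}
    (hM : IsTriangulation Ω M) {K : LSimplex d} (hK : K ∈ M) : K.carrier ⊆ closure Ω := by
  rw [← hM.cover]
  exact Set.subset_biUnion_of_mem (u := fun K : LSimplex d => K.carrier) hK

theorem IsTriangulation.interior_subset {Ω : Set (E d)} {M : Finset (LSimplex d)} (hΩ : IsOpen Ω)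
    (hlip : HasLipschitzBoundary Ω) (hM : IsTriangulation Ω M) {K : LSimplex d} (hK : K ∈ M) :
    interior K.carrier ⊆ Ω := by
  rw [← interior_closure_eq hΩ hlip]
  exact interior_mono (hM.carrier_subset hK)

end

section

/-! ### Polynomial functions -/

/-- `pval` as a linear map. -/
def pvalLin (d : ℕ) : MvPolynomial (Fin d) ℝ →ₗ[ℝ] (E d → ℝ) where
  toFun := pval
  map_add' p q := by funext x; simp [pval]
  map_smul' c p := by funext x; simp [pval]

/-- The polynomial functions of degree at most `k`. -/
def polyFun (d k : ℕ) : Submodule ℝ (E d → ℝ) :=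
  (MvPolynomial.restrictTotalDegree (Fin d) ℝ k).map (pvalLin d)

instance (k : ℕ) : FiniteDimensional ℝ (polyFun d k) := by
  unfold polyFun
  infer_instance

theorem mem_polyFun {k : ℕ} {f : E d → ℝ} :
    f ∈ polyFun d k ↔ ∃ p : MvPolynomial (Fin d) ℝ, p.totalDegree ≤ k ∧ f = pval p := by
  constructor
  · rintro ⟨p, hp, rfl⟩
    exact ⟨p, (MvPolynomial.mem_restrictTotalDegree _ _ p).1 hp, rfl⟩
  · rintro ⟨p, hp, rfl⟩
    exact ⟨p, (MvPolynomial.mem_restrictTotalDegree _ _ p).2 hp, rfl⟩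

theorem pval_mem_polyFun {k : ℕ} {p : MvPolynomial (Fin d) ℝ} (hp : p.totalDegree ≤ k) :
    pval p ∈ polyFun d k := mem_polyFun.2 ⟨p, hp, rfl⟩

theorem contDiff_of_mem_polyFun {k : ℕ} {f : E d → ℝ} (hf : f ∈ polyFun d k) : ContDiff ℝ ∞ f := by
  obtain ⟨p, -, rfl⟩ := mem_polyFun.1 hf
  exact contDiff_pval p

theorem mul_mem_polyFun {k l : ℕ} {f g : E d → ℝ} (hf : f ∈ polyFun d k) (hg : g ∈ polyFun d l) :
    (fun x => f x * g x) ∈ polyFun d (k + l) := by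
  obtain ⟨p, hp, rfl⟩ := mem_polyFun.1 hf
  obtain ⟨q, hq, rfl⟩ := mem_polyFun.1 hg
  refine mem_polyFun.2 ⟨p * q, (MvPolynomial.totalDegree_mul p q).trans (add_le_add hp hq), ?_⟩
  funext x
  simp [pval]

theorem affineMap_mem_polyFun (φ : E d →ᵃ[ℝ] ℝ) : ⇑φ ∈ polyFun d 1 := by
  refine mem_polyFun.2 ⟨MvPolynomial.C (φ 0) +
    ∑ i, MvPolynomial.C (φ.linear (EuclideanSpace.single i 1)) * MvPolynomial.X i, ?_, ?_⟩
  · refine (MvPolynomial.totalDegree_add _ _).trans (max_le (by simp) ?_)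
    refine MvPolynomial.totalDegree_finsetSum_le fun i _ => ?_
    refine (MvPolynomial.totalDegree_mul _ _).trans ?_
    simp
  · funext x
    have h1 : φ x = φ.linear x + φ 0 := by
      have := φ.map_vadd 0 x
      simpa using this
    have h2 : x = ∑ i, x i • (EuclideanSpace.single i (1 : ℝ) : E d) := by
      ext j
      simp [Finset.sum_apply, Pi.single_apply]
    rw [h1]
    conv_lhs => rw [h2, map_sum]
    simp [pval, add_comm, mul_comm]

theorem comp_mem_polyFun {k : ℕ} {f : E d → ℝ} (hf : f ∈ polyFun d k) (F : E d →ᵃ[ℝ] E d) :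
    (fun x => f (F x)) ∈ polyFun d k := by
  obtain ⟨p, hp, rfl⟩ := mem_polyFun.1 hf
  have hG : ∀ i : Fin d, ∃ q : MvPolynomial (Fin d) ℝ, q.totalDegree ≤ 1 ∧
    ∀ x, F x i = pval q x := by
    intro i
    obtain ⟨q, hq, h⟩ := mem_polyFun.1 (affineMap_mem_polyFun
      ((EuclideanSpace.proj i : E d →L[ℝ] ℝ).toLinearMap.toAffineMap.comp F))
    exact ⟨q, hq, fun x => by rw [← h]; rfl⟩
  choose G hG1 hG2 using hG
  refine mem_polyFun.2 ⟨∑ m ∈ p.support, MvPolynomial.C (p.coeff m) * ∏ i, G i ^ m i, ?_, ?_⟩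
  · refine MvPolynomial.totalDegree_finsetSum_le fun m hm => ?_
    refine (MvPolynomial.totalDegree_mul _ _).trans ?_
    rw [MvPolynomial.totalDegree_C, zero_add]
    refine (MvPolynomial.totalDegree_finsetProd _ _).trans ?_
    have h1 : ∀ i, (G i ^ m i).totalDegree ≤ m i := fun i =>
      (MvPolynomial.totalDegree_pow _ _).trans (by nlinarith [hG1 i])
    refine (Finset.sum_le_sum fun i _ => h1 i).trans ?_
    have h2 := MvPolynomial.le_totalDegree hm
    rw [Finsupp.sum_fintype _ _ (fun _ => rfl)] at h2
    exact h2.trans hp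
  · funext x
    simp only [pval, MvPolynomial.eval_eq' _ p, map_sum, map_mul, MvPolynomial.eval_C,
      map_prod, map_pow]
    refine Finset.sum_congr rfl fun m _ => ?_
    congr 1
    refine Finset.prod_congr rfl fun i _ => ?_
    rw [hG2 i x, pval]

/-- An open set contains a box, that is, a product of infinite sets of reals, and only the zero
polynomial vanishes on such a product. -/
theorem eq_zero_of_eqOn_open {k : ℕ} {f : E d → ℝ} (hf : f ∈ polyFun d k) {U : Set (E d)}
    (hU : IsOpen U) (hne : U.Nonempty) (h : ∀ x ∈ U, f x = 0) : f = 0 := by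
  obtain ⟨p, -, rfl⟩ := mem_polyFun.1 hf
  obtain ⟨x, hx⟩ := hne
  have hU' : IsOpen ((WithLp.toLp 2 : (Fin d → ℝ) → E d) ⁻¹' U) :=
    hU.preimage (PiLp.continuous_toLp 2 _)
  obtain ⟨ε, hε, hball⟩ := Metric.isOpen_iff.1 hU' x.ofLp hx
  have hp : p = 0 := by
    refine MvPolynomial.funext_set (fun i => Metric.ball (x.ofLp i) ε) (fun i => ?_) ?_
    · rw [Real.ball_eq_Ioo]
      exact Set.Ioo_infinite (by linarith)
    · intro y hy
      have : y ∈ Metric.ball x.ofLp ε := by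
        rw [ball_pi _ hε]
        exact hy
      have := h _ (hball this)
      simpa [pval] using this
  rw [hp]
  funext y
  simp [pval]

/-- Equivalence of norms in finite dimension: in coordinates the weighted `L²` form is a continuous,
positive definite quadratic form, bounded below on the unit sphere by compactness. It therefore
controls values and derivatives on any compact set. All constants on the reference simplex originate
here. -/
theorem exists_sup_bound {V : Submodule ℝ (E d → ℝ)} [FiniteDimensional ℝ V]
    (hV : ∀ f ∈ V, ContDiff ℝ 1 f) (ν : Measure (E d)) [IsFiniteMeasure ν] {S : Set (E d)}
    (hS : IsCompact S) (hν : ∀ᵐ x ∂ν, x ∈ S) {w : E d → ℝ} (hw : Continuous w)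
    (hw0 : ∀ x, 0 ≤ w x) (hpos : ∀ f ∈ V, ∫ x, w x * f x ^ 2 ∂ν = 0 → f = 0) {S' : Set (E d)}
    (hS' : IsCompact S') :
    ∃ C : ℝ, 0 ≤ C ∧ ∀ f ∈ V, ∀ x ∈ S', f x ^ 2 ≤ C * ∫ x, w x * f x ^ 2 ∂ν ∧
      ‖fderiv ℝ f x‖ ^ 2 ≤ C * ∫ x, w x * f x ^ 2 ∂ν := by
  let n := Module.finrank ℝ V
  let e := Module.finBasis ℝ V
  have hinteg : ∀ f g : E d → ℝ, Continuous f → Continuous g →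
      Integrable (fun x => w x * (f x * g x)) ν := by
    intro f g hf hg
    have hc : Continuous fun x => w x * (f x * g x) := hw.mul (hf.mul hg)
    obtain ⟨B, hB⟩ := hS.exists_bound_of_continuousOn hc.continuousOn
    refine Integrable.of_bound hc.aestronglyMeasurable B ?_
    filter_upwards [hν] with x hx using hB x hx
  have hcV : ∀ i, Continuous (e i : E d → ℝ) := fun i => (hV _ (e i).2).continuous
  let f : (Fin n → ℝ) → E d → ℝ := fun c x => ∑ i, c i * (e i : E d → ℝ) x
  have hfV : ∀ c, f c ∈ V := by
    intro c
    have : f c = ((∑ i, c i • e i : V) : E d → ℝ) := by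
      funext x
      simp [f, Finset.sum_apply]
    rw [this]
    exact (∑ i, c i • e i : V).2
  let Q : (Fin n → ℝ) → ℝ := fun c => ∫ x, w x * f c x ^ 2 ∂ν
  have hQ : ∀ c, Q c =
    ∑ i, ∑ j, c i * c j * ∫ x, w x * ((e i : E d → ℝ) x * (e j : E d → ℝ) x) ∂ν := by
    intro c
    simp only [Q, f]
    have : ∀ x, w x * (∑ i, c i * (e i : E d → ℝ) x) ^ 2 =
        ∑ i, ∑ j, c i * c j * (w x * ((e i : E d → ℝ) x * (e j : E d → ℝ) x)) := by
      intro x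
      rw [sq, Finset.sum_mul_sum, Finset.mul_sum]
      refine Finset.sum_congr rfl fun i _ => ?_
      rw [Finset.mul_sum]
      exact Finset.sum_congr rfl fun j _ => by ring
    simp_rw [this]
    rw [integral_finsetSum]
    · refine Finset.sum_congr rfl fun i _ => ?_
      rw [integral_finsetSum]
      · exact Finset.sum_congr rfl fun j _ => integral_const_mul _ _
      · exact fun j _ => (hinteg _ _ (hcV i) (hcV j)).const_mul _
    · exact fun i _ => integrable_finsetSum _ fun j _ => (hinteg _ _ (hcV i) (hcV j)).const_mul _
  have hQc : Continuous Q := by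
    have : Q = fun c => ∑ i, ∑ j, c i * c j *
        ∫ x, w x * ((e i : E d → ℝ) x * (e j : E d → ℝ) x) ∂ν := funext hQ
    rw [this]
    fun_prop
  have hQ0 : ∀ c, 0 ≤ Q c := fun c =>
    integral_nonneg fun x => mul_nonneg (hw0 x) (sq_nonneg _)
  have hf0 : ∀ c, f c = 0 → c = 0 := by
    intro c hc
    have h1 : (∑ i, c i • e i : V) = 0 := by
      refine Subtype.ext ?_
      rw [ZeroMemClass.coe_zero, ← hc]
      funext x
      simp [f, Finset.sum_apply]
    have h2 := Fintype.linearIndependent_iff.1 e.linearIndependent c h1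
    exact funext h2
  obtain ⟨m, hm, hmQ⟩ : ∃ m : ℝ, 0 < m ∧ ∀ c, m * ‖c‖ ^ 2 ≤ Q c := by
    -- The sphere is empty when `V` is trivial; then every positive `m` works.
    by_cases hn : (Metric.sphere (0 : Fin n → ℝ) 1).Nonempty
    · obtain ⟨c₀, hc₀, hmin⟩ := (isCompact_sphere (0 : Fin n → ℝ) 1).exists_isMinOn hn
        hQc.continuousOn
      have hc₀' : ‖c₀‖ = 1 := by simpa using hc₀
      refine ⟨Q c₀, lt_of_le_of_ne (hQ0 c₀) fun h => ?_, fun c => ?_⟩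
      · have := hf0 c₀ (hpos _ (hfV c₀) h.symm)
        rw [this] at hc₀'
        simp at hc₀'
      · by_cases hc : c = 0
        · subst hc
          simpa using hQ0 0
        · have hcn : ‖c‖ ≠ 0 := norm_ne_zero_iff.2 hc
          have h1 : Q c₀ ≤ Q (‖c‖⁻¹ • c) := hmin (by simp [norm_smul, hcn])
          have h2 : Q (‖c‖⁻¹ • c) = (‖c‖⁻¹) ^ 2 * Q c := by
            rw [hQ, hQ, Finset.mul_sum]
            refine Finset.sum_congr rfl fun i _ => ?_
            rw [Finset.mul_sum]
            refine Finset.sum_congr rfl fun j _ => ?_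
            simp only [Pi.smul_apply, smul_eq_mul]
            ring
          rw [h2] at h1
          calc Q c₀ * ‖c‖ ^ 2 ≤ (‖c‖⁻¹ ^ 2 * Q c) * ‖c‖ ^ 2 := by gcongr
            _ = Q c := by field_simp
    · refine ⟨1, one_pos, fun c => ?_⟩
      have : c = 0 := by
        by_contra hc
        refine hn ⟨‖c‖⁻¹ • c, ?_⟩
        simp [norm_smul, norm_ne_zero_iff.2 hc]
      subst this
      simpa using hQ0 0
  have hB : ∀ i, ∃ B : ℝ, ∀ x ∈ S', |(e i : E d → ℝ) x| ≤ B ∧ ‖fderiv ℝ (e i : E d → ℝ) x‖ ≤ B := by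
    intro i
    obtain ⟨B1, hB1⟩ := hS'.exists_bound_of_continuousOn (hcV i).continuousOn
    obtain ⟨B2, hB2⟩ := hS'.exists_bound_of_continuousOn
      ((hV _ (e i).2).continuous_fderiv one_ne_zero).continuousOn
    exact ⟨max B1 B2, fun x hx => ⟨(hB1 x hx).trans (le_max_left _ _),
      (hB2 x hx).trans (le_max_right _ _)⟩⟩
  choose B hB using hB
  refine ⟨(∑ i, |B i|) ^ 2 / m, by positivity, fun g hg x hx => ?_⟩
  obtain ⟨c, rfl⟩ : ∃ c, g = f c := by
    refine ⟨fun i => e.repr ⟨g, hg⟩ i, ?_⟩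
    have h1 := e.sum_repr ⟨g, hg⟩
    funext x
    have h2 := congrArg (fun v : V => (v : E d → ℝ) x) h1
    refine Eq.trans h2.symm ?_
    change ((∑ i, e.repr ⟨g, hg⟩ i • e i : V) : E d → ℝ) x = _
    rw [Submodule.coe_sum, Finset.sum_apply]
    rfl
  have hcn : ‖c‖ ^ 2 ≤ Q c / m := by
    rw [le_div_iff₀ hm, mul_comm]
    exact hmQ c
  have hfin : ∀ t : ℝ, 0 ≤ t → t ≤ ‖c‖ * ∑ i, |B i| →
      t ^ 2 ≤ (∑ i, |B i|) ^ 2 / m * ∫ x, w x * f c x ^ 2 ∂ν := by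
    intro t ht0 ht
    calc t ^ 2 ≤ (‖c‖ * ∑ i, |B i|) ^ 2 := pow_le_pow_left₀ ht0 ht 2
      _ = (∑ i, |B i|) ^ 2 * ‖c‖ ^ 2 := by ring
      _ ≤ (∑ i, |B i|) ^ 2 * (Q c / m) := by gcongr
      _ = _ := by simp only [Q]; ring
  constructor
  · rw [← sq_abs]
    refine hfin _ (abs_nonneg _) ?_
    rw [Finset.mul_sum]
    refine (Finset.abs_sum_le_sum_abs _ _).trans (Finset.sum_le_sum fun i _ => ?_)
    rw [abs_mul]
    exact mul_le_mul (norm_le_pi_norm c i) (((hB i x hx).1).trans (le_abs_self _)) (abs_nonneg _)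
      (norm_nonneg _)
  · refine hfin _ (norm_nonneg _) ?_
    have hd : fderiv ℝ (f c) x = ∑ i, c i • fderiv ℝ (e i : E d → ℝ) x := by
      have hdi : ∀ i ∈ Finset.univ, DifferentiableAt ℝ (fun x => c i * (e i : E d → ℝ) x) x :=
        fun i _ => ((hV _ (e i).2).differentiable one_ne_zero x).const_mul _
      have : f c = fun x => ∑ i, c i * (e i : E d → ℝ) x := rfl
      rw [this, fderiv_fun_sum hdi]
      refine Finset.sum_congr rfl fun i _ => ?_
      exact fderiv_const_mul ((hV _ (e i).2).differentiable one_ne_zero x) _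
    rw [hd, Finset.mul_sum]
    refine (norm_sum_le _ _).trans (Finset.sum_le_sum fun i _ => ?_)
    rw [norm_smul]
    exact mul_le_mul (norm_le_pi_norm c i) (((hB i x hx).2).trans (le_abs_self _)) (norm_nonneg _)
      (norm_nonneg _)

end

section

/-! ### Affine transport between simplices -/

/-- The affine map that maps the vertices of one simplex to those of another one. -/
def transport (b₀ b : AffineBasis (Fin (d + 1)) ℝ (E d)) : E d →ᵃ[ℝ] E d where
  toFun x := ∑ k, b₀.coord k x • b k
  linear := ∑ k, (b₀.coord k).linear.smulRight (b k)
  map_vadd' x v := by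
    have h : ∀ k, b₀.coord k (v + x) = (b₀.coord k).linear v + b₀.coord k x := fun k =>
      (b₀.coord k).map_vadd x v
    simp only [h, add_smul, Finset.sum_add_distrib, vadd_eq_add, LinearMap.sum_apply,
      LinearMap.smulRight_apply]

variable (b₀ b : AffineBasis (Fin (d + 1)) ℝ (E d))

theorem transport_apply (x : E d) : transport b₀ b x = ∑ k, b₀.coord k x • b k := rfl

@[simp]
theorem coord_transport (j : Fin (d + 1)) (x : E d) :
    b.coord j (transport b₀ b x) = b₀.coord j x := by
  rw [transport_apply, LSimplex.coord_sum b _ (b₀.sum_coord_apply_eq_one x)]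
  simp [b.coord_apply]

theorem coords_transport (x : E d) : b.coords (transport b₀ b x) = b₀.coords x := by
  funext j
  simp

@[simp]
theorem transport_transport (x : E d) : transport b b₀ (transport b₀ b x) = x :=
  b₀.ext_elem fun j => by simp

theorem continuous_transport : Continuous (transport b₀ b) :=
  (transport b₀ b).continuous_of_finiteDimensional

theorem transport_injective : Function.Injective (transport b₀ b) :=
  Function.LeftInverse.injective (transport_transport b₀ b)

theorem image_transport (s : Set (E d)) : transport b₀ b '' s = transport b b₀ ⁻¹' s :=
  congrFun (Set.image_eq_preimage_of_inverse (transport_transport b₀ b)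
    (transport_transport b b₀)) s

theorem continuous_coord (j : Fin (d + 1)) : Continuous (b.coord j) :=
  (b.coord j).continuous_of_finiteDimensional

theorem continuous_coords : Continuous fun x => b.coords x :=
  continuous_pi fun j => continuous_coord b j

/-- The simplex spanned by an affine basis. -/
def hull : Set (E d) := convexHull ℝ (Set.range b)

theorem mem_hull (x : E d) : x ∈ hull b ↔ ∀ i, 0 ≤ b.coord i x := by
  rw [hull, b.convexHull_eq_nonneg_coord]
  rfl

theorem isCompact_hull : IsCompact (hull b) := (Set.finite_range b).isCompact_convexHull ℝ

theorem transport_mem_hull (x : E d) : transport b₀ b x ∈ hull b ↔ x ∈ hull b₀ := by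
  simp [mem_hull]

theorem image_transport_hull : transport b₀ b '' hull b₀ = hull b := by
  rw [image_transport]
  ext x
  exact transport_mem_hull b b₀ x

theorem measure_hull_pos : 0 < volume.real (hull b) := by
  have h1 : (interior (hull b)).Nonempty := ⟨_, b.centroid_mem_interior_convexHull⟩
  have h2 : 0 < volume (hull b) :=
    (isOpen_interior.measure_pos volume h1).trans_le (measure_mono interior_subset)
  exact ENNReal.toReal_pos h2.ne' (isCompact_hull b).measure_lt_top.ne

/-- The factor is the absolute value of the determinant. It is nonzero, since otherwise the target
simplex would have volume zero. -/
theorem exists_setIntegral_transport : ∃ c : ℝ, 0 < c ∧ ∀ s : Set (E d), MeasurableSet s →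
    ∀ g : E d → ℝ, ∫ x in transport b₀ b '' s, g x = c * ∫ x in s, g (transport b₀ b x) := by
  let A : E d →L[ℝ] E d := (transport b₀ b).linear.toContinuousLinearMap
  have hA : ∀ x, HasFDerivAt (transport b₀ b) A x := by
    intro x
    have h1 : ⇑(transport b₀ b) = fun y => A y + transport b₀ b 0 := by
      funext y
      have := (transport b₀ b).map_vadd 0 y
      rw [vadd_eq_add, add_zero] at this
      exact this
    rw [h1]
    exact A.hasFDerivAt.add_const _
  have key : ∀ s : Set (E d), MeasurableSet s → ∀ g : E d → ℝ,
      ∫ x in transport b₀ b '' s, g x = |A.det| * ∫ x in s, g (transport b₀ b x) := by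
    intro s hs g
    rw [integral_image_eq_integral_abs_det_fderiv_smul volume hs
      (fun x _ => (hA x).hasFDerivWithinAt) (transport_injective b₀ b).injOn]
    simp only [smul_eq_mul]
    rw [integral_const_mul]
  refine ⟨|A.det|, lt_of_le_of_ne (abs_nonneg _) fun h => ?_, key⟩
  have h1 := key (hull b₀) (isCompact_hull b₀).measurableSet (fun _ => 1)
  rw [← h, zero_mul, image_transport_hull] at h1
  simp only [integral_const, smul_eq_mul, mul_one, measureReal_restrict_apply_univ] at h1
  exact (measure_hull_pos b).ne' h1

/-- The outward unit normal of the side opposite to the `i`-th vertex. -/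
def IsOuterNormal (i : Fin (d + 1)) (n : E d) : Prop :=
  ‖n‖ = 1 ∧ (∀ j k, j ≠ i → k ≠ i → inner ℝ n (b j - b k) = 0) ∧
    ∀ j, j ≠ i → inner ℝ n (b i - b j) < 0

theorem exists_isOuterNormal (hd : 0 < d) (i : Fin (d + 1)) : ∃ n, IsOuterNormal b i n := by
  have hne : ∃ j : Fin (d + 1), j ≠ i := by
    haveI : Nontrivial (Fin (d + 1)) := Fin.nontrivial_iff_two_le.2 (by omega)
    exact exists_ne i
  obtain ⟨j₀, hj₀⟩ := hne
  let φ : E d →L[ℝ] ℝ := (b.coord i).linear.toContinuousLinearMap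
  let g : E d := (InnerProductSpace.toDual ℝ (E d)).symm φ
  have hg : ∀ x, inner ℝ g x = (b.coord i).linear x := fun x => by
    simp [g, φ]
  have hlin : ∀ j k, (b.coord i).linear (b j - b k) = b.coord i (b j) - b.coord i (b k) :=
    fun j k => (b.coord i).linearMap_vsub (b j) (b k)
  have hg0 : g ≠ 0 := by
    intro h
    have h1 := hg (b i - b j₀)
    rw [h, inner_zero_left, hlin, b.coord_apply_eq, b.coord_apply_ne hj₀.symm] at h1
    norm_num at h1
  have hgn : 0 < ‖g‖ := norm_pos_iff.2 hg0
  refine ⟨-(‖g‖⁻¹ • g), ?_, ?_, ?_⟩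
  · rw [norm_neg, norm_smul, norm_inv, norm_norm, inv_mul_cancel₀ hgn.ne']
  · intro j k hj hk
    rw [inner_neg_left, real_inner_smul_left, hg, hlin, b.coord_apply_ne hj.symm,
      b.coord_apply_ne hk.symm]
    simp
  · intro j hj
    rw [inner_neg_left, real_inner_smul_left, hg, hlin, b.coord_apply_eq,
      b.coord_apply_ne hj.symm]
    simpa using hg0

variable {b}

theorem IsOuterNormal.inner_sub {i : Fin (d + 1)} {n : E d} (hn : IsOuterNormal b i n)
    {j : Fin (d + 1)} (hj : j ≠ i) (x : E d) :
    inner ℝ n (x - b j) = b.coord i x * inner ℝ n (b i - b j) := by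
  have h1 : x - b j = ∑ k, b.coord k x • (b k - b j) := by
    simp only [smul_sub, Finset.sum_sub_distrib, ← Finset.sum_smul, b.sum_coord_apply_eq_one,
      one_smul, b.linear_combination_coord_eq_self]
  rw [h1, inner_sum, Finset.sum_eq_single i]
  · rw [inner_smul_right]
  · intro k _ hk
    rw [inner_smul_right, hn.2.1 k j hk hj, mul_zero]
  · simp

theorem IsOuterNormal.halfSpace {i : Fin (d + 1)} {n : E d} (hn : IsOuterNormal b i n)
    {j : Fin (d + 1)} (hj : j ≠ i) :
    {x | 0 ≤ b.coord i x} = {x | inner ℝ n x ≤ inner ℝ n (b j)} := by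
  ext x
  have h1 := hn.inner_sub hj x
  have h2 := hn.2.2 j hj
  rw [_root_.inner_sub_right] at h1
  change 0 ≤ b.coord i x ↔ inner ℝ n x ≤ inner ℝ n (b j)
  constructor
  · intro h
    nlinarith
  · intro h
    by_contra h3
    nlinarith [not_le.1 h3]

theorem IsOuterNormal.hyperplane {i : Fin (d + 1)} {n : E d} (hn : IsOuterNormal b i n)
    {j : Fin (d + 1)} (hj : j ≠ i) :
    {x | b.coord i x = 0} = {x | inner ℝ n x = inner ℝ n (b j)} := by
  ext x
  have h1 := hn.inner_sub hj x
  have h2 := hn.2.2 j hj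
  rw [_root_.inner_sub_right] at h1
  change b.coord i x = 0 ↔ inner ℝ n x = inner ℝ n (b j)
  constructor
  · intro h
    rw [h] at h1
    linarith
  · intro h
    rw [h, sub_self] at h1
    rcases mul_eq_zero.1 h1.symm with h | h
    · exact h
    · exact absurd h h2.ne

variable (b)

/-- The surface measure on the hyperplane that contains the side opposite to the `i`-th vertex. -/
def planeMeasure (i : Fin (d + 1)) : Measure (E d) :=
  (Measure.euclideanHausdorffMeasure (d - 1)).restrict {x | b.coord i x = 0}

variable {b}

theorem integral_halfSpace_coord {i : Fin (d + 1)} {n : E d} (hn : IsOuterNormal b i n)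
    (hd : 0 < d) {g : E d → ℝ} {C : ℝ≥0} (hg : LipschitzWith C g) (hgc : HasCompactSupport g)
    (e : E d) :
    ∫ x in {x | 0 ≤ b.coord i x}, lineDeriv ℝ g x e = inner ℝ e n * ∫ x, g x ∂planeMeasure b i := by
  obtain ⟨m, rfl⟩ : ∃ m, d = m + 1 := ⟨d - 1, by omega⟩
  obtain ⟨j, hj⟩ := exists_ne i
  rw [hn.halfSpace hj, planeMeasure, hn.hyperplane hj]
  exact integral_halfSpace_lineDeriv n hn.1 _ C g hg hgc e

variable (b)

/-- The change of variables for surface integrals is derived from that for volumes: the half-space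
divergence theorem is applied to `g` on the reference side and to its transport on the other one,
along the corresponding edges `b₀ i - b₀ j` and `b i - b j`. Comparison gives `c' = c α₀ / α`, where
`-α₀` and `-α` are the heights over the side. The height is at most the diameter, which yields the
inequality between `c` and `c'`. -/
theorem exists_scaling (hd : 0 < d) (i : Fin (d + 1)) : ∃ Γ : ℝ, 0 < Γ ∧
    ∀ b : AffineBasis (Fin (d + 1)) ℝ (E d), ∃ c c' : ℝ, 0 < c ∧ 0 < c' ∧
      c ≤ Γ * Metric.diam (hull b) * c' ∧
      (∀ g : E d → ℝ, ∫ x in hull b, g x = c * ∫ x in hull b₀, g (transport b₀ b x)) ∧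
      ∀ (g : E d → ℝ) (C : ℝ≥0), LipschitzWith C g → HasCompactSupport g →
        ∫ x, g (transport b b₀ x) ∂planeMeasure b i = c' * ∫ x, g x ∂planeMeasure b₀ i := by
  obtain ⟨n₀, hn₀⟩ := exists_isOuterNormal b₀ hd i
  have hne : ∃ j : Fin (d + 1), j ≠ i := by
    haveI : Nontrivial (Fin (d + 1)) := Fin.nontrivial_iff_two_le.2 (by omega)
    exact exists_ne i
  obtain ⟨j, hj⟩ := hne
  have hα₀ := hn₀.2.2 j hj
  rw [real_inner_comm] at hα₀
  set α₀ : ℝ := inner ℝ (b₀ i - b₀ j) n₀ with hα₀def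
  -- The constant `Γ` is the reciprocal of the height of the reference simplex over its `i`-th side.
  refine ⟨(-α₀)⁻¹, by simpa using hα₀, fun b => ?_⟩
  obtain ⟨n, hn⟩ := exists_isOuterNormal b hd i
  have hα := hn.2.2 j hj
  rw [real_inner_comm] at hα
  set α : ℝ := inner ℝ (b i - b j) n with hαdef
  obtain ⟨c, hc, hci⟩ := exists_setIntegral_transport b₀ b
  refine ⟨c, c * (α₀ / α), hc, mul_pos hc (div_pos_of_neg_of_neg hα₀ hα), ?_, ?_, ?_⟩
  · have h1 : -α ≤ Metric.diam (hull b) := by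
      have h2 : |α| ≤ ‖b i - b j‖ * ‖n‖ := abs_real_inner_le_norm _ _
      rw [hn.1, mul_one, ← dist_eq_norm] at h2
      have h3 : dist (b i) (b j) ≤ Metric.diam (hull b) :=
        Metric.dist_le_diam_of_mem (isCompact_hull b).isBounded
          (subset_convexHull ℝ _ ⟨i, rfl⟩) (subset_convexHull ℝ _ ⟨j, rfl⟩)
      exact (neg_le_abs α).trans (h2.trans h3)
    have h4 : (-α₀)⁻¹ * Metric.diam (hull b) * (c * (α₀ / α)) =
        c * (Metric.diam (hull b) / (-α)) := by
      have := hα₀.ne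
      have := hα.ne
      field_simp
    rw [h4]
    refine le_mul_of_one_le_right hc.le ?_
    rw [one_le_div (by linarith)]
    exact h1
  · intro g
    rw [← image_transport_hull b₀ b]
    exact hci _ (isCompact_hull b₀).measurableSet g
  · intro g C hg hgc
    have hTl : ∃ D : ℝ≥0, LipschitzWith D (transport b b₀) := by
      have h1 : ⇑(transport b b₀) =
          fun y => (transport b b₀).linear.toContinuousLinearMap y + transport b b₀ 0 := by
        funext y
        have := (transport b b₀).map_vadd 0 y
        simpa using this
      rw [h1]
      exact ⟨_, ((transport b b₀).linear.toContinuousLinearMap.lipschitz).add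
        (LipschitzWith.const _)⟩
    obtain ⟨D, hD⟩ := hTl
    have hgl := hg.comp hD
    have hgs : HasCompactSupport (g ∘ transport b b₀) := by
      refine hgc.comp_isClosedEmbedding ?_
      exact (Homeomorph.mk ⟨transport b b₀, transport b₀ b, transport_transport b b₀,
        transport_transport b₀ b⟩ (continuous_transport b b₀)
        (continuous_transport b₀ b)).isClosedEmbedding
    have e1 := integral_halfSpace_coord hn hd hgl hgs (b i - b j)
    have e2 := integral_halfSpace_coord hn₀ hd hg hgc (b₀ i - b₀ j)
    have himg : {x | 0 ≤ b.coord i x} = transport b₀ b '' {x | 0 ≤ b₀.coord i x} := by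
      rw [image_transport]
      ext x
      simp
    have hmeas : MeasurableSet {x | 0 ≤ b₀.coord i x} :=
      (isClosed_le continuous_const (continuous_coord b₀ i)).measurableSet
    rw [himg, hci _ hmeas] at e1
    have hline : ∀ x, lineDeriv ℝ (g ∘ transport b b₀) (transport b₀ b x) (b i - b j) =
        lineDeriv ℝ g x (b₀ i - b₀ j) := by
      intro x
      simp only [lineDeriv, Function.comp]
      congr 1
      funext t
      congr 1
      have h2 : (transport b b₀).linear (b i - b j) = b₀ i - b₀ j := by
        have h3 := (transport b b₀).linearMap_vsub (b i) (b j)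
        have h4 : ∀ k, transport b b₀ (b k) = b₀ k := fun k => by
          simp [transport_apply, b.coord_apply]
        rw [h4, h4] at h3
        exact h3
      have h5 := (transport b b₀).map_vadd (transport b₀ b x) (t • (b i - b j))
      rw [map_smul, h2, transport_transport] at h5
      rw [add_comm, add_comm x]
      exact h5
    simp_rw [hline] at e1
    rw [e2] at e1
    change c * (α₀ * _) = α * ∫ x, g (transport b b₀ x) ∂planeMeasure b i at e1
    have h6 := hα.ne
    have h7 : c * (α₀ / α) * ∫ x, g x ∂planeMeasure b₀ i
        = (c * (α₀ * ∫ x, g x ∂planeMeasure b₀ i)) / α := by ring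
    rw [h7, e1, mul_div_cancel_left₀ _ h6]

end

section

/-! ### Lipschitz functions -/

theorem exists_cutoff {S : Set (E d)} (hS : IsCompact S) : ∃ ψ : E d → ℝ, ContDiff ℝ ∞ ψ ∧
    HasCompactSupport ψ ∧ (∀ x ∈ S, ∀ᶠ y in 𝓝 x, ψ y = 1) ∧ ∀ x, 0 ≤ ψ x ∧ ψ x ≤ 1 := by
  have h1 : S ⊆ interior (Metric.cthickening 1 S) :=
    (Metric.self_subset_thickening one_pos S).trans
      (interior_maximal (Metric.thickening_subset_cthickening 1 S) Metric.isOpen_thickening)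
  obtain ⟨f, hf1, hf0, hf⟩ := exists_contMDiffMap_one_nhds_of_subset_interior
    (modelWithCornersSelf ℝ (E d)) (n := ⊤) hS.isClosed h1
  refine ⟨f, f.contMDiff.contDiff, ?_, fun x hx => ?_, fun x => ⟨(hf x).1, (hf x).2⟩⟩
  · exact HasCompactSupport.intro (hS.cthickening (r := 1)) hf0
  · exact hf1.filter_mono (nhds_le_nhdsSet hx)

theorem exists_lipschitzWith_mul {f g : E d → ℝ} {C C' : ℝ≥0} {B B' : ℝ} (hf : LipschitzWith C f)
    (hg : LipschitzWith C' g) (hB : ∀ x, |f x| ≤ B) (hB' : ∀ x, |g x| ≤ B') :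
    ∃ D : ℝ≥0, LipschitzWith D fun x => f x * g x := by
  have hB0 : 0 ≤ B := (abs_nonneg _).trans (hB 0)
  have hB0' : 0 ≤ B' := (abs_nonneg _).trans (hB' 0)
  refine ⟨(B * C' + B' * C).toNNReal, LipschitzWith.of_dist_le_mul fun x y => ?_⟩
  rw [Real.coe_toNNReal _ (by positivity), Real.dist_eq]
  have h1 := hf.dist_le_mul x y
  have h2 := hg.dist_le_mul x y
  rw [Real.dist_eq] at h1 h2
  calc |f x * g x - f y * g y| = |f x * (g x - g y) + g y * (f x - f y)| := by ring_nf
    _ ≤ |f x| * |g x - g y| + |g y| * |f x - f y| := by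
      rw [← abs_mul, ← abs_mul]
      exact abs_add_le _ _
    _ ≤ B * (C' * dist x y) + B' * (C * dist x y) := by
      gcongr
      · exact hB x
      · exact hB' y
    _ = _ := by ring

/-- The product of a bounded Lipschitz function with a `C¹` function of compact support. -/
theorem exists_lipschitzWith_mul_contDiff {f g : E d → ℝ} {C : ℝ≥0} {B : ℝ}
    (hf : LipschitzWith C f) (hB : ∀ x, |f x| ≤ B) (hg : ContDiff ℝ 1 g)
    (hgc : HasCompactSupport g) : ∃ D : ℝ≥0, LipschitzWith D fun x => f x * g x := by
  obtain ⟨C', hC'⟩ := hg.lipschitzWith_of_hasCompactSupport hgc one_ne_zero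
  obtain ⟨B', hB'⟩ := hg.continuous.bounded_above_of_compact_support hgc
  exact exists_lipschitzWith_mul hf hC' hB hB'

/-! ### Bubbles as Lipschitz functions -/

theorem exists_abs_bubble_sub_le (L : List (Fin (d + 1) → ℤ)) : ∃ Λ : ℝ, 0 ≤ Λ ∧
    ∀ (x y : Fin (d + 1) → ℝ) (δ : ℝ), 0 ≤ δ → (∀ j, |x j - y j| ≤ δ) →
      |bubble L x - bubble L y| ≤ Λ * δ := by
  have h1 : ∃ Λ : ℝ, 0 ≤ Λ ∧ ∀ (x y : Fin (d + 1) → ℝ) (δ : ℝ), 0 ≤ δ → (∀ j, |x j - y j| ≤ δ) →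
      |capMin L x - capMin L y| ≤ Λ * δ := by
    induction L with
    | nil => exact ⟨0, le_rfl, fun x y δ _ _ => by simp [capMin]⟩
    | cons f L ih =>
      obtain ⟨Λ, hΛ, h⟩ := ih
      refine ⟨max (∑ j, |(f j : ℝ)|) Λ, le_max_of_le_right hΛ, fun x y δ hδ hxy => ?_⟩
      refine (abs_min_sub_min_le_max _ _ _ _).trans (max_le ?_ ?_)
      · have h2 : formVal f x - formVal f y = ∑ j, (f j : ℝ) * (x j - y j) := by
          simp only [formVal, ← Finset.sum_sub_distrib, mul_sub]
        rw [h2]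
        calc |∑ j, (f j : ℝ) * (x j - y j)| ≤ ∑ j, |(f j : ℝ)| * δ := by
              refine (Finset.abs_sum_le_sum_abs _ _).trans (Finset.sum_le_sum fun j _ => ?_)
              rw [abs_mul]
              exact mul_le_mul_of_nonneg_left (hxy j) (abs_nonneg _)
          _ = (∑ j, |(f j : ℝ)|) * δ := by rw [Finset.sum_mul]
          _ ≤ _ := by gcongr; exact le_max_left _ _
      · refine (h x y δ hδ hxy).trans ?_
        gcongr
        exact le_max_right _ _
  obtain ⟨Λ, hΛ, h⟩ := h1
  refine ⟨Λ, hΛ, fun x y δ hδ hxy => ?_⟩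
  refine (abs_max_sub_max_le_max _ _ _ _).trans (max_le ?_ (h x y δ hδ hxy))
  simpa using by positivity

/-- The number `G` bounds the Lipschitz constants of the barycentric coordinates. -/
def CoordLip (b : AffineBasis (Fin (d + 1)) ℝ (E d)) (G : ℝ) : Prop :=
  0 ≤ G ∧ ∀ j x y, |b.coord j x - b.coord j y| ≤ G * ‖x - y‖

theorem exists_coordLip (b : AffineBasis (Fin (d + 1)) ℝ (E d)) : ∃ G, CoordLip b G := by
  refine ⟨∑ j, ‖(b.coord j).linear.toContinuousLinearMap‖, by positivity, fun j x y => ?_⟩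
  have h1 : b.coord j x - b.coord j y = (b.coord j).linear.toContinuousLinearMap (x - y) :=
    ((b.coord j).linearMap_vsub x y).symm
  rw [h1, ← Real.norm_eq_abs]
  refine (ContinuousLinearMap.le_opNorm _ _).trans ?_
  gcongr
  exact Finset.single_le_sum (f := fun j => ‖(b.coord j).linear.toContinuousLinearMap‖)
    (fun _ _ => norm_nonneg _) (Finset.mem_univ j)

variable {b₀ b : AffineBasis (Fin (d + 1)) ℝ (E d)} {G : ℝ}

theorem CoordLip.lipschitz_bubble (hG : CoordLip b G) {L : List (Fin (d + 1) → ℤ)} {Λ : ℝ}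
    (hΛ : 0 ≤ Λ) (h : ∀ (x y : Fin (d + 1) → ℝ) (δ : ℝ), 0 ≤ δ → (∀ j, |x j - y j| ≤ δ) →
      |bubble L x - bubble L y| ≤ Λ * δ) :
    LipschitzWith (Λ * G).toNNReal fun x => bubble L (b.coords x) := by
  refine LipschitzWith.of_dist_le_mul fun x y => ?_
  rw [Real.coe_toNNReal _ (mul_nonneg hΛ hG.1), Real.dist_eq, mul_assoc, dist_eq_norm]
  exact h _ _ _ (mul_nonneg hG.1 (norm_nonneg _)) fun j => hG.2 j x y

theorem exists_lipschitzWith_bubble (b : AffineBasis (Fin (d + 1)) ℝ (E d))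
    (L : List (Fin (d + 1) → ℤ)) :
    ∃ C : ℝ≥0, LipschitzWith C fun x => bubble L (b.coords x) := by
  obtain ⟨Λ, hΛ, h⟩ := exists_abs_bubble_sub_le L
  obtain ⟨G, hG⟩ := exists_coordLip b
  exact ⟨_, hG.lipschitz_bubble hΛ h⟩

theorem CoordLip.norm_transport_sub_le (hG : CoordLip b G) (x y : E d) :
    ‖transport b b₀ x - transport b b₀ y‖ ≤ G * (∑ k, ‖b₀ k‖) * ‖x - y‖ := by
  rw [transport_apply, transport_apply, ← Finset.sum_sub_distrib, Finset.mul_sum, Finset.sum_mul]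
  refine (norm_sum_le _ _).trans (Finset.sum_le_sum fun k _ => ?_)
  rw [← sub_smul, norm_smul, Real.norm_eq_abs]
  calc _ ≤ G * ‖x - y‖ * ‖b₀ k‖ := by gcongr; exact hG.2 k x y
    _ = _ := by ring

theorem differentiable_transport (b b₀ : AffineBasis (Fin (d + 1)) ℝ (E d)) :
    Differentiable ℝ (transport b b₀) :=
  (⟨transport b b₀, continuous_transport b b₀⟩ : E d →ᴬ[ℝ] E d).differentiable

theorem CoordLip.norm_fderiv_comp_le (hG : CoordLip b G) {f : E d → ℝ} {x : E d}
    (hf : DifferentiableAt ℝ f (transport b b₀ x)) :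
    ‖fderiv ℝ (fun y => f (transport b b₀ y)) x‖ ≤
      ‖fderiv ℝ f (transport b b₀ x)‖ * (G * ∑ k, ‖b₀ k‖) := by
  have hT : DifferentiableAt ℝ (transport b b₀) x :=
    differentiable_transport b b₀ x
  have h1 : fderiv ℝ (fun y => f (transport b b₀ y)) x =
      (fderiv ℝ f (transport b b₀ x)).comp (fderiv ℝ (transport b b₀) x) :=
    fderiv_comp x hf hT
  rw [h1]
  refine (ContinuousLinearMap.opNorm_comp_le _ _).trans ?_
  gcongr
  have hl : LipschitzWith (G * ∑ k, ‖b₀ k‖).toNNReal (transport b b₀) := by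
    refine LipschitzWith.of_dist_le_mul fun x y => ?_
    rw [Real.coe_toNNReal _ (mul_nonneg hG.1 (by positivity)), dist_eq_norm, dist_eq_norm]
    exact hG.norm_transport_sub_le x y
  have h2 := norm_fderiv_le_of_lipschitz ℝ hl (x₀ := x)
  rwa [Real.coe_toNNReal _ (mul_nonneg hG.1 (by positivity))] at h2

/-- By the product rule the bubble contributes `Λ * G` and the transported function `G * ∑ ‖b₀ k‖`.
The target simplex enters only through the Lipschitz constant `G` of its coordinates. -/
theorem exists_gradient_bubble_mul_le (b₀ : AffineBasis (Fin (d + 1)) ℝ (E d))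
    (L : List (Fin (d + 1) → ℤ)) : ∃ C : ℝ, 0 ≤ C ∧
    ∀ (b : AffineBasis (Fin (d + 1)) ℝ (E d)) (G : ℝ), CoordLip b G → ∀ (f : E d → ℝ) (Q : ℝ),
      ContDiff ℝ 1 f → (∀ x ∈ hull b₀, f x ^ 2 ≤ Q ∧ ‖fderiv ℝ f x‖ ^ 2 ≤ Q) →
      ∀ᵐ x, x ∈ hull b →
        ‖gradient (fun y => bubble L (b.coords y) * f (transport b b₀ y)) x‖ ^ 2 ≤
          C * G ^ 2 * Q := by
  obtain ⟨Λ, hΛ, h⟩ := exists_abs_bubble_sub_le L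
  refine ⟨2 * ((∑ k, ‖b₀ k‖) ^ 2 + Λ ^ 2), by positivity, fun b G hG f Q hf hQ => ?_⟩
  have hw := hG.lipschitz_bubble hΛ h
  filter_upwards [hw.ae_differentiableAt] with x hx hxb
  obtain ⟨hq1, hq2⟩ := hQ _ ((transport_mem_hull b b₀ x).2 hxb)
  have hfx : DifferentiableAt ℝ f (transport b b₀ x) := hf.differentiable one_ne_zero _
  have hfT : DifferentiableAt ℝ (fun y => f (transport b b₀ y)) x :=
    hfx.comp x (differentiable_transport b b₀ x)
  rw [norm_gradient, fderiv_fun_mul hx hfT]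
  have e1 := hG.norm_fderiv_comp_le hfx
  have e2 := norm_fderiv_le_of_lipschitz ℝ hw (x₀ := x)
  rw [Real.coe_toNNReal _ (mul_nonneg hΛ hG.1)] at e2
  have e3 : ‖bubble L (b.coords x) • fderiv ℝ (fun y => f (transport b b₀ y)) x +
      f (transport b b₀ x) • fderiv ℝ (fun y => bubble L (b.coords y)) x‖ ≤
      ‖fderiv ℝ f (transport b b₀ x)‖ * (G * ∑ k, ‖b₀ k‖) + |f (transport b b₀ x)| * (Λ * G) := by
    refine (norm_add_le _ _).trans (add_le_add ?_ ?_)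
    · rw [norm_smul, Real.norm_eq_abs, abs_of_nonneg (bubble_nonneg _ _)]
      exact (mul_le_of_le_one_left (norm_nonneg _) (bubble_le_one _ _)).trans e1
    · rw [norm_smul, Real.norm_eq_abs]
      gcongr
  have hs : 0 ≤ ∑ k, ‖b₀ k‖ := by positivity
  set s := ∑ k, ‖b₀ k‖
  set t := ‖fderiv ℝ f (transport b b₀ x)‖
  set r := |f (transport b b₀ x)| with hr
  have hr2 : r ^ 2 ≤ Q := by rw [hr, sq_abs]; exact hq1
  calc _ ≤ (t * (G * s) + r * (Λ * G)) ^ 2 := pow_le_pow_left₀ (norm_nonneg _) e3 2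
    _ ≤ 2 * ((t * (G * s)) ^ 2 + (r * (Λ * G)) ^ 2) := by
      nlinarith [sq_nonneg (t * (G * s) - r * (Λ * G))]
    _ = 2 * (s ^ 2 * G ^ 2 * t ^ 2 + Λ ^ 2 * G ^ 2 * r ^ 2) := by ring
    _ ≤ 2 * (s ^ 2 * G ^ 2 * Q + Λ ^ 2 * G ^ 2 * Q) := by gcongr
    _ = _ := by ring

theorem setIntegral_le_of_sq_le {f : E d → ℝ} {S : Set (E d)} {ν : Measure (E d)} {Q : ℝ}
    (hS : MeasurableSet S) (hν : ν S ≠ ⊤)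
    (h : ∀ᵐ x ∂ν, x ∈ S → f x ≤ Q) (h0 : ∀ x, 0 ≤ f x) : ∫ x in S, f x ∂ν ≤ ν.real S * Q := by
  haveI : IsFiniteMeasure (ν.restrict S) := ⟨by simpa using hν.lt_top⟩
  have h1 : ∫ x in S, f x ∂ν ≤ ∫ x in S, Q ∂ν := by
    refine integral_mono_of_nonneg (Filter.Eventually.of_forall h0) (integrable_const _) ?_
    exact (ae_restrict_iff' hS).2 h
  simpa using h1

/-! ### Estimates on an element -/

/-- On the reference simplex the bubble-weighted `L²` norm of a polynomial controls its values and
derivatives. Affine transport preserves degrees and barycentric coordinates and multiplies all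
volume integrals by the same factor, so the constant does not depend on `b`. -/
theorem exists_elem_estimate (b₀ : AffineBasis (Fin (d + 1)) ℝ (E d)) (L : List (Fin (d + 1) → ℤ))
    (hL : ∃ x : Fin (d + 1) → ℝ, ∑ j, x j = 1 ∧ 0 < bubble L x)
    (hpos : ∀ x : Fin (d + 1) → ℝ, bubble L x ≠ 0 → ∀ j, 0 < x j) (k : ℕ) : ∃ C : ℝ, 0 ≤ C ∧
    ∀ (b : AffineBasis (Fin (d + 1)) ℝ (E d)) (G : ℝ), CoordLip b G → ∀ f ∈ polyFun d k,
      ∫ x in hull b, f x ^ 2 ≤ C * ∫ x in hull b, bubble L (b.coords x) * f x ^ 2 ∧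
      ∫ x in hull b, ‖gradient (fun y => bubble L (b.coords y) * f y) x‖ ^ 2 ≤
        C * G ^ 2 * ∫ x in hull b, f x ^ 2 := by
  haveI : IsFiniteMeasure ((volume : Measure (E d)).restrict (hull b₀)) :=
    ⟨by simpa using (isCompact_hull b₀).measure_lt_top⟩
  have hwc : Continuous fun x => bubble L (b₀.coords x) :=
    (continuous_bubble L).comp (continuous_coords b₀)
  obtain ⟨C₀, hC₀, hsup⟩ := exists_sup_bound (V := polyFun d k)
    (fun f hf => (contDiff_of_mem_polyFun hf).of_le (by norm_cast))
    ((volume : Measure (E d)).restrict (hull b₀)) (isCompact_hull b₀)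
    (ae_restrict_mem (isCompact_hull b₀).measurableSet) hwc (fun x => bubble_nonneg _ _)
    (by
      intro f hf h0
      have hfc := (contDiff_of_mem_polyFun hf).continuous
      have hcont : Continuous fun x => bubble L (b₀.coords x) * f x ^ 2 := hwc.mul (hfc.pow 2)
      have hae := (integral_eq_zero_iff_of_nonneg
        (fun x => mul_nonneg (bubble_nonneg _ _) (sq_nonneg _))
        (hcont.continuousOn.integrableOn_compact (isCompact_hull b₀))).1 h0
      -- Definiteness: if the weighted integral vanishes, then `f` vanishes on the nonempty open set
      -- where the bubble is positive, which lies inside the simplex.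
      have hU : IsOpen {x | 0 < bubble L (b₀.coords x)} := isOpen_lt continuous_const hwc
      refine eq_zero_of_eqOn_open hf hU ?_ ?_
      · obtain ⟨x, hx1, hx⟩ := hL
        refine ⟨∑ j, x j • b₀ j, ?_⟩
        have : b₀.coords (∑ j, x j • b₀ j) = x := by
          funext j
          rw [AffineBasis.coords_apply, LSimplex.coord_sum b₀ x hx1]
          simp [b₀.coord_apply]
        simpa [this] using hx
      · intro x hx
        by_contra hfx
        have hopen : IsOpen {x | 0 < bubble L (b₀.coords x) * f x ^ 2} :=
          isOpen_lt continuous_const hcont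
        have hsub : {x | 0 < bubble L (b₀.coords x) * f x ^ 2} ⊆ hull b₀ := by
          intro y hy
          rw [mem_hull]
          intro j
          refine (hpos (b₀.coords y) ?_ j).le
          intro h
          simp [h] at hy
        have h1 : volume {x | 0 < bubble L (b₀.coords x) * f x ^ 2} = 0 := by
          rw [Filter.EventuallyEq, ae_restrict_iff' (isCompact_hull b₀).measurableSet] at hae
          refine measure_mono_null ?_ hae
          intro y hy h
          have := h (hsub hy)
          simp only [Pi.zero_apply] at this
          exact absurd this (ne_of_gt hy)
        have hx' : 0 < bubble L (b₀.coords x) * f x ^ 2 := mul_pos hx (by positivity)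
        exact absurd h1 (hopen.measure_pos volume ⟨x, hx'⟩).ne')
    (isCompact_hull b₀)
  obtain ⟨C₁, hC₁, hgrad⟩ := exists_gradient_bubble_mul_le b₀ L
  set m := volume.real (hull b₀) with hm
  have hm0 : 0 < m := measure_hull_pos b₀
  refine ⟨m * C₀ + m * C₁ * C₀, by positivity, fun b G hG f hf => ?_⟩
  obtain ⟨c, hc, hci⟩ := exists_setIntegral_transport b₀ b
  have hinteg : ∀ g : E d → ℝ, ∫ x in hull b, g x = c * ∫ x in hull b₀, g (transport b₀ b x) := by
    intro g
    rw [← image_transport_hull b₀ b]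
    exact hci _ (isCompact_hull b₀).measurableSet g
  have hvol : volume.real (hull b) = c * m := by
    have := hinteg fun _ => 1
    simpa using this
  have hb := hsup _ (comp_mem_polyFun hf (transport b₀ b))
  set Q := ∫ x in hull b₀, bubble L (b₀.coords x) * f (transport b₀ b x) ^ 2 with hQ
  have hQ0 : 0 ≤ Q := integral_nonneg fun x => mul_nonneg (bubble_nonneg _ _) (sq_nonneg _)
  have hQ1 : c * Q = ∫ x in hull b, bubble L (b.coords x) * f x ^ 2 := by
    rw [hinteg]
    simp only [coords_transport, hQ]
  have hfcont := (contDiff_of_mem_polyFun hf).continuous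
  have hwb : Continuous fun x => bubble L (b.coords x) :=
    (continuous_bubble L).comp (continuous_coords b)
  have hI : c * Q ≤ ∫ x in hull b, f x ^ 2 := by
    rw [hQ1]
    refine integral_mono ((hwb.mul (hfcont.pow 2)).continuousOn.integrableOn_compact
      (isCompact_hull b)) ((hfcont.pow 2).continuousOn.integrableOn_compact (isCompact_hull b)) ?_
    intro x
    exact mul_le_of_le_one_left (sq_nonneg _) (bubble_le_one _ _)
  constructor
  · have h1 : ∫ x in hull b, f x ^ 2 ≤ volume.real (hull b) * (C₀ * Q) := by
      refine setIntegral_le_of_sq_le (isCompact_hull b).measurableSet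
        (isCompact_hull b).measure_lt_top.ne (Filter.Eventually.of_forall fun x hx => ?_)
        fun x => sq_nonneg _
      have := (hb (transport b b₀ x) ((transport_mem_hull b b₀ x).2 hx)).1
      simpa using this
    rw [hvol] at h1
    rw [← hQ1]
    have : 0 ≤ m * C₁ * C₀ * (c * Q) := by positivity
    nlinarith
  · have h1 : ∫ x in hull b, ‖gradient (fun y => bubble L (b.coords y) * f y) x‖ ^ 2 ≤
        volume.real (hull b) * (C₁ * G ^ 2 * (C₀ * Q)) := by
      refine setIntegral_le_of_sq_le (isCompact_hull b).measurableSet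
        (isCompact_hull b).measure_lt_top.ne ?_ fun x => sq_nonneg _
      have := hgrad b G hG (fun x => f (transport b₀ b x)) (C₀ * Q)
        ((contDiff_of_mem_polyFun (comp_mem_polyFun hf _)).of_le (by norm_cast)) hb
      simpa using this
    rw [hvol] at h1
    have h2 : c * m * (C₁ * G ^ 2 * (C₀ * Q)) = m * C₁ * C₀ * G ^ 2 * (c * Q) := by ring
    rw [h2] at h1
    refine h1.trans ?_
    have h3 : 0 ≤ ∫ x in hull b, f x ^ 2 := integral_nonneg fun x => sq_nonneg _
    calc _ ≤ m * C₁ * C₀ * G ^ 2 * ∫ x in hull b, f x ^ 2 := by gcongr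
      _ ≤ _ := by
        gcongr
        nlinarith [mul_nonneg hm0.le hC₀]

end

section

/-! ### Estimates on a side -/

/-- The affine projection onto the hyperplane of the side opposite to the `i`-th vertex that maps
the `i`-th vertex to the `j`-th one. -/
def sideProj (b : AffineBasis (Fin (d + 1)) ℝ (E d)) (i j : Fin (d + 1)) : E d →ᵃ[ℝ] E d where
  toFun x := x - b.coord i x • (b i - b j)
  linear := LinearMap.id - (b.coord i).linear.smulRight (b i - b j)
  map_vadd' x v := by
    have h : b.coord i (v + x) = (b.coord i).linear v + b.coord i x := (b.coord i).map_vadd x v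
    simp only [h, add_smul, vadd_eq_add, LinearMap.sub_apply, LinearMap.smulRight_apply,
      LinearMap.id_apply]
    abel

variable (b₀ b : AffineBasis (Fin (d + 1)) ℝ (E d)) {i j : Fin (d + 1)}

theorem sideProj_apply (x : E d) : sideProj b i j x = x - b.coord i x • (b i - b j) := rfl

theorem coord_sideProj (l : Fin (d + 1)) (x : E d) : b.coord l (sideProj b i j x) =
    b.coord l x - b.coord i x * (b.coord l (b i) - b.coord l (b j)) := by
  have h1 := (b.coord l).map_vadd x (-(b.coord i x • (b i - b j)))
  have h2 : (b.coord l).linear (b i - b j) = b.coord l (b i) - b.coord l (b j) :=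
    (b.coord l).linearMap_vsub (b i) (b j)
  rw [map_neg, map_smul, h2, vadd_eq_add, vadd_eq_add, smul_eq_mul] at h1
  rw [sideProj_apply, sub_eq_neg_add, h1]
  ring

theorem coord_sideProj_self (hji : j ≠ i) (x : E d) : b.coord i (sideProj b i j x) = 0 := by
  rw [coord_sideProj, b.coord_apply_eq, b.coord_apply_ne hji.symm]
  ring

variable {b} in
theorem sideProj_eq_self {x : E d} (hx : b.coord i x = 0) : sideProj b i j x = x := by
  rw [sideProj_apply, hx, zero_smul, sub_zero]

theorem transport_sideProj (x : E d) :
    transport b₀ b (sideProj b₀ i j x) = sideProj b i j (transport b₀ b x) := by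
  refine b.ext_elem fun l => ?_
  rw [coord_transport, coord_sideProj, coord_sideProj, coord_transport, coord_transport]
  simp [b.coord_apply, b₀.coord_apply]

theorem continuous_sideProj : Continuous (sideProj b i j) :=
  (sideProj b i j).continuous_of_finiteDimensional

theorem exists_plane_param (hd : 0 < d) (i : Fin (d + 1)) : ∃ φ : E (d - 1) → E d, Isometry φ ∧
    Set.range φ = {x | b.coord i x = 0} ∧ planeMeasure b i = volume.map φ := by
  obtain ⟨m, rfl⟩ : ∃ m, d = m + 1 := ⟨d - 1, by omega⟩
  obtain ⟨n, hn⟩ := exists_isOuterNormal b hd i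
  obtain ⟨j, hj⟩ := exists_ne i
  obtain ⟨ι, h0, h1, -⟩ := exists_hyperplane_coordinates n hn.1
  refine ⟨fun y => (inner ℝ n (b j) : ℝ) • n + ι y, (isometry_add_left _).comp ι.isometry, ?_, ?_⟩
  · rw [hn.hyperplane hj]
    ext x
    constructor
    · rintro ⟨y, rfl⟩
      change inner ℝ n (inner ℝ n (b j) • n + ι y) = inner ℝ n (b j)
      rw [inner_add_right, inner_smul_right, h0, real_inner_self_eq_norm_sq, hn.1]
      simp
    · intro hx
      obtain ⟨y, hy⟩ := h1 x
      refine ⟨y, ?_⟩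
      have hx' : inner ℝ n x = inner ℝ n (b j) := hx
      rw [hx'] at hy
      exact hy.symm
  · rw [planeMeasure, hn.hyperplane hj]
    exact (map_hyperplane_volume n hn.1 ι h0 h1 _).symm

theorem planeMeasure_pos (hd : 0 < d) {U : Set (E d)} (hU : IsOpen U) {x : E d} (hx : x ∈ U)
    (hxi : b.coord i x = 0) : 0 < planeMeasure b i U := by
  obtain ⟨φ, hφ, hr, he⟩ := exists_plane_param b hd i
  rw [he, Measure.map_apply hφ.continuous.measurable hU.measurableSet]
  have : x ∈ Set.range φ := by rw [hr]; exact hxi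
  obtain ⟨y, rfl⟩ := this
  exact (hU.preimage hφ.continuous).measure_pos volume ⟨y, hx⟩

theorem planeMeasure_lt_top (hd : 0 < d) {S : Set (E d)} (hS : IsCompact S) :
    planeMeasure b i S < ⊤ := by
  obtain ⟨φ, hφ, hr, he⟩ := exists_plane_param b hd i
  rw [he, Measure.map_apply hφ.continuous.measurable hS.measurableSet]
  exact (hφ.isClosedEmbedding.isCompact_preimage hS).measure_lt_top

theorem ae_planeMeasure : ∀ᵐ x ∂planeMeasure b i, b.coord i x = 0 :=
  ae_restrict_mem (isClosed_eq (continuous_coord b i) continuous_const).measurableSet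

/-- The surface measure on a side. -/
def faceMeasure (i : Fin (d + 1)) : Measure (E d) := (planeMeasure b i).restrict (hull b)

theorem isFiniteMeasure_faceMeasure (hd : 0 < d) (i : Fin (d + 1)) :
    IsFiniteMeasure (faceMeasure b i) :=
  ⟨by simpa [faceMeasure] using planeMeasure_lt_top b hd (isCompact_hull b)⟩

theorem ae_faceMeasure : ∀ᵐ x ∂faceMeasure b i, b.coord i x = 0 ∧ x ∈ hull b :=
  (ae_restrict_of_ae (ae_planeMeasure b)).and (ae_restrict_mem (isCompact_hull b).measurableSet)

theorem integrable_faceMeasure (hd : 0 < d) {f : E d → ℝ} (hf : Continuous f) :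
    Integrable f (faceMeasure b i) :=
  hf.continuousOn.integrableOn_of_subset_isCompact (isCompact_hull b)
    (isCompact_hull b).measurableSet subset_rfl (planeMeasure_lt_top b hd (isCompact_hull b)).ne

variable {b}

/-- On the plane the bubble vanishes off the side, so the cutoff `ψ` is invisible. It serves to give
the integrand the compact support that `exists_scaling` demands. -/
theorem integral_planeMeasure_eq {L : List (Fin (d + 1) → ℤ)}
    (hpos : ∀ x : Fin (d + 1) → ℝ, x i = 0 → bubble L x ≠ 0 → ∀ l, l ≠ i → 0 < x l)
    {ψ : E d → ℝ} (hψ : ∀ x ∈ hull b, ψ x = 1) (f : E d → ℝ) :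
    ∫ x, bubble L (b.coords x) * (f x ^ 2 * ψ x) ∂planeMeasure b i =
      ∫ x, bubble L (b.coords x) * f x ^ 2 ∂faceMeasure b i := by
  rw [faceMeasure, ← integral_indicator (isCompact_hull b).measurableSet]
  refine integral_congr_ae ?_
  filter_upwards [ae_planeMeasure b] with x hx
  by_cases hxh : x ∈ hull b
  · rw [Set.indicator_of_mem hxh, hψ x hxh, mul_one]
  · rw [Set.indicator_of_notMem hxh]
    have : bubble L (b.coords x) = 0 := by
      by_contra h
      refine hxh ((mem_hull b x).2 fun l => ?_)
      by_cases hl : l = i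
      · rw [hl, hx]
      · exact (hpos (b.coords x) hx h l hl).le
    rw [this, zero_mul]

/-- The side analogue of `exists_elem_estimate`. A function on the side is extended to the simplex
by being constant along the edge direction `b i - b j`; transport commutes with this extension.
Passing from surface to volume integrals costs one factor of the diameter, by the inequality in
`exists_scaling`. -/
theorem exists_side_estimate (b₀ : AffineBasis (Fin (d + 1)) ℝ (E d)) (hd : 0 < d) (hji : j ≠ i)
    (L : List (Fin (d + 1) → ℤ))
    (hL : ∃ x : Fin (d + 1) → ℝ, x i = 0 ∧ ∑ j, x j = 1 ∧ 0 < bubble L x)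
    (hpos : ∀ x : Fin (d + 1) → ℝ, x i = 0 → bubble L x ≠ 0 → ∀ l, l ≠ i → 0 < x l) (k : ℕ) :
    ∃ C : ℝ, 0 ≤ C ∧ ∀ (b : AffineBasis (Fin (d + 1)) ℝ (E d)) (G : ℝ), CoordLip b G →
      ∀ f ∈ polyFun d k,
      ∫ x, f x ^ 2 ∂faceMeasure b i ≤ C * ∫ x, bubble L (b.coords x) * f x ^ 2 ∂faceMeasure b i ∧
      ∫ x in hull b, f (sideProj b i j x) ^ 2 ≤
        C * Metric.diam (hull b) * ∫ x, f x ^ 2 ∂faceMeasure b i ∧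
      ∫ x in hull b, ‖gradient (fun y => bubble L (b.coords y) * f (sideProj b i j y)) x‖ ^ 2 ≤
        C * G ^ 2 * Metric.diam (hull b) * ∫ x, f x ^ 2 ∂faceMeasure b i := by
  haveI := isFiniteMeasure_faceMeasure b₀ hd i
  have hwc : Continuous fun x => bubble L (b₀.coords x) :=
    (continuous_bubble L).comp (continuous_coords b₀)
  -- A polynomial is not determined by its restriction to the side, but one that is constant along
  -- the projection is. On this subspace the weighted surface norm is definite.
  let V : Submodule ℝ (E d → ℝ) := polyFun d k ⊓
    { carrier := {f | ∀ x, f (sideProj b₀ i j x) = f x}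
      add_mem' := fun hf hg x => by simp only [Pi.add_apply, hf x, hg x]
      zero_mem' := fun x => rfl
      smul_mem' := fun c f hf x => by simp only [Pi.smul_apply, hf x] }
  haveI : FiniteDimensional ℝ V := Submodule.finiteDimensional_of_le inf_le_left
  obtain ⟨C₀, hC₀, hsup⟩ := exists_sup_bound (V := V)
    (fun f hf => (contDiff_of_mem_polyFun hf.1).of_le (by norm_cast))
    (faceMeasure b₀ i) (isCompact_hull b₀)
    ((ae_faceMeasure b₀).mono fun x hx => hx.2) hwc (fun x => bubble_nonneg _ _)
    (by
      intro f hf h0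
      have hfc := (contDiff_of_mem_polyFun hf.1).continuous
      have hcont : Continuous fun x => bubble L (b₀.coords x) * f x ^ 2 := hwc.mul (hfc.pow 2)
      have hU : IsOpen {x | 0 < bubble L (b₀.coords (sideProj b₀ i j x))} :=
        isOpen_lt continuous_const (hwc.comp (continuous_sideProj b₀))
      refine eq_zero_of_eqOn_open hf.1 hU ?_ ?_
      · obtain ⟨x, hxi, hx1, hx⟩ := hL
        refine ⟨∑ j, x j • b₀ j, ?_⟩
        have hxc : b₀.coords (∑ j, x j • b₀ j) = x := by
          funext j
          rw [AffineBasis.coords_apply, LSimplex.coord_sum b₀ x hx1]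
          simp [b₀.coord_apply]
        have hxc' : b₀.coord i (∑ j, x j • b₀ j) = 0 := by
          rw [← hxi]
          exact congrFun hxc i
        change 0 < bubble L (b₀.coords (sideProj b₀ i j (∑ j, x j • b₀ j)))
        rw [sideProj_eq_self hxc', hxc]
        exact hx
      · intro x hx
        rw [← hf.2 x]
        have hxi : b₀.coord i (sideProj b₀ i j x) = 0 := coord_sideProj_self b₀ hji x
        set y := sideProj b₀ i j x
        by_contra hfy
        have hopen : IsOpen {x | 0 < bubble L (b₀.coords x) * f x ^ 2} :=
          isOpen_lt continuous_const hcont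
        have hy' : 0 < bubble L (b₀.coords y) * f y ^ 2 := mul_pos hx (by positivity)
        have h1 := planeMeasure_pos b₀ hd hopen hy' hxi
        have hae := (integral_eq_zero_iff_of_nonneg
          (fun x => mul_nonneg (bubble_nonneg _ _) (sq_nonneg _))
          (integrable_faceMeasure b₀ hd hcont)).1 h0
        have h2 : planeMeasure b₀ i {x | 0 < bubble L (b₀.coords x) * f x ^ 2} = 0 := by
          rw [faceMeasure, Filter.EventuallyEq,
            ae_restrict_iff' (isCompact_hull b₀).measurableSet] at hae
          refine measure_mono_null (t := {x | ¬ (b₀.coord i x = 0 ∧ (x ∈ hull b₀ →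
            bubble L (b₀.coords x) * f x ^ 2 = (0 : E d → ℝ) x))}) ?_
            ((ae_planeMeasure b₀).and hae)
          rintro z hz ⟨h3, h4⟩
          refine hz.ne' (h4 ((mem_hull b₀ z).2 fun l => ?_))
          by_cases hl : l = i
          · rw [hl, h3]
          · refine (hpos (b₀.coords z) h3 (fun h => ?_) l hl).le
            simp [h] at hz
        exact h1.ne' h2)
    (isCompact_hull b₀)
  obtain ⟨C₁, hC₁, hgrad⟩ := exists_gradient_bubble_mul_le b₀ L
  obtain ⟨Γ, hΓ, hscal⟩ := exists_scaling b₀ hd i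
  obtain ⟨ψ, hψ, hψc, hψ1, hψ0⟩ := exists_cutoff (isCompact_hull b₀)
  set m := volume.real (hull b₀) with hm
  have hm0 : 0 < m := measure_hull_pos b₀
  set s := ∫ x, ψ x ∂planeMeasure b₀ i with hs
  have hs0 : 0 ≤ s := integral_nonneg fun x => (hψ0 x).1
  have hψ1' : ContDiff ℝ 1 ψ := hψ.of_le (by norm_cast)
  refine ⟨s * C₀ + Γ * m * C₀ + Γ * m * C₁ * C₀, by positivity, fun b G hG f hf => ?_⟩
  haveI := isFiniteMeasure_faceMeasure b hd i
  obtain ⟨c, c', hc, hc', hcc, hinteg, hints⟩ := hscal b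
  have hvol : volume.real (hull b) = c * m := by
    have := hinteg fun _ => 1
    simpa using this
  set F : E d → ℝ := fun x => f (sideProj b i j (transport b₀ b x)) with hF
  have hFpoly : F ∈ polyFun d k := comp_mem_polyFun (comp_mem_polyFun hf (sideProj b i j)) _
  have hFV : F ∈ V := by
    refine ⟨hFpoly, fun x => ?_⟩
    simp only [hF, transport_sideProj]
    rw [sideProj_eq_self (coord_sideProj_self b hji _)]
  have hFc : ContDiff ℝ 1 F := (contDiff_of_mem_polyFun hFpoly).of_le (by norm_cast)
  have hb := hsup F hFV
  set Q := ∫ x, bubble L (b₀.coords x) * F x ^ 2 ∂faceMeasure b₀ i with hQ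
  have hQ0 : 0 ≤ Q := integral_nonneg fun x => mul_nonneg (bubble_nonneg _ _) (sq_nonneg _)
  have hQ1 : c' * Q = ∫ x, bubble L (b.coords x) * f x ^ 2 ∂faceMeasure b i := by
    obtain ⟨Cw, hCw⟩ := exists_lipschitzWith_bubble b₀ L
    have hsupp : HasCompactSupport fun x => F x ^ 2 * ψ x := hψc.mul_left
    obtain ⟨D, hD⟩ := exists_lipschitzWith_mul_contDiff (B := 1) hCw
      (fun x => by rw [abs_of_nonneg (bubble_nonneg _ _)]; exact bubble_le_one _ _)
      ((hFc.pow 2).mul hψ1') hsupp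
    have h1 := hints _ D hD hsupp.mul_left
    rw [integral_planeMeasure_eq hpos (fun x hx => (hψ1 x hx).self_of_nhds), ← hQ] at h1
    rw [← h1]
    have h2 : ∀ x ∈ hull b, ψ (transport b b₀ x) = 1 := fun x hx =>
      (hψ1 _ ((transport_mem_hull b b₀ x).2 hx)).self_of_nhds
    rw [← integral_planeMeasure_eq hpos h2]
    refine integral_congr_ae ?_
    filter_upwards [ae_planeMeasure b] with x hx
    rw [coords_transport, hF]
    simp only [transport_transport]
    rw [sideProj_eq_self hx]
  -- The indicator of the side is not Lipschitz, so its area is compared through the cutoff, which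
  -- is a majorant.
  have hσ : (faceMeasure b i).real Set.univ ≤ c' * s := by
    obtain ⟨Cψ, hCψ⟩ := hψ1'.lipschitzWith_of_hasCompactSupport hψc one_ne_zero
    rw [hs, ← hints ψ Cψ hCψ hψc]
    have h1 : (faceMeasure b i).real Set.univ =
        ∫ x, (hull b).indicator (fun _ => (1 : ℝ)) x ∂planeMeasure b i := by
      rw [integral_indicator (isCompact_hull b).measurableSet]
      simp [faceMeasure]
    rw [h1]
    have hcs : HasCompactSupport (ψ ∘ transport b b₀) := by
      refine hψc.comp_isClosedEmbedding ?_
      exact (Homeomorph.mk ⟨transport b b₀, transport b₀ b, transport_transport b b₀,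
        transport_transport b₀ b⟩ (continuous_transport b b₀)
        (continuous_transport b₀ b)).isClosedEmbedding
    refine integral_mono_of_nonneg (Filter.Eventually.of_forall fun x =>
      Set.indicator_nonneg (fun _ _ => zero_le_one) x) ?_ (Filter.Eventually.of_forall fun x => ?_)
    · have hc1 : Continuous (ψ ∘ transport b b₀) := hψ.continuous.comp (continuous_transport b b₀)
      refine (integrableOn_iff_integrable_of_support_subset
        (subset_tsupport (ψ ∘ transport b b₀))).1 ?_
      exact hc1.continuousOn.integrableOn_of_subset_isCompact hcs
        hcs.isCompact.measurableSet subset_rfl (planeMeasure_lt_top b hd hcs).ne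
    · by_cases hx : x ∈ hull b
      · simp only [Set.indicator_of_mem hx]
        exact (hψ1 _ ((transport_mem_hull b b₀ x).2 hx)).self_of_nhds.ge
      · simp only [Set.indicator_of_notMem hx]
        exact (hψ0 _).1
  have hfcont := (contDiff_of_mem_polyFun hf).continuous
  have hwb : Continuous fun x => bubble L (b.coords x) :=
    (continuous_bubble L).comp (continuous_coords b)
  have hI : c' * Q ≤ ∫ x, f x ^ 2 ∂faceMeasure b i := by
    rw [hQ1]
    refine integral_mono (integrable_faceMeasure b hd (hwb.mul (hfcont.pow 2)))
      (integrable_faceMeasure b hd (hfcont.pow 2)) fun x => ?_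
    exact mul_le_of_le_one_left (sq_nonneg _) (bubble_le_one _ _)
  have hdiam : 0 ≤ Metric.diam (hull b) := Metric.diam_nonneg
  set I := ∫ x, f x ^ 2 ∂faceMeasure b i with hIdef
  have hI0 : 0 ≤ I := integral_nonneg fun x => sq_nonneg _
  have hFx : ∀ x, F (transport b b₀ x) = f (sideProj b i j x) := fun x => by
    simp only [hF, transport_transport]
  refine ⟨?_, ?_, ?_⟩
  · have h1 : I ≤ (faceMeasure b i).real Set.univ * (C₀ * Q) := by
      rw [hIdef, ← setIntegral_univ]
      refine setIntegral_le_of_sq_le MeasurableSet.univ (measure_ne_top _ _) ?_ fun x => sq_nonneg _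
      filter_upwards [ae_faceMeasure b] with x hx _
      have h2 := (hb (transport b b₀ x) ((transport_mem_hull b b₀ x).2 hx.2)).1
      rwa [hFx, sideProj_eq_self hx.1] at h2
    rw [← hQ1]
    calc I ≤ c' * s * (C₀ * Q) := h1.trans (by gcongr)
      _ = s * C₀ * (c' * Q) := by ring
      _ ≤ _ := by
        gcongr
        nlinarith [mul_nonneg (mul_nonneg hΓ.le hm0.le) hC₀,
          mul_nonneg (mul_nonneg (mul_nonneg hΓ.le hm0.le) hC₁) hC₀]
  · have h1 : ∫ x in hull b, f (sideProj b i j x) ^ 2 ≤ volume.real (hull b) * (C₀ * Q) := by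
      refine setIntegral_le_of_sq_le (isCompact_hull b).measurableSet
        (isCompact_hull b).measure_lt_top.ne (Filter.Eventually.of_forall fun x hx => ?_)
        fun x => sq_nonneg _
      have h2 := (hb (transport b b₀ x) ((transport_mem_hull b b₀ x).2 hx)).1
      rwa [hFx] at h2
    rw [hvol] at h1
    calc _ ≤ c * m * (C₀ * Q) := h1
      _ ≤ Γ * Metric.diam (hull b) * c' * m * (C₀ * Q) := by gcongr
      _ = Γ * m * C₀ * Metric.diam (hull b) * (c' * Q) := by ring
      _ ≤ Γ * m * C₀ * Metric.diam (hull b) * I := by gcongr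
      _ ≤ _ := by
        gcongr
        nlinarith [mul_nonneg hs0 hC₀,
          mul_nonneg (mul_nonneg (mul_nonneg hΓ.le hm0.le) hC₁) hC₀]
  · have h1 : ∫ x in hull b,
        ‖gradient (fun y => bubble L (b.coords y) * f (sideProj b i j y)) x‖ ^ 2 ≤
        volume.real (hull b) * (C₁ * G ^ 2 * (C₀ * Q)) := by
      refine setIntegral_le_of_sq_le (isCompact_hull b).measurableSet
        (isCompact_hull b).measure_lt_top.ne ?_ fun x => sq_nonneg _
      have := hgrad b G hG F (C₀ * Q) hFc hb
      simpa only [hFx] using this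
    rw [hvol] at h1
    calc _ ≤ c * m * (C₁ * G ^ 2 * (C₀ * Q)) := h1
      _ ≤ Γ * Metric.diam (hull b) * c' * m * (C₁ * G ^ 2 * (C₀ * Q)) := by gcongr
      _ = Γ * m * C₁ * C₀ * G ^ 2 * Metric.diam (hull b) * (c' * Q) := by ring
      _ ≤ Γ * m * C₁ * C₀ * G ^ 2 * Metric.diam (hull b) * I := by gcongr
      _ ≤ _ := by
        gcongr
        nlinarith [mul_nonneg hs0 hC₀, mul_nonneg (mul_nonneg hΓ.le hm0.le) hC₀]

end

section

/-! ### Uniform estimates for the bubbles -/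

/-- The element and side bubble estimates for one simplex. -/
def BubbleEstimates (k : ℕ) (C : ℝ) (t : Fin 3) (b : AffineBasis (Fin (d + 1)) ℝ (E d)) : Prop :=
  ∀ G, CoordLip b G → ∀ f ∈ polyFun d k,
    (∫ x in hull b, f x ^ 2 ≤ C * ∫ x in hull b, bubble (elemForms d t) (b.coords x) * f x ^ 2 ∧
      ∫ x in hull b, ‖gradient (fun y => bubble (elemForms d t) (b.coords y) * f y) x‖ ^ 2 ≤
        C * G ^ 2 * ∫ x in hull b, f x ^ 2) ∧
    ∀ i j, j ≠ i →
      ∫ x, f x ^ 2 ∂faceMeasure b i ≤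
        C * ∫ x, bubble (sideForms d t i) (b.coords x) * f x ^ 2 ∂faceMeasure b i ∧
      ∫ x in hull b, f (sideProj b i j x) ^ 2 ≤
        C * Metric.diam (hull b) * ∫ x, f x ^ 2 ∂faceMeasure b i ∧
      ∫ x in hull b,
          ‖gradient (fun y => bubble (sideForms d t i) (b.coords y) * f (sideProj b i j y)) x‖ ^ 2 ≤
        C * G ^ 2 * Metric.diam (hull b) * ∫ x, f x ^ 2 ∂faceMeasure b i

theorem exists_bubbleEstimates (hd : d = 2 ∨ d = 3) (k : ℕ) : ∃ C : ℝ, 0 ≤ C ∧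
    ∀ (t : Fin 3) (b : AffineBasis (Fin (d + 1)) ℝ (E d)), BubbleEstimates k C t b := by
  -- Any affine basis may serve as the reference simplex; without one the claim would be empty.
  by_cases hne : Nonempty (AffineBasis (Fin (d + 1)) ℝ (E d))
  swap
  · exact ⟨0, le_rfl, fun t b => absurd ⟨b⟩ hne⟩
  obtain ⟨b₀⟩ := hne
  have hd0 : 0 < d := by omega
  choose Ce hCe he using fun t : Fin 3 => exists_elem_estimate b₀ (elemForms d t)
    (exists_elemBubble_pos hd t) (elemBubble_pos hd t) k
  have hs : ∀ (t : Fin 3) (i j : Fin (d + 1)), ∃ C : ℝ, 0 ≤ C ∧ (j ≠ i →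
      ∀ (b : AffineBasis (Fin (d + 1)) ℝ (E d)) (G : ℝ), CoordLip b G → ∀ f ∈ polyFun d k,
      ∫ x, f x ^ 2 ∂faceMeasure b i ≤
        C * ∫ x, bubble (sideForms d t i) (b.coords x) * f x ^ 2 ∂faceMeasure b i ∧
      ∫ x in hull b, f (sideProj b i j x) ^ 2 ≤
        C * Metric.diam (hull b) * ∫ x, f x ^ 2 ∂faceMeasure b i ∧
      ∫ x in hull b,
          ‖gradient (fun y => bubble (sideForms d t i) (b.coords y) * f (sideProj b i j y)) x‖ ^ 2 ≤
        C * G ^ 2 * Metric.diam (hull b) * ∫ x, f x ^ 2 ∂faceMeasure b i) := by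
    intro t i j
    by_cases hji : j ≠ i
    · obtain ⟨C, hC, h⟩ := exists_side_estimate b₀ hd0 hji (sideForms d t i)
        (exists_sideBubble_pos hd t i) (fun x hx h => sideBubble_pos hd t i x hx.ge h) k
      exact ⟨C, hC, fun _ => h⟩
    · exact ⟨0, le_rfl, fun h => absurd h hji⟩
  choose Cs hCs hs using hs
  refine ⟨∑ t, Ce t + ∑ t, ∑ i, ∑ j, Cs t i j,
    add_nonneg (Finset.sum_nonneg fun t _ => hCe t) (Finset.sum_nonneg fun t _ =>
      Finset.sum_nonneg fun i _ => Finset.sum_nonneg fun j _ => hCs t i j),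
    fun t b G hG f hf => ?_⟩
  have h1 : ∀ t, Ce t ≤ ∑ t, Ce t := fun t =>
    Finset.single_le_sum (fun t _ => hCe t) (Finset.mem_univ t)
  have h2 : ∀ t i j, Cs t i j ≤ ∑ t, ∑ i, ∑ j, Cs t i j := fun t i j =>
    calc Cs t i j ≤ ∑ j, Cs t i j :=
          Finset.single_le_sum (f := fun j => Cs t i j) (fun j _ => hCs t i j) (Finset.mem_univ j)
      _ ≤ ∑ i, ∑ j, Cs t i j :=
          Finset.single_le_sum (f := fun i => ∑ j, Cs t i j)
            (fun i _ => Finset.sum_nonneg fun j _ => hCs t i j) (Finset.mem_univ i)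
      _ ≤ _ := Finset.single_le_sum (f := fun t => ∑ i, ∑ j, Cs t i j)
          (fun t _ => Finset.sum_nonneg fun i _ => Finset.sum_nonneg fun j _ => hCs t i j)
          (Finset.mem_univ t)
  have h3 : 0 ≤ ∑ t, Ce t := Finset.sum_nonneg fun t _ => hCe t
  have h4 : 0 ≤ ∑ t, ∑ i, ∑ j, Cs t i j := Finset.sum_nonneg fun t _ =>
      Finset.sum_nonneg fun i _ => Finset.sum_nonneg fun j _ => hCs t i j
  have h5 : 0 ≤ Metric.diam (hull b) := Metric.diam_nonneg
  constructor
  · obtain ⟨e1, e2⟩ := he t b G hG f hf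
    have h6 : Ce t ≤ ∑ t, Ce t + ∑ t, ∑ i, ∑ j, Cs t i j := by linarith [h1 t]
    refine ⟨e1.trans ?_, e2.trans ?_⟩
    · exact mul_le_mul_of_nonneg_right h6
        (integral_nonneg fun x => mul_nonneg (bubble_nonneg _ _) (sq_nonneg _))
    · have : 0 ≤ ∫ x in hull b, f x ^ 2 := integral_nonneg fun x => sq_nonneg _
      gcongr
  · intro i j hji
    obtain ⟨e1, e2, e3⟩ := hs t i j hji b G hG f hf
    have h6 : Cs t i j ≤ ∑ t, Ce t + ∑ t, ∑ i, ∑ j, Cs t i j := by linarith [h2 t i j]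
    have : 0 ≤ ∫ x, f x ^ 2 ∂faceMeasure b i := integral_nonneg fun x => sq_nonneg _
    refine ⟨e1.trans ?_, e2.trans ?_, e3.trans ?_⟩
    · exact mul_le_mul_of_nonneg_right h6
        (integral_nonneg fun x => mul_nonneg (bubble_nonneg _ _) (sq_nonneg _))
    · gcongr
    · gcongr

/-! ### Shape regularity -/

namespace LSimplex

variable {K T : LSimplex d}

theorem coord_mem_Icc (hK : AffineIndependent ℝ K.vert) {x : E d} (hx : x ∈ K.carrier)
    (j : Fin (d + 1)) : 0 ≤ (K.basis hK).coord j x ∧ (K.basis hK).coord j x ≤ 1 := by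
  rw [carrier_eq hK] at hx
  refine ⟨hx j, ?_⟩
  rw [← (K.basis hK).sum_coord_apply_eq_one x]
  exact Finset.single_le_sum (f := fun j => (K.basis hK).coord j x) (fun k _ => hx k)
    (Finset.mem_univ j)

/-- A barycentric coordinate has values in `[0, 1]` on the ball, so it changes by at most `1` along
a diameter, which has length `2 * r`. In the supremum over such balls its gradient is bounded by `1
/ (2 * K.rho)`. -/
theorem abs_linear_coord_le (hK : AffineIndependent ℝ K.vert) {x : E d} {r : ℝ} (hr : 0 ≤ r)
    (hx : Metric.closedBall x r ⊆ K.carrier) (j : Fin (d + 1)) (v : E d) :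
    2 * r * |((K.basis hK).coord j).linear v| ≤ ‖v‖ := by
  by_cases hv : v = 0
  · simp [hv]
  have hv0 : 0 < ‖v‖ := norm_pos_iff.2 hv
  set φ := (K.basis hK).coord j
  have hmem : ∀ s : ℝ, |s| ≤ r / ‖v‖ → s • v + x ∈ K.carrier := by
    intro s hs
    apply hx
    rw [Metric.mem_closedBall, dist_eq_norm, add_sub_cancel_right, norm_smul, Real.norm_eq_abs]
    rwa [le_div_iff₀ hv0] at hs
  have hval : ∀ s : ℝ, φ (s • v + x) = s * φ.linear v + φ x := fun s => by
    have := φ.map_vadd x (s • v)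
    rw [map_smul] at this
    exact this
  have hr0 : 0 ≤ r / ‖v‖ := by positivity
  have h1 := coord_mem_Icc hK (hmem (r / ‖v‖) (abs_of_nonneg hr0).le) j
  have h2 := coord_mem_Icc hK (hmem (-(r / ‖v‖)) (by rw [abs_neg, abs_of_nonneg hr0])) j
  change 0 ≤ φ _ ∧ φ _ ≤ 1 at h1 h2
  rw [hval] at h1 h2
  have h3 : |2 * (r / ‖v‖) * φ.linear v| ≤ 1 := by
    rw [abs_le]
    constructor <;> linarith
  rw [abs_mul, abs_of_nonneg (by positivity : 0 ≤ 2 * (r / ‖v‖))] at h3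
  have h4 : 2 * r * |φ.linear v| = 2 * (r / ‖v‖) * |φ.linear v| * ‖v‖ := by
    field_simp
  rw [h4]
  exact mul_le_of_le_one_left hv0.le h3

theorem rho_set_nonempty (hK : AffineIndependent ℝ K.vert) :
    ∃ r, 0 < r ∧ ∃ x, Metric.closedBall x r ⊆ K.carrier := by
  obtain ⟨x, hx⟩ := nonempty_interior hK
  obtain ⟨r, hr, h⟩ := Metric.nhds_basis_closedBall.mem_iff.1 (mem_interior_iff_mem_nhds.1 hx)
  exact ⟨r, hr, x, h⟩

theorem linear_coord_sub (hK : AffineIndependent ℝ K.vert) {i j : Fin (d + 1)} (hij : i ≠ j) :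
    ((K.basis hK).coord i).linear (K.vert i - K.vert j) = 1 := by
  have h1 := ((K.basis hK).coord i).linearMap_vsub ((K.basis hK) i) ((K.basis hK) j)
  rw [(K.basis hK).coord_apply_eq, (K.basis hK).coord_apply_ne hij] at h1
  simpa using h1

theorem bddAbove_rho (hd : 0 < d) (hK : AffineIndependent ℝ K.vert) :
    BddAbove {r | 0 ≤ r ∧ ∃ x, Metric.closedBall x r ⊆ K.carrier} := by
  haveI : Nontrivial (Fin (d + 1)) := Fin.nontrivial_iff_two_le.2 (by omega)
  obtain ⟨i, j, hij⟩ := exists_pair_ne (Fin (d + 1))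
  refine ⟨‖K.vert i - K.vert j‖, ?_⟩
  rintro r ⟨hr, x, hx⟩
  have := abs_linear_coord_le hK hr hx i (K.vert i - K.vert j)
  rw [linear_coord_sub hK hij, abs_one] at this
  linarith

theorem rho_pos (hd : 0 < d) (hK : AffineIndependent ℝ K.vert) : 0 < K.rho := by
  obtain ⟨r, hr, x, hx⟩ := rho_set_nonempty hK
  exact hr.trans_le (le_csSup (bddAbove_rho hd hK) ⟨hr.le, x, hx⟩)

theorem rho_mul_le (hd : 0 < d) (hK : AffineIndependent ℝ K.vert) (j : Fin (d + 1)) (v : E d) :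
    2 * K.rho * |((K.basis hK).coord j).linear v| ≤ ‖v‖ := by
  rcases (abs_nonneg (((K.basis hK).coord j).linear v)).eq_or_lt with h0 | h0
  · rw [← h0]
    simp
  · have h1 : K.rho ≤ ‖v‖ / (2 * |((K.basis hK).coord j).linear v|) := by
      obtain ⟨r, hr, x, hx⟩ := rho_set_nonempty hK
      refine csSup_le ⟨r, hr.le, x, hx⟩ ?_
      rintro r ⟨hr, x, hx⟩
      rw [le_div_iff₀ (by positivity)]
      linarith [abs_linear_coord_le hK hr hx j v]
    rw [le_div_iff₀ (by positivity)] at h1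
    linarith

theorem coordLip_rho (hd : 0 < d) (hK : AffineIndependent ℝ K.vert) :
    CoordLip (K.basis hK) (1 / (2 * K.rho)) := by
  have hρ := rho_pos hd hK
  refine ⟨by positivity, fun j x y => ?_⟩
  have h1 : (K.basis hK).coord j x - (K.basis hK).coord j y =
      ((K.basis hK).coord j).linear (x - y) := (((K.basis hK).coord j).linearMap_vsub x y).symm
  rw [h1, div_mul_eq_mul_div, one_mul, le_div_iff₀ (by positivity)]
  linarith [rho_mul_le hd hK j (x - y)]

theorem two_mul_rho_le (hd : 0 < d) (hK : AffineIndependent ℝ K.vert) {i j : Fin (d + 1)}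
    (hij : i ≠ j) : 2 * K.rho ≤ dist (K.vert i) (K.vert j) := by
  have := rho_mul_le hd hK i (K.vert i - K.vert j)
  rwa [linear_coord_sub hK hij, abs_one, mul_one, ← dist_eq_norm] at this

theorem dist_vert_le (K : LSimplex d) (i j : Fin (d + 1)) :
    dist (K.vert i) (K.vert j) ≤ Metric.diam K.carrier :=
  Metric.dist_le_diam_of_mem (isCompact_carrier K).isBounded (vert_mem_carrier K i)
    (vert_mem_carrier K j)

theorem h_nonneg (K : LSimplex d) : 0 ≤ K.h := by
  unfold h
  positivity

/-- The simplex lies in the ball of radius `diam` around a vertex and contains balls with radii up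
to the inradius. The constant is the `d`-th root of the volume of the unit ball. -/
theorem exists_h_bounds (hd : 0 < d) : ∃ ν : ℝ, 0 < ν ∧ ∀ K : LSimplex d,
    AffineIndependent ℝ K.vert → K.h ≤ ν * Metric.diam K.carrier ∧ ν * K.rho ≤ K.h := by
  set V := volume.real (Metric.ball (0 : E d) 1) with hV
  have hV0 : 0 < V :=
    ENNReal.toReal_pos (Metric.measure_ball_pos volume _ one_pos).ne' measure_ball_lt_top.ne
  have hball : ∀ (x : E d) (r : ℝ), 0 ≤ r →
      volume.real (Metric.closedBall x r) ^ (1 / (d : ℝ)) = V ^ (1 / (d : ℝ)) * r := by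
    intro x r hr
    have h1 : volume.real (Metric.closedBall x r) = r ^ d * V := by
      rw [Measure.addHaar_real_closedBall _ _ hr, finrank_euclideanSpace_fin]
    rw [h1, Real.mul_rpow (by positivity) hV0.le, mul_comm]
    congr 1
    rw [one_div, Real.pow_rpow_inv_natCast hr (by omega)]
  refine ⟨V ^ (1 / (d : ℝ)), by positivity, fun K hK => ⟨?_, ?_⟩⟩
  · rw [← hball (K.vert 0) _ Metric.diam_nonneg, h]
    refine Real.rpow_le_rpow (by positivity) ?_ (by positivity)
    refine measureReal_mono ?_ measure_closedBall_lt_top.ne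
    intro x hx
    exact Metric.dist_le_diam_of_mem (isCompact_carrier K).isBounded hx (vert_mem_carrier K 0)
  · have hν : 0 < V ^ (1 / (d : ℝ)) := by positivity
    rw [mul_comm, ← le_div_iff₀ hν]
    obtain ⟨r, hr, x, hx⟩ := rho_set_nonempty hK
    refine csSup_le ⟨r, hr.le, x, hx⟩ ?_
    rintro r ⟨hr, x, hx⟩
    rw [le_div_iff₀ hν, mul_comm, ← hball x r hr, h]
    refine Real.rpow_le_rpow (by positivity) ?_ (by positivity)
    exact measureReal_mono hx (isCompact_carrier K).measure_lt_top.ne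

/-- A common edge makes the sizes comparable: its length is at least twice the inradius and at most
the diameter of either simplex, and each diameter is at most `κ` times the inradius. This is why
only elements sharing an edge with `T` are scaled by `T.h`. -/
theorem exists_shape_constant (hd : 0 < d) (κ : ℝ) : ∃ C : ℝ, 0 ≤ C ∧ ∀ K T : LSimplex d,
    AffineIndependent ℝ K.vert → AffineIndependent ℝ T.vert →
    Metric.diam K.carrier ≤ κ * K.rho → Metric.diam T.carrier ≤ κ * T.rho →
    (∃ i j i' j', i ≠ j ∧ i' ≠ j' ∧ K.vert i = T.vert i' ∧ K.vert j = T.vert j') →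
    T.h * (1 / (2 * K.rho)) ≤ C ∧ Metric.diam K.carrier ≤ C * T.h := by
  obtain ⟨ν, hν, h⟩ := exists_h_bounds (d := d) hd
  refine ⟨ν * κ ^ 2 + κ ^ 2 / ν, by positivity, ?_⟩
  rintro K T hK hT hdK hdT ⟨i, j, i', j', hij, hij', hi, hj⟩
  have hρK := rho_pos hd hK
  have hρT := rho_pos hd hT
  have e1 := two_mul_rho_le hd hK hij
  have e2 := two_mul_rho_le hd hT hij'
  have e3 := dist_vert_le K i j
  have e4 := dist_vert_le T i' j'
  rw [← hi, ← hj] at e2 e4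
  set e := dist (K.vert i) (K.vert j)
  have hκ : 0 ≤ κ := by
    by_contra hκ
    nlinarith [Metric.diam_nonneg (s := K.carrier)]
  obtain ⟨f1, -⟩ := h T hT
  obtain ⟨-, f2⟩ := h T hT
  have g1 : Metric.diam T.carrier ≤ κ * (κ * K.rho) :=
    hdT.trans (mul_le_mul_of_nonneg_left (by linarith) hκ)
  have g2 : Metric.diam K.carrier ≤ κ * (κ * T.rho) :=
    hdK.trans (mul_le_mul_of_nonneg_left (by linarith) hκ)
  constructor
  · rw [mul_one_div, div_le_iff₀ (by positivity)]
    have : T.h ≤ ν * (κ * (κ * K.rho)) := f1.trans (mul_le_mul_of_nonneg_left g1 hν.le)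
    have h3 : 0 ≤ κ ^ 2 / ν := by positivity
    have h4 : 0 ≤ ν * κ ^ 2 * K.rho := by positivity
    nlinarith [mul_nonneg h3 hρK.le]
  · have h5 : T.rho ≤ T.h / ν := by
      rw [le_div_iff₀ hν]
      linarith
    calc _ ≤ κ * (κ * T.rho) := g2
      _ ≤ κ * (κ * (T.h / ν)) := by gcongr
      _ = κ ^ 2 / ν * T.h := by ring
      _ ≤ _ := by
        have := h_nonneg T
        gcongr
        have : 0 ≤ ν * κ ^ 2 := by positivity
        linarith

/-! ### Sides and normals -/

theorem hull_basis (hK : AffineIndependent ℝ K.vert) : hull (K.basis hK) = K.carrier := rfl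

theorem side_eq (hK : AffineIndependent ℝ K.vert) (i : Fin (d + 1)) :
    K.side i = {x | (K.basis hK).coord i x = 0} ∩ K.carrier := by
  apply subset_antisymm
  · refine Set.subset_inter (convexHull_min ?_ ?_) (convexHull_mono (Set.image_subset_range _ _))
    · rintro _ ⟨j, hj, rfl⟩
      exact (K.basis hK).coord_apply_ne (Ne.symm hj)
    · intro x hx y hy s t hs ht hst
      change (K.basis hK).coord i (s • x + t • y) = 0
      have := Convex.combo_affine_apply (f := (K.basis hK).coord i) hst (x := x) (y := y)
      rw [this, hx, hy]
      simp
  · rintro x ⟨hx0, hx⟩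
    rw [carrier_eq hK] at hx
    rw [← (K.basis hK).linear_combination_coord_eq_self x,
      ← Finset.sum_erase_add _ _ (Finset.mem_univ i), hx0, zero_smul, add_zero]
    refine (convex_convexHull ℝ _).sum_mem (fun j _ => hx j) ?_ fun j hj => ?_
    · rw [← (K.basis hK).sum_coord_apply_eq_one x, ← Finset.sum_erase_add _ _ (Finset.mem_univ i),
        hx0, add_zero]
    · exact subset_convexHull ℝ _ ⟨j, Finset.ne_of_mem_erase hj, rfl⟩

theorem sideMeasure_eq (hK : AffineIndependent ℝ K.vert) (i : Fin (d + 1)) :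
    sideMeasure K i = faceMeasure (K.basis hK) i := by
  rw [sideMeasure, side_eq hK, faceMeasure, planeMeasure, Measure.restrict_restrict
    (isCompact_hull _).measurableSet, Set.inter_comm, hull_basis]

theorem isOuterNormal_normal (hd : 0 < d) (hK : AffineIndependent ℝ K.vert) (i : Fin (d + 1)) :
    IsOuterNormal (K.basis hK) i (K.normal i) :=
  Classical.epsilon_spec (exists_isOuterNormal (K.basis hK) hd i)

end LSimplex

theorem diam_le_of_regularity {M : Finset (LSimplex d)} {κ : ℝ} (hκ : regularity M ≤ κ)
    {K : LSimplex d} (hK : K ∈ M) (hρ : 0 < K.rho) : Metric.diam K.carrier ≤ κ * K.rho := by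
  rw [← div_le_iff₀ hρ]
  refine le_trans ?_ hκ
  exact le_ciSup (f := fun K : {K // K ∈ M} => Metric.diam K.1.carrier / K.1.rho)
    (Set.finite_range _).bddAbove ⟨K, hK⟩

end

section

/-! ### The `L²` norm -/

variable {F F' : Type*} [NormedAddCommGroup F] [NormedAddCommGroup F'] {ν : Measure (E d)}

theorem l2norm_nonneg (f : E d → F) : 0 ≤ l2norm ν f := ENNReal.toReal_nonneg

theorem l2norm_sq {f : E d → F} (hf : MemLp f 2 ν) : l2norm ν f ^ 2 = ∫ x, ‖f x‖ ^ 2 ∂ν := by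
  have h0 : 0 ≤ ∫ x, ‖f x‖ ^ 2 ∂ν := integral_nonneg fun x => sq_nonneg _
  have h1 := hf.eLpNorm_eq_integral_rpow_norm two_ne_zero ENNReal.ofNat_ne_top
  simp only [ENNReal.toReal_ofNat, Real.rpow_ofNat] at h1
  rw [l2norm, h1, ENNReal.toReal_ofReal (by positivity), ← Real.rpow_natCast, ← Real.rpow_mul h0]
  norm_num

theorem l2norm_add_le {f g : E d → F} (hf : MemLp f 2 ν) (hg : MemLp g 2 ν) :
    l2norm ν (f + g) ≤ l2norm ν f + l2norm ν g := by
  rw [l2norm, l2norm, l2norm, ← ENNReal.toReal_add hf.2.ne hg.2.ne]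
  exact ENNReal.toReal_mono (ENNReal.add_ne_top.2 ⟨hf.2.ne, hg.2.ne⟩)
    (eLpNorm_add_le hf.1 hg.1 (by norm_num))

theorem l2norm_le_add_sub {f g : E d → F} (hf : MemLp f 2 ν) (hg : MemLp g 2 ν) :
    l2norm ν f ≤ l2norm ν g + l2norm ν (f - g) := by
  have := l2norm_add_le hg (hf.sub hg)
  rwa [add_sub_cancel] at this

theorem l2norm_mono_measure {ν' : Measure (E d)} (h : ν ≤ ν') {f : E d → F} (hf : MemLp f 2 ν') :
    l2norm ν f ≤ l2norm ν' f :=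
  ENNReal.toReal_mono hf.2.ne (eLpNorm_mono_measure f h)

theorem rpow_integral_norm {f : E d → F} (hf : MemLp f 2 ν) :
    (∫ x, ‖f x‖ ^ (2 : ℝ) ∂ν) ^ (1 / (2 : ℝ)) = l2norm ν f := by
  simp only [Real.rpow_ofNat]
  rw [← l2norm_sq hf, ← Real.sqrt_eq_rpow, Real.sqrt_sq (l2norm_nonneg f)]

theorem abs_integral_le_l2norm {f : E d → F} {g : E d → F'} (hf : MemLp f 2 ν) (hg : MemLp g 2 ν)
    {H : E d → ℝ} {c : ℝ} (hc : 0 ≤ c) (hH : ∀ᵐ x ∂ν, |H x| ≤ c * (‖f x‖ * ‖g x‖)) :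
    |∫ x, H x ∂ν| ≤ c * (l2norm ν f * l2norm ν g) := by
  have h1 := integral_mul_norm_le_Lp_mul_Lq (f := fun x => ‖f x‖) (g := fun x => ‖g x‖) (μ := ν)
    (Real.HolderConjugate.two_two) (by simpa using hf.norm) (by simpa using hg.norm)
  simp only [norm_norm] at h1
  have hinteg : Integrable (fun x => ‖f x‖ * ‖g x‖) ν := hf.norm.integrable_mul hg.norm
  rw [rpow_integral_norm hf, rpow_integral_norm hg] at h1
  calc |∫ x, H x ∂ν| ≤ ∫ x, |H x| ∂ν := abs_integral_le_integral_abs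
    _ ≤ ∫ x, c * (‖f x‖ * ‖g x‖) ∂ν :=
      integral_mono_of_nonneg (Filter.Eventually.of_forall fun x => abs_nonneg _)
        (hinteg.const_mul c) hH
    _ = c * ∫ x, ‖f x‖ * ‖g x‖ ∂ν := integral_const_mul _ _
    _ ≤ _ := by gcongr

/-! ### The projection onto polynomials -/

theorem memLp_of_continuous [IsFiniteMeasure ν] {S : Set (E d)} (hS : IsCompact S)
    (hν : ∀ᵐ x ∂ν, x ∈ S) {f : E d → ℝ} (hf : Continuous f) : MemLp f 2 ν := by
  obtain ⟨B, hB⟩ := hS.exists_bound_of_continuousOn hf.continuousOn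
  exact MemLp.of_bound hf.aestronglyMeasurable B (hν.mono hB)

/-- The orthogonal projection onto the finite-dimensional image of the polynomials in `L²`.
Existence ensures that the choice made in `l2proj` has its defining properties. -/
theorem exists_l2proj [IsFiniteMeasure ν] {S : Set (E d)} (hS : IsCompact S)
    (hν : ∀ᵐ x ∂ν, x ∈ S) (k : ℕ) {f : E d → ℝ} (hf : MemLp f 2 ν) :
    ∃ q : MvPolynomial (Fin d) ℝ, q.totalDegree ≤ k ∧
    ∀ p : MvPolynomial (Fin d) ℝ, p.totalDegree ≤ k → ∫ x, (f x - pval q x) * pval p x ∂ν = 0 := by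
  have hm : ∀ g ∈ polyFun d k, MemLp g 2 ν := fun g hg =>
    memLp_of_continuous hS hν (contDiff_of_mem_polyFun hg).continuous
  let T : polyFun d k →ₗ[ℝ] Lp ℝ 2 ν :=
    { toFun := fun g => (hm g g.2).toLp g
      map_add' := fun g g' => MemLp.toLp_add _ _
      map_smul' := fun c g => MemLp.toLp_const_smul c (hm g g.2) }
  let R := LinearMap.range T
  haveI : FiniteDimensional ℝ R := LinearMap.finiteDimensional_range T
  let v := hf.toLp f
  obtain ⟨⟨g, hg⟩, hgv⟩ : R.starProjection v ∈ R := Submodule.starProjection_apply_mem _ _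
  obtain ⟨q, hq, rfl⟩ := mem_polyFun.1 hg
  refine ⟨q, hq, fun p hp => ?_⟩
  have h1 : v - R.starProjection v ∈ Rᗮ := Submodule.sub_starProjection_mem_orthogonal v
  have hp' : pval p ∈ polyFun d k := pval_mem_polyFun hp
  have h2 := (Submodule.mem_orthogonal _ _).1 h1 (T ⟨pval p, hp'⟩) ⟨_, rfl⟩
  rw [← hgv, MeasureTheory.L2.inner_def] at h2
  rw [← h2]
  refine integral_congr_ae ?_
  filter_upwards [Lp.coeFn_sub v (T ⟨pval q, hg⟩), hf.coeFn_toLp, (hm _ hg).coeFn_toLp,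
    (hm _ hp').coeFn_toLp] with x h3 h4 h5 h6
  have h7 : T ⟨pval q, hg⟩ = (hm _ hg).toLp (pval q) := rfl
  have h8 : T ⟨pval p, hp'⟩ = (hm _ hp').toLp (pval p) := rfl
  rw [h3, h8, h6, h7, Pi.sub_apply, h5, h4]
  simp

theorem l2proj_mem_polyFun [IsFiniteMeasure ν] {S : Set (E d)} (hS : IsCompact S)
    (hν : ∀ᵐ x ∂ν, x ∈ S) (k : ℕ) {f : E d → ℝ} (hf : MemLp f 2 ν) :
    l2proj ν k f ∈ polyFun d k :=
  pval_mem_polyFun (Classical.epsilon_spec (exists_l2proj hS hν k hf)).1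

end

section

/-! ### The coefficients on an element -/

/-- The product of two Lipschitz functions, one of which has compact support. -/
theorem exists_lipschitzWith_mul_of_hasCompactSupport {f g : E d → ℝ} {C C' : ℝ≥0}
    (hf : LipschitzWith C f) (hg : LipschitzWith C' g) (hgc : HasCompactSupport g) :
    ∃ D : ℝ≥0, LipschitzWith D fun x => f x * g x := by
  obtain ⟨B, hB⟩ := hgc.isCompact.exists_bound_of_continuousOn hf.continuous.continuousOn
  obtain ⟨B', hB'⟩ := hg.continuous.bounded_above_of_compact_support hgc
  have h1 : LipschitzWith C fun x => max (-|B|) (min |B| (f x)) := (hf.const_min _).const_max _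
  obtain ⟨D, hD⟩ := exists_lipschitzWith_mul (B := |B|) h1 hg (fun x => by
    rw [abs_le]
    refine ⟨le_max_left _ _, max_le ?_ (min_le_left _ _)⟩
    linarith [abs_nonneg B]) hB'
  refine ⟨D, ?_⟩
  convert! hD using 2 with x
  by_cases hx : x ∈ tsupport g
  · have h2 : |f x| ≤ |B| := (hB x hx).trans (le_abs_self B)
    rw [min_eq_right ((le_abs_self _).trans h2), max_eq_right (abs_le.1 h2).1]
  · rw [image_eq_zero_of_notMem_tsupport hx, mul_zero, mul_zero]

/-- The Cauchy–Schwarz inequality for the nonnegative form of `A x`, read off from the discriminant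
of `t ↦ A(ξ + tη)·(ξ + tη)`. -/
theorem abs_mulVec_dotProduct_le {Ω : Set (E d)} {A : E d → Matrix (Fin d) (Fin d) ℝ} {a₁ a₂ : ℝ}
    (ha₁ : 0 < a₁) (hA : IsUniformlyElliptic Ω A a₁ a₂) {x : E d} (hx : x ∈ Ω) (ξ η : E d) :
    |(A x).mulVec ξ.ofLp ⬝ᵥ η.ofLp| ≤ |a₂| * (‖ξ‖ * ‖η‖) := by
  obtain ⟨hs, he⟩ := hA x hx
  have hn : ∀ ξ : E d, ξ.ofLp ⬝ᵥ ξ.ofLp = ‖ξ‖ ^ 2 := fun ξ => by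
    rw [EuclideanSpace.real_norm_sq_eq]
    simp [dotProduct, sq]
  have hsym : (A x).mulVec η.ofLp ⬝ᵥ ξ.ofLp = (A x).mulVec ξ.ofLp ⬝ᵥ η.ofLp := by
    rw [dotProduct_comm, Matrix.dotProduct_mulVec, ← Matrix.mulVec_transpose, hs]
  have hq : ∀ t : ℝ, 0 ≤ ((A x).mulVec η.ofLp ⬝ᵥ η.ofLp) * (t * t) +
      (2 * ((A x).mulVec ξ.ofLp ⬝ᵥ η.ofLp)) * t + (A x).mulVec ξ.ofLp ⬝ᵥ ξ.ofLp := by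
    intro t
    have h1 := (he (ξ.ofLp + t • η.ofLp)).1
    have h2 : 0 ≤ (ξ.ofLp + t • η.ofLp) ⬝ᵥ (ξ.ofLp + t • η.ofLp) := by
      have := hn (ξ + t • η)
      rw [WithLp.ofLp_add, WithLp.ofLp_smul] at this
      rw [this]
      positivity
    have h3 := (mul_nonneg ha₁.le h2).trans h1
    simp only [Matrix.mulVec_add, Matrix.mulVec_smul, add_dotProduct, dotProduct_add,
      smul_dotProduct, dotProduct_smul, smul_eq_mul, hsym] at h3
    linarith
  have hdisc := discrim_le_zero hq
  have h1 := (he ξ.ofLp).2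
  have h2 := (he η.ofLp).2
  have h3 := (he ξ.ofLp).1
  have h4 := (he η.ofLp).1
  rw [hn] at h1 h2 h3 h4
  set p := (A x).mulVec ξ.ofLp ⬝ᵥ ξ.ofLp
  set q := (A x).mulVec η.ofLp ⬝ᵥ η.ofLp
  set r := (A x).mulVec ξ.ofLp ⬝ᵥ η.ofLp
  rw [discrim] at hdisc
  have hp : 0 ≤ p := (by positivity : (0 : ℝ) ≤ a₁ * ‖ξ‖ ^ 2).trans h3
  have hq0 : 0 ≤ q := (by positivity : (0 : ℝ) ≤ a₁ * ‖η‖ ^ 2).trans h4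
  have h5 : p * q ≤ (|a₂| * ‖ξ‖ ^ 2) * (|a₂| * ‖η‖ ^ 2) := by
    refine mul_le_mul (h1.trans ?_) (h2.trans ?_) hq0 (by positivity)
    · exact mul_le_mul_of_nonneg_right (le_abs_self _) (by positivity)
    · exact mul_le_mul_of_nonneg_right (le_abs_self _) (by positivity)
  refine abs_le_of_sq_le_sq ?_ (by positivity)
  nlinarith

/-- The entries of `A` are Lipschitz in the interior only, so they are extended to the whole space
one by one. The extension agrees with `traceCoeff` on the closed simplex by continuity, and the
result is a globally Lipschitz field to which the half-space divergence theorem applies. -/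
theorem exists_flux_extension {K : LSimplex d} (hK : AffineIndependent ℝ K.vert)
    {A : E d → Matrix (Fin d) (Fin d) ℝ}
    (hA : ∀ i j, ∃ L : ℝ≥0, LipschitzOnWith L (fun x => A x i j) (interior K.carrier))
    (p : MvPolynomial (Fin d) ℝ) : ∃ F : Fin d → E d → ℝ,
      (∀ k, ∃ C : ℝ≥0, LipschitzWith C (F k)) ∧
      (∀ k, ∀ x ∈ interior K.carrier, F k x = (A x).mulVec (pgrad p x) k) ∧
      ∀ k, ∀ x ∈ K.carrier, F k x = (traceCoeff A K x).mulVec (pgrad p x) k := by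
  choose L hL using hA
  choose a ha hae using fun i j => (hL i j).extend_real
  -- Polynomials need not be globally Lipschitz; the cutoff makes them so without changing them near
  -- the simplex.
  obtain ⟨ψ, hψ, hψc, hψ1, -⟩ := exists_cutoff (LSimplex.isCompact_carrier K)
  have hg : ∀ j, ∃ C : ℝ≥0, LipschitzWith C fun x => pgrad p x j * ψ x := by
    intro j
    have h1 : ContDiff ℝ ∞ fun x => pgrad p x j * ψ x := (contDiff_pval _).mul hψ
    exact h1.lipschitzWith_of_hasCompactSupport hψc.mul_left (by simp)
  choose Cg hCg using hg
  have hp : ∀ i j, ∃ C : ℝ≥0, LipschitzWith C fun x => a i j x * (pgrad p x j * ψ x) := fun i j =>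
    exists_lipschitzWith_mul_of_hasCompactSupport (ha i j) (hCg j) hψc.mul_left
  choose D hD using hp
  have htr : ∀ i j, ∀ x ∈ K.carrier, traceCoeff A K x i j = a i j x := by
    intro i j x hx
    rw [traceCoeff, Matrix.of_apply]
    refine extendFrom_eq (by rwa [LSimplex.closure_interior hK]) ?_
    refine Filter.Tendsto.congr' ?_
      ((ha i j).continuous.continuousWithinAt (s := interior K.carrier))
    filter_upwards [self_mem_nhdsWithin] with y hy
    exact (hae i j hy).symm
  refine ⟨fun k x => ∑ j, a k j x * (pgrad p x j * ψ x), fun k => ?_, fun k x hx => ?_,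
    fun k x hx => ?_⟩
  · refine ⟨∑ j, D k j, ?_⟩
    refine LipschitzWith.of_dist_le_mul fun x y => ?_
    rw [dist_eq_norm, ← Finset.sum_sub_distrib, NNReal.coe_sum, Finset.sum_mul]
    refine (norm_sum_le _ _).trans (Finset.sum_le_sum fun j _ => ?_)
    rw [← dist_eq_norm]
    exact (hD k j).dist_le_mul x y
  · simp only [(hψ1 x (interior_subset hx)).self_of_nhds, mul_one, Matrix.mulVec, dotProduct]
    exact Finset.sum_congr rfl fun j _ => by rw [← hae k j hx]
  · simp only [(hψ1 x hx).self_of_nhds, mul_one, Matrix.mulVec, dotProduct]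
    exact Finset.sum_congr rfl fun j _ => by rw [htr k j x hx]

theorem exists_continuous_flux {K : LSimplex d} (hK : AffineIndependent ℝ K.vert)
    {A : E d → Matrix (Fin d) (Fin d) ℝ}
    (hA : ∀ i j, ∃ L : ℝ≥0, LipschitzOnWith L (fun x => A x i j) (interior K.carrier))
    (u : L2Pair d) (i : Fin (d + 1)) :
    ∃ Φ : E d → ℝ, Continuous Φ ∧ ∀ x ∈ K.carrier, flux A u K i x = Φ x := by
  obtain ⟨F, hF, -, hFt⟩ := exists_flux_extension hK hA (localPoly u K)
  refine ⟨fun x => ∑ k, F k x * K.normal i k, ?_, fun x hx => ?_⟩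
  · refine continuous_finsetSum _ fun k _ => ?_
    obtain ⟨C, hC⟩ := hF k
    exact hC.continuous.mul continuous_const
  · rw [flux, dotProduct]
    exact Finset.sum_congr rfl fun k _ => by rw [hFt k x hx]

theorem elemResidual_eq {K : LSimplex d} {A : E d → Matrix (Fin d) (Fin d) ℝ} {B : E d → ℝ}
    {lam : ℝ} {u : L2Pair d} {F : Fin d → E d → ℝ}
    (hF : ∀ k, ∀ x ∈ interior K.carrier, F k x = (A x).mulVec (pgrad (localPoly u K) x) k)
    {x : E d} (hx : x ∈ interior K.carrier) :
    elemResidual A B lam u K x = -(∑ k, fderiv ℝ (F k) x (EuclideanSpace.single k 1))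
      - lam * B x * pval (localPoly u K) x := by
  rw [elemResidual, divergence]
  congr 2
  refine Finset.sum_congr rfl fun k _ => ?_
  congr 1
  refine Filter.EventuallyEq.fderiv_eq ?_
  filter_upwards [isOpen_interior.mem_nhds hx] with y hy
  exact (hF k y hy).symm

theorem norm_fderiv_single_le {F : E d → ℝ} {C : ℝ≥0} (hF : LipschitzWith C F) (x : E d)
    (k : Fin d) : ‖fderiv ℝ F x (EuclideanSpace.single k 1)‖ ≤ C := by
  rw [← gradient_apply]
  exact (PiLp.norm_apply_le _ _).trans (norm_gradient_le hF x)

theorem memLp_elemResidual {Ω : Set (E d)} {K : LSimplex d} (hK : AffineIndependent ℝ K.vert)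
    (hKΩ : interior K.carrier ⊆ Ω)
    {A : E d → Matrix (Fin d) (Fin d) ℝ}
    (hA : ∀ i j, ∃ L : ℝ≥0, LipschitzOnWith L (fun x => A x i j) (interior K.carrier))
    {B : E d → ℝ} (hB : AEMeasurable B (volume.restrict Ω)) {b₂ : ℝ} (hb : ∀ x ∈ Ω, |B x| ≤ b₂)
    (lam : ℝ) (u : L2Pair d) :
    MemLp (elemResidual A B lam u K) 2 (volume.restrict K.carrier) := by
  obtain ⟨F, hF, hFe, -⟩ := exists_flux_extension hK hA (localPoly u K)
  choose C hC using hF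
  rw [← K.restrict_interior]
  haveI : IsFiniteMeasure ((volume : Measure (E d)).restrict (interior K.carrier)) :=
    ⟨by simpa using (measure_mono interior_subset).trans_lt K.isCompact_carrier.measure_lt_top⟩
  obtain ⟨P, hP⟩ := K.isCompact_carrier.exists_bound_of_continuousOn
    (continuous_pval (localPoly u K)).continuousOn
  have hae : elemResidual A B lam u K =ᵐ[volume.restrict (interior K.carrier)]
      fun x => -(∑ k, fderiv ℝ (F k) x (EuclideanSpace.single k 1))
        - lam * B x * pval (localPoly u K) x := by
    filter_upwards [ae_restrict_mem isOpen_interior.measurableSet] with x hx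
    exact elemResidual_eq hFe hx
  refine (memLp_congr_ae hae).2 ?_
  refine MemLp.of_bound (C := ∑ k, (C k : ℝ) + |lam| * b₂ * P) ?_ ?_
  · refine AEMeasurable.aestronglyMeasurable (AEMeasurable.sub (AEMeasurable.neg ?_) ?_)
    · exact (Finset.measurable_sum _ fun k _ =>
        (measurable_fderiv_apply_const ℝ (F k) _)).aemeasurable
    · exact ((hB.mono_measure (Measure.restrict_mono hKΩ le_rfl)).const_mul lam).mul
        (continuous_pval _).measurable.aemeasurable
  · filter_upwards [ae_restrict_mem isOpen_interior.measurableSet] with x hx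
    refine (norm_sub_le _ _).trans (add_le_add ?_ ?_)
    · rw [norm_neg]
      refine (norm_sum_le _ _).trans (Finset.sum_le_sum fun k _ => ?_)
      exact norm_fderiv_single_le (hC k) x k
    · rw [norm_mul, norm_mul, Real.norm_eq_abs, Real.norm_eq_abs]
      have h1 := hb x (hKΩ hx)
      have h2 := hP x (interior_subset hx)
      have h3 : 0 ≤ b₂ := (abs_nonneg _).trans h1
      gcongr

/-! ### Integration by parts on an element -/

/-- Within the half-space of the `i`-th side, `v` vanishes outside the simplex. The integrals over
half-space and simplex therefore coincide, and only this one side contributes a boundary term. -/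
theorem integral_parts {b : AffineBasis (Fin (d + 1)) ℝ (E d)} {i : Fin (d + 1)} {n : E d}
    (hn : IsOuterNormal b i n) (hd : 0 < d) {v F : E d → ℝ} {C C' : ℝ≥0} (hF : LipschitzWith C F)
    (hv : LipschitzWith C' v) (hvc : HasCompactSupport v)
    (hvK : ∀ x, 0 ≤ b.coord i x → v x ≠ 0 → x ∈ hull b) (k : Fin d) :
    ∫ x in hull b, F x * gradient v x k =
      -(∫ x in hull b, fderiv ℝ F x (EuclideanSpace.single k 1) * v x) +
        ∫ x, F x * n k * v x ∂faceMeasure b i := by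
  obtain ⟨D, hD⟩ := exists_lipschitzWith_mul_of_hasCompactSupport hF hv hvc
  have h1 := integral_halfSpace_coord hn hd hD hvc.mul_left (EuclideanSpace.single k 1)
  have hsub : hull b ⊆ {x | 0 ≤ b.coord i x} := fun x hx => (mem_hull b x).1 hx i
  have hH : MeasurableSet {x | 0 ≤ b.coord i x} :=
    (isClosed_le continuous_const (continuous_coord b i)).measurableSet
  have hprod : ∀ᵐ x, lineDeriv ℝ (fun x => F x * v x) x (EuclideanSpace.single k 1) =
      F x * gradient v x k + fderiv ℝ F x (EuclideanSpace.single k 1) * v x := by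
    filter_upwards [hF.ae_differentiableAt, hv.ae_differentiableAt] with x hx hx'
    have hm : DifferentiableAt ℝ (fun x => F x * v x) x := hx.mul hx'
    rw [hm.lineDeriv_eq_fderiv, fderiv_fun_mul hx hx', gradient_apply]
    simp [mul_comm]
  have h2 : ∫ x in {x | 0 ≤ b.coord i x},
      lineDeriv ℝ (fun x => F x * v x) x (EuclideanSpace.single k 1) =
      ∫ x in hull b, (F x * gradient v x k + fderiv ℝ F x (EuclideanSpace.single k 1) * v x) := by
    rw [setIntegral_congr_ae hH (hprod.mono fun x hx _ => hx)]
    refine setIntegral_eq_of_subset_of_ae_sdiff_eq_zero hH.nullMeasurableSet hsub ?_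
    filter_upwards [ae_gradient_eq_zero hv] with x hx hxd
    have hv0 : v x = 0 := by
      by_contra h
      exact hxd.2 (hvK x hxd.1 h)
    rw [hx hv0, hv0]
    simp
  obtain ⟨Bv, hBv⟩ := hv.continuous.bounded_above_of_compact_support hvc
  haveI : IsFiniteMeasure ((volume : Measure (E d)).restrict (hull b)) :=
    ⟨by simpa using (isCompact_hull b).measure_lt_top⟩
  obtain ⟨BF, hBF⟩ := (isCompact_hull b).exists_bound_of_continuousOn hF.continuous.continuousOn
  have i1 : Integrable (fun x => F x * gradient v x k) (volume.restrict (hull b)) := by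
    refine Integrable.of_bound (C := BF * C') ?_ ?_
    · refine (hF.continuous.measurable.mul ?_).aestronglyMeasurable
      simp only [gradient_apply]
      exact measurable_fderiv_apply_const ℝ v _
    · filter_upwards [ae_restrict_mem (isCompact_hull b).measurableSet] with x hx
      rw [norm_mul]
      have h3 : ‖gradient v x k‖ ≤ C' := (PiLp.norm_apply_le _ _).trans (norm_gradient_le hv x)
      exact mul_le_mul (hBF x hx) h3 (norm_nonneg _) ((norm_nonneg _).trans (hBF x hx))
  have i2 : Integrable (fun x => fderiv ℝ F x (EuclideanSpace.single k 1) * v x)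
      (volume.restrict (hull b)) := by
    refine Integrable.of_bound (C := C * Bv) ?_ ?_
    · exact ((measurable_fderiv_apply_const ℝ F _).mul
        hv.continuous.measurable).aestronglyMeasurable
    · refine Filter.Eventually.of_forall fun x => ?_
      rw [norm_mul]
      refine mul_le_mul ?_ (hBv x) (norm_nonneg _) C.2
      exact norm_fderiv_single_le hF x k
  rw [h2, integral_add i1 i2] at h1
  have h4 : ∫ x, F x * n k * v x ∂faceMeasure b i =
      inner ℝ (EuclideanSpace.single k 1) n * ∫ x, F x * v x ∂planeMeasure b i := by
    rw [EuclideanSpace.inner_single_left, faceMeasure, ← integral_const_mul,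
      ← integral_indicator (isCompact_hull b).measurableSet]
    refine integral_congr_ae ?_
    filter_upwards [ae_planeMeasure b] with x hx
    by_cases hxh : x ∈ hull b
    · rw [Set.indicator_of_mem hxh]
      simp only [map_one, one_mul]
      ring
    · rw [Set.indicator_of_notMem hxh]
      have : v x = 0 := by
        by_contra h
        exact hxh (hvK x hx.ge h)
      rw [this]
      simp
  rw [h4, ← h1]
  ring

theorem integral_parts_elem {K : LSimplex d} (hK : AffineIndependent ℝ K.vert) (hd : 0 < d)
    {Ω : Set (E d)} (hKΩ : interior K.carrier ⊆ Ω) {A : E d → Matrix (Fin d) (Fin d) ℝ}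
    (hA : ∀ i j, ∃ L : ℝ≥0, LipschitzOnWith L (fun x => A x i j) (interior K.carrier))
    {B : E d → ℝ} (hB : AEMeasurable B (volume.restrict Ω)) {b₂ : ℝ} (hb : ∀ x ∈ Ω, |B x| ≤ b₂)
    (lam : ℝ) (u : L2Pair d) (i : Fin (d + 1)) {v : E d → ℝ} {C : ℝ≥0} (hv : LipschitzWith C v)
    (hvc : HasCompactSupport v)
    (hvK : ∀ x, 0 ≤ (K.basis hK).coord i x → v x ≠ 0 → x ∈ K.carrier) :
    ∫ x in K.carrier, ((A x).mulVec (pgrad (localPoly u K) x) ⬝ᵥ (gradient v x).ofLp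
        - lam * (B x * pval (localPoly u K) x * v x)) =
      (∫ x in K.carrier, elemResidual A B lam u K x * v x) +
        ∫ x, flux A u K i x * v x ∂sideMeasure K i := by
  obtain ⟨F, hF, hFe, hFt⟩ := exists_flux_extension hK hA (localPoly u K)
  choose CF hCF using hF
  set q := localPoly u K
  haveI : IsFiniteMeasure ((volume : Measure (E d)).restrict K.carrier) :=
    ⟨by simpa using K.isCompact_carrier.measure_lt_top⟩
  haveI := isFiniteMeasure_faceMeasure (K.basis hK) hd i
  obtain ⟨Bv, hBv⟩ := hv.continuous.bounded_above_of_compact_support hvc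
  have hbd : ∀ k, ∃ BF, ∀ x ∈ K.carrier, ‖F k x‖ ≤ BF := fun k =>
    K.isCompact_carrier.exists_bound_of_continuousOn (hCF k).continuous.continuousOn
  choose BF hBF using hbd
  have i1 : ∀ k, Integrable (fun x => F k x * gradient v x k) (volume.restrict K.carrier) := by
    intro k
    refine Integrable.of_bound (C := BF k * C) ?_ ?_
    · refine ((hCF k).continuous.measurable.mul ?_).aestronglyMeasurable
      simp only [gradient_apply]
      exact measurable_fderiv_apply_const ℝ v _
    · filter_upwards [ae_restrict_mem K.isCompact_carrier.measurableSet] with x hx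
      rw [norm_mul]
      have h3 : ‖gradient v x k‖ ≤ C := (PiLp.norm_apply_le _ _).trans (norm_gradient_le hv x)
      exact mul_le_mul (hBF k x hx) h3 (norm_nonneg _) ((norm_nonneg _).trans (hBF k x hx))
  have i2 : ∀ k, Integrable (fun x => fderiv ℝ (F k) x (EuclideanSpace.single k 1) * v x)
      (volume.restrict K.carrier) := by
    intro k
    refine Integrable.of_bound (C := CF k * Bv) ?_ ?_
    · exact ((measurable_fderiv_apply_const ℝ (F k) _).mul
        hv.continuous.measurable).aestronglyMeasurable
    · refine Filter.Eventually.of_forall fun x => ?_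
      rw [norm_mul]
      refine mul_le_mul ?_ (hBv x) (norm_nonneg _) (CF k).2
      exact norm_fderiv_single_le (hCF k) x k
  obtain ⟨P, hP⟩ := K.isCompact_carrier.exists_bound_of_continuousOn
    (continuous_pval q).continuousOn
  have hinteg : interior K.carrier ∈ ae (volume.restrict K.carrier) := by
    rw [← K.restrict_interior]
    exact ae_restrict_mem isOpen_interior.measurableSet
  have i3 : Integrable (fun x => lam * (B x * pval q x * v x)) (volume.restrict K.carrier) := by
    refine Integrable.const_mul ?_ lam
    refine Integrable.of_bound (C := b₂ * P * Bv) ?_ ?_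
    · rw [← K.restrict_interior]
      exact (((hB.mono_measure (Measure.restrict_mono hKΩ le_rfl)).mul
        (continuous_pval q).measurable.aemeasurable).mul
        hv.continuous.measurable.aemeasurable).aestronglyMeasurable
    · filter_upwards [hinteg] with x hx
      rw [norm_mul, norm_mul, Real.norm_eq_abs]
      have h1 := hb x (hKΩ hx)
      have h2 := hP x (interior_subset hx)
      have h3 : 0 ≤ b₂ := (abs_nonneg _).trans h1
      have h4 : 0 ≤ P := (norm_nonneg _).trans h2
      exact mul_le_mul (mul_le_mul h1 h2 (norm_nonneg _) h3) (hBv x) (norm_nonneg _) (by positivity)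
  have i4 : ∀ k, Integrable (fun x => F k x * K.normal i k * v x) (faceMeasure (K.basis hK) i) :=
    fun k => integrable_faceMeasure _ hd
      (((hCF k).continuous.mul continuous_const).mul hv.continuous)
  have e1 : ∫ x in K.carrier, ((A x).mulVec (pgrad q x) ⬝ᵥ (gradient v x).ofLp
        - lam * (B x * pval q x * v x)) =
      ∑ k, (∫ x in K.carrier, F k x * gradient v x k)
        - ∫ x in K.carrier, lam * (B x * pval q x * v x) := by
    rw [← integral_finsetSum _ fun k _ => i1 k,
      ← integral_sub (integrable_finsetSum _ fun k _ => i1 k) i3]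
    refine integral_congr_ae ?_
    filter_upwards [hinteg] with x hx
    simp only [dotProduct, fun k => hFe k x hx]
  have e2 : ∫ x in K.carrier, elemResidual A B lam u K x * v x =
      -(∑ k, ∫ x in K.carrier, fderiv ℝ (F k) x (EuclideanSpace.single k 1) * v x)
        - ∫ x in K.carrier, lam * (B x * pval q x * v x) := by
    rw [← integral_finsetSum _ fun k _ => i2 k, ← integral_neg,
      ← integral_sub (Integrable.fun_neg (integrable_finsetSum _ fun k _ => i2 k)) i3]
    refine integral_congr_ae ?_
    filter_upwards [hinteg] with x hx
    rw [elemResidual_eq hFe hx, ← Finset.sum_mul]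
    ring
  have e3 : ∫ x, flux A u K i x * v x ∂sideMeasure K i =
      ∑ k, ∫ x, F k x * K.normal i k * v x ∂faceMeasure (K.basis hK) i := by
    rw [LSimplex.sideMeasure_eq hK, ← integral_finsetSum _ fun k _ => i4 k]
    refine integral_congr_ae ?_
    filter_upwards [ae_faceMeasure (K.basis hK)] with x hx
    rw [flux, dotProduct, ← Finset.sum_mul]
    congr 1
    exact Finset.sum_congr rfl fun k _ => by rw [hFt k x hx.2]
  have e4 : ∀ k, ∫ x in K.carrier, F k x * gradient v x k =
      -(∫ x in K.carrier, fderiv ℝ (F k) x (EuclideanSpace.single k 1) * v x) +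
        ∫ x, F k x * K.normal i k * v x ∂faceMeasure (K.basis hK) i := fun k =>
    integral_parts (LSimplex.isOuterNormal_normal hd hK i) hd (hCF k) hv hvc hvK k
  rw [e1, e2, e3, Finset.sum_congr rfl fun k _ => e4 k, Finset.sum_add_distrib,
    Finset.sum_neg_distrib]
  ring

end

section

/-! ### Conforming triangulations -/

variable {Ω : Set (E d)} {M M' : Finset (LSimplex d)} {K K' : LSimplex d}

theorem LSimplex.sideVert_injective (hK : AffineIndependent ℝ K.vert) :
    Function.Injective K.sideVert := by
  intro i j h
  by_contra hij
  have h1 : K.vert i ∈ K.sideVert j := ⟨i, hij, rfl⟩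
  rw [← h] at h1
  obtain ⟨k, hk, hki⟩ := h1
  exact hk (hK.injective hki)

theorem IsTriangulation.exists_vert_notMem (hM : IsTriangulation Ω M) (hK : K ∈ M) (hK' : K' ∈ M)
    (hne : K ≠ K') : ∃ i, K.vert i ∉ Set.range K'.vert := by
  by_contra! h
  refine hne (hM.unique_label K hK K' hK' ?_)
  refine Set.eq_of_subset_of_ncard_le (Set.range_subset_iff.2 h) ?_ (Set.finite_range _)
  rw [← Set.image_univ, ← Set.image_univ, Set.ncard_image_of_injective _
    (hM.nondegenerate K hK).injective, Set.ncard_image_of_injective _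
    (hM.nondegenerate K' hK').injective]

/-- Some vertex of `K` is not a vertex of `K'`, so by conformity the intersection lies in the side
of `K` opposite to it, and that side misses the interior. -/
theorem IsTriangulation.notMem_of_mem_interior (hM : IsTriangulation Ω M) (hK : K ∈ M)
    (hK' : K' ∈ M) (hne : K ≠ K') {x : E d} (hx : x ∈ interior K.carrier) : x ∉ K'.carrier := by
  intro hx'
  obtain ⟨i, hi⟩ := hM.exists_vert_notMem hK hK' hne
  have h1 : x ∈ K.carrier ∩ K'.carrier := ⟨_root_.interior_subset hx, hx'⟩
  rw [hM.conforming K hK K' hK'] at h1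
  have h2 : x ∈ K.side i := by
    refine convexHull_mono ?_ h1
    rintro _ ⟨⟨k, rfl⟩, hk⟩
    refine ⟨k, ?_, rfl⟩
    rintro rfl
    exact hi hk
  rw [LSimplex.side_eq (hM.nondegenerate K hK)] at h2
  rw [LSimplex.interior_carrier_eq (hM.nondegenerate K hK)] at hx
  exact (hx i).ne' h2.1

/-- An interior point of `K` lies in some element of the refinement, and the ancestor of that
element contains the point, hence is `K` itself. The union of the descendants of `K` is closed, so
it contains the boundary of `K` as well. -/
theorem exists_descendant_mem (hM : IsTriangulation Ω M) (hM' : IsTriangulation Ω M')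
    (href : ∀ D ∈ M', ∃ K ∈ M, ∃ m, K.IsDescendant m D) (hK : K ∈ M) {x : E d}
    (hx : x ∈ K.carrier) : ∃ D ∈ M', ∃ m, K.IsDescendant m D ∧ x ∈ D.carrier := by
  classical
  set N := M'.filter fun D => ∃ m, K.IsDescendant m D
  have hcl : IsClosed (⋃ D ∈ N, D.carrier) :=
    Set.Finite.isClosed_biUnion N.finite_toSet fun D _ => D.isCompact_carrier.isClosed
  have hsub : interior K.carrier ⊆ ⋃ D ∈ N, D.carrier := by
    intro y hy
    have h1 : y ∈ ⋃ D ∈ M', D.carrier := by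
      rw [hM'.cover]
      exact hM.carrier_subset hK (interior_subset hy)
    simp only [Set.mem_iUnion] at h1
    obtain ⟨D, hD, hyD⟩ := h1
    obtain ⟨K₁, hK₁, m, hm⟩ := href D hD
    have h2 : K = K₁ := by
      by_contra hne
      exact hM.notMem_of_mem_interior hK hK₁ hne hy (hm.carrier_subset hyD)
    subst h2
    simp only [Set.mem_iUnion]
    exact ⟨D, Finset.mem_filter.2 ⟨hD, m, hm⟩, hyD⟩
  have h3 := closure_minimal hsub hcl
  rw [LSimplex.closure_interior (hM.nondegenerate K hK)] at h3
  have h4 := h3 hx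
  simp only [Set.mem_iUnion] at h4
  obtain ⟨D, hD, hxD⟩ := h4
  obtain ⟨hD', m, hm⟩ := Finset.mem_filter.1 hD
  exact ⟨D, hD', m, hm, hxD⟩

/-- A point of a convex hull at which a nonnegative affine function vanishes lies in the hull of the
zeros of that function. -/
theorem mem_convexHull_zeros {Z : Set (E d)} {φ : E d →ᵃ[ℝ] ℝ} (hφ : ∀ z ∈ Z, 0 ≤ φ z) {g : E d}
    (hg : g ∈ convexHull ℝ Z) (hg0 : φ g = 0) : g ∈ convexHull ℝ (Z ∩ {z | φ z = 0}) := by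
  have hzero : ∀ x ∈ convexHull ℝ (Z ∩ {z | φ z = 0}), φ x = 0 := by
    intro x hx
    have h1 : Convex ℝ {z | φ z = 0} := by
      have := (convex_singleton (𝕜 := ℝ) (0 : ℝ)).affine_preimage φ
      exact this
    exact convexHull_min Set.inter_subset_right h1 hx
  -- This union contains `Z` and is convex: a proper combination involving a point with `φ > 0`
  -- again has `φ > 0`. A point of the hull with `φ = 0` must then lie in the second part.
  have hconv : Convex ℝ ({x | 0 < φ x} ∪ convexHull ℝ (Z ∩ {z | φ z = 0})) := by
    have hnn : ∀ x ∈ {x | 0 < φ x} ∪ convexHull ℝ (Z ∩ {z | φ z = 0}), 0 ≤ φ x := by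
      rintro x (hx | hx)
      · exact le_of_lt hx
      · exact (hzero x hx).ge
    intro x hx y hy s t hs ht hst
    by_cases hall : x ∈ convexHull ℝ (Z ∩ {z | φ z = 0}) ∧ y ∈ convexHull ℝ (Z ∩ {z | φ z = 0})
    · exact Or.inr (convex_convexHull ℝ _ hall.1 hall.2 hs ht hst)
    have hval : φ (s • x + t • y) = s * φ x + t * φ y := Convex.combo_affine_apply hst
    rcases hs.eq_or_lt with rfl | hs'
    · obtain rfl : t = 1 := by linarith
      simpa using hy
    rcases ht.eq_or_lt with rfl | ht'
    · obtain rfl : s = 1 := by linarith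
      simpa using hx
    left
    change 0 < φ (s • x + t • y)
    rw [hval]
    have hx0 := hnn x hx
    have hy0 := hnn y hy
    rcases hx with hx | hx
    · exact add_pos_of_pos_of_nonneg (mul_pos hs' hx) (mul_nonneg ht hy0)
    · rcases hy with hy | hy
      · exact add_pos_of_nonneg_of_pos (mul_nonneg hs hx0) (mul_pos ht' hy)
      · exact absurd ⟨hx, hy⟩ hall
  have hsub : Z ⊆ {x | 0 < φ x} ∪ convexHull ℝ (Z ∩ {z | φ z = 0}) := by
    intro z hz
    rcases (hφ z hz).eq_or_lt with h | h
    · exact Or.inr (subset_convexHull ℝ _ ⟨hz, h.symm⟩)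
    · exact Or.inl h
  rcases convexHull_min hsub hconv hg with h | h
  · exact absurd hg0 (ne_of_gt h)
  · exact h

/-! ### Two simplices with a common side -/

section CommonSide

variable {i j : Fin (d + 1)}

theorem exists_match (hS : K'.sideVert j = K.sideVert i) {a : Fin (d + 1)} (ha : a ≠ i) :
    ∃ a', a' ≠ j ∧ K'.vert a' = K.vert a := by
  have h1 : K.vert a ∈ K'.sideVert j := by
    rw [hS]
    exact ⟨a, ha, rfl⟩
  exact h1

theorem coord_eq_sum (hK : AffineIndependent ℝ K.vert) (φ : E d →ᵃ[ℝ] ℝ) (x : E d) :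
    φ x = ∑ k, (K.basis hK).coord k x * φ (K.vert k) := by
  have h1 := Finset.univ.map_affineCombination K.vert (fun k => (K.basis hK).coord k x)
    ((K.basis hK).sum_coord_apply_eq_one x) φ
  rw [Finset.affineCombination_eq_linear_combination _ _ _
      ((K.basis hK).sum_coord_apply_eq_one x),
    Finset.affineCombination_eq_linear_combination _ _ _
      ((K.basis hK).sum_coord_apply_eq_one x)] at h1
  have h2 := (K.basis hK).linear_combination_coord_eq_self x
  rw [LSimplex.coe_basis] at h2
  rw [h2] at h1
  simpa using h1

/-- Both opposite coordinates are affine and vanish on the common side, so they are proportional.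
The sign of the factor decides whether the simplices lie on the same side of its plane. -/
theorem coord_opposite (hK : AffineIndependent ℝ K.vert)
    (hK' : AffineIndependent ℝ K'.vert) (hS : K'.sideVert j = K.sideVert i) (x : E d) :
    (K'.basis hK').coord j x =
    (K'.basis hK').coord j (K.vert i) * (K.basis hK).coord i x := by
  rw [coord_eq_sum hK ((K'.basis hK').coord j) x, Finset.sum_eq_single i]
  · ring
  · intro k _ hk
    obtain ⟨k', hk', h⟩ := exists_match hS hk
    rw [← h, ← LSimplex.coe_basis K' hK', (K'.basis hK').coord_apply_ne hk'.symm, mul_zero]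
  · simp

theorem coord_match (hK : AffineIndependent ℝ K.vert)
    (hK' : AffineIndependent ℝ K'.vert) (hS : K'.sideVert j = K.sideVert i)
    {a a' : Fin (d + 1)} (h : K'.vert a' = K.vert a) {x : E d}
    (hx : (K.basis hK).coord i x = 0) : (K'.basis hK').coord a' x = (K.basis hK).coord a x := by
  rw [coord_eq_sum hK ((K'.basis hK').coord a') x, Finset.sum_eq_single a]
  · rw [← h, ← LSimplex.coe_basis K' hK', (K'.basis hK').coord_apply_eq, mul_one]
  · intro k _ hk
    by_cases hki : k = i
    · rw [hki, hx, zero_mul]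
    · obtain ⟨k', hk', hk''⟩ := exists_match hS hki
      have hne : a' ≠ k' := by
        rintro rfl
        exact hk (hK.injective (hk''.symm.trans h))
      rw [← hk'', ← LSimplex.coe_basis K' hK', (K'.basis hK').coord_apply_ne hne, mul_zero]
  · simp

theorem coord_opposite_ne_zero (hK : AffineIndependent ℝ K.vert)
    (hK' : AffineIndependent ℝ K'.vert) (hS : K'.sideVert j = K.sideVert i) :
    (K'.basis hK').coord j (K.vert i) ≠ 0 := by
  intro h
  have h1 := coord_opposite hK hK' hS (K'.vert j)
  rw [h, zero_mul, ← LSimplex.coe_basis K' hK', (K'.basis hK').coord_apply_eq] at h1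
  exact one_ne_zero h1

/-- If both simplices lie on the same side, a point slightly off the barycentre of the common side,
towards `K.vert i`, is interior to both. -/
theorem exists_mem_interior_inter (hK : AffineIndependent ℝ K.vert)
    (hK' : AffineIndependent ℝ K'.vert) (hS : K'.sideVert j = K.sideVert i)
    (hd : 0 < d) (hpos : 0 < (K'.basis hK').coord j (K.vert i)) :
    ∃ x, x ∈ interior K.carrier ∧ x ∈ interior K'.carrier := by
  set b := K.basis hK
  set b' := K'.basis hK'
  have hd0 : (0 : ℝ) < d := by exact_mod_cast hd
  let w : Fin (d + 1) → ℝ := fun k => if k = i then 0 else 1 / d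
  have hw : ∑ k, w k = 1 := by
    simp only [w]
    rw [Finset.sum_ite, Finset.sum_const_zero, zero_add, Finset.sum_const, Finset.filter_ne']
    simp [hd0.ne']
  set g := ∑ k, w k • K.vert k with hg
  have hgc : ∀ k, b.coord k g = w k := by
    intro k
    rw [hg, LSimplex.coord_sum b w hw]
    rw [Finset.sum_eq_single k]
    · rw [← LSimplex.coe_basis K hK, b.coord_apply_eq, mul_one]
    · intro l _ hl
      rw [← LSimplex.coe_basis K hK, b.coord_apply_ne hl.symm, mul_zero]
    · simp
  have hgi : b.coord i g = 0 := by rw [hgc]; simp [w]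
  have hgc' : ∀ l, l ≠ j → 0 < b'.coord l g := by
    intro l hl
    obtain ⟨a, ha, hal⟩ := exists_match hS.symm hl
    rw [coord_match hK hK' hS hal.symm hgi, hgc]
    simp only [w, if_neg ha]
    positivity
  have hcomb : ∀ (φ : E d →ᵃ[ℝ] ℝ) (ε : ℝ), φ (AffineMap.lineMap g (K.vert i) ε) =
      (1 - ε) * φ g + ε * φ (K.vert i) := by
    intro φ ε
    rw [AffineMap.apply_lineMap, AffineMap.lineMap_apply_module]
    simp
  have hev : ∀ᶠ ε : ℝ in 𝓝[>] 0, ∀ l, l ≠ j →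
      0 < (1 - ε) * b'.coord l g + ε * b'.coord l (K.vert i) := by
    refine Filter.eventually_all.2 fun l => ?_
    by_cases hl : l = j
    · exact Filter.Eventually.of_forall fun ε h => absurd hl h
    have hc : Continuous fun ε : ℝ => (1 - ε) * b'.coord l g + ε * b'.coord l (K.vert i) := by
      fun_prop
    have := hc.tendsto 0
    simp only [sub_zero, one_mul, zero_mul, add_zero] at this
    exact ((this.eventually (lt_mem_nhds (hgc' l hl))).filter_mono nhdsWithin_le_nhds).mono
      fun ε h _ => h
  have hlt : ∀ᶠ ε : ℝ in 𝓝[>] 0, 0 < ε ∧ ε < 1 :=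
    (eventually_mem_nhdsWithin).and ((gt_mem_nhds one_pos).filter_mono nhdsWithin_le_nhds)
  obtain ⟨ε, h1, h2, h3⟩ := (hev.and hlt).exists
  refine ⟨AffineMap.lineMap g (K.vert i) ε, ?_, ?_⟩
  · rw [LSimplex.interior_carrier_eq hK]
    intro k
    change 0 < b.coord k _
    rw [hcomb, hgc, ← LSimplex.coe_basis K hK]
    by_cases hk : k = i
    · subst hk
      simp only [w, if_true, mul_zero, zero_add]
      rw [(K.basis hK).coord_apply_eq, mul_one]
      exact h2
    · simp only [w, if_neg hk]
      rw [(K.basis hK).coord_apply_ne hk, mul_zero, add_zero]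
      have : 0 < 1 - ε := by linarith
      positivity
  · rw [LSimplex.interior_carrier_eq hK']
    intro l
    change 0 < b'.coord l _
    rw [hcomb]
    by_cases hl : l = j
    · subst hl
      have : b'.coord l g = 0 := by
        have := coord_opposite hK hK' hS g
        rw [hgi, mul_zero] at this
        exact this
      rw [this, mul_zero, zero_add]
      exact mul_pos h2 hpos
    · exact h1 l hl

end CommonSide

theorem IsTriangulation.coord_opposite_neg (hd : 0 < d) (hM : IsTriangulation Ω M) (hK : K ∈ M)
    (hK' : K' ∈ M) (hne : K ≠ K') {i j : Fin (d + 1)} (hS : K'.sideVert j = K.sideVert i) :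
    (K'.basis (hM.nondegenerate K' hK')).coord j (K.vert i) < 0 := by
  rcases lt_trichotomy ((K'.basis (hM.nondegenerate K' hK')).coord j (K.vert i)) 0 with h | h | h
  · exact h
  · exact absurd h (coord_opposite_ne_zero (hM.nondegenerate K hK) _ hS)
  · obtain ⟨x, hx, hx'⟩ := exists_mem_interior_inter (hM.nondegenerate K hK) _ hS hd h
    exact absurd (_root_.interior_subset hx') (hM.notMem_of_mem_interior hK hK' hne hx)

/-- Three different elements cannot share a side: if `K'` and `D` both lie opposite to `K`, they lie
on the same side of the plane, whereas they must be opposite to each other too. -/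
theorem IsTriangulation.eq_or_eq_of_sideVert (hd : 0 < d) (hM : IsTriangulation Ω M) (hK : K ∈ M)
    (hK' : K' ∈ M) (hne : K ≠ K') {i j : Fin (d + 1)} (hS : K'.sideVert j = K.sideVert i)
    {D : LSimplex d} (hD : D ∈ M) {l : Fin (d + 1)} (hDS : D.sideVert l = K.sideVert i) :
    D = K ∨ D = K' := by
  by_contra! h
  have h1 := hM.coord_opposite_neg hd hK hK' hne hS
  have h2 := hM.coord_opposite_neg hd hK hD h.1.symm hDS
  have h3 := hM.coord_opposite_neg hd hK' hD h.2.symm (hDS.trans hS.symm)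
  have e1 := coord_opposite (hM.nondegenerate K hK) (hM.nondegenerate K' hK') hS (K'.vert j)
  have e2 := coord_opposite (hM.nondegenerate K hK) (hM.nondegenerate D hD) hDS (K'.vert j)
  rw [← LSimplex.coe_basis K' (hM.nondegenerate K' hK'), (K'.basis _).coord_apply_eq,
    LSimplex.coe_basis] at e1
  nlinarith

theorem jump_eq (hd : 0 < d) (hM : IsTriangulation Ω M) (hK : K ∈ M) (hK' : K' ∈ M) (hne : K ≠ K')
    {i j : Fin (d + 1)} (hS : K'.sideVert j = K.sideVert i) (A : E d → Matrix (Fin d) (Fin d) ℝ)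
    (u : L2Pair d) (x : E d) : jump A M u K i x = flux A u K i x + flux A u K' j x := by
  classical
  rw [jump, if_pos ⟨K', hK', hne.symm, j, hS⟩]
  have hinner : ∀ D ∈ M, ∀ l, D.sideVert l = K.sideVert i →
      (∑ l', if D.sideVert l' = K.sideVert i then flux A u D l' x else 0) = flux A u D l x := by
    intro D hD l hl
    rw [Finset.sum_eq_single l, if_pos hl]
    · intro l' _ hl'
      refine if_neg fun h => hl' ?_
      exact LSimplex.sideVert_injective (hM.nondegenerate D hD) (h.trans hl.symm)
    · simp
  rw [← Finset.sum_subset (s₁ := {K, K'})]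
  · rw [Finset.sum_pair hne, hinner K hK i rfl, hinner K' hK' j hS]
  · intro D hD
    rcases Finset.mem_insert.1 hD with rfl | h
    · exact hK
    · rw [Finset.mem_singleton.1 h]
      exact hK'
  · intro D hD hDn
    refine Finset.sum_eq_zero fun l _ => if_neg fun h => hDn ?_
    rcases hM.eq_or_eq_of_sideVert hd hK hK' hne hS hD h with rfl | rfl <;> simp

/-! ### The traces of the side bubbles of two neighbours coincide -/

theorem apex_ne (t : Fin 3) (i : Fin 4) : apex t i ≠ i := by
  revert t i
  decide

theorem exists_other_two (i : Fin 3) : ∃ a b : Fin 3, a ≠ i ∧ b ≠ i ∧ a ≠ b := by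
  revert i
  decide

theorem exists_other_four (i c e : Fin 4) (hic : c ≠ i) (hei : e ≠ i) (hec : e ≠ c) :
    ∃ f : Fin 4, f ≠ i ∧ f ≠ c ∧ f ≠ e ∧ ∀ k, k = i ∨ k = c ∨ k = e ∨ k = f := by
  have h : ∀ i c e : Fin 4, ∃ f : Fin 4, f ≠ i ∧ f ≠ c ∧ f ≠ e := by decide
  obtain ⟨f, hfi, hfc, hfe⟩ := h i c e
  refine ⟨f, hfi, hfc, hfe, fun k => ?_⟩
  simp only [ne_eq, Fin.ext_iff] at *
  omega

theorem exists_other_three (i c : Fin 4) (hic : c ≠ i) :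
    ∃ a b : Fin 4, a ≠ i ∧ b ≠ i ∧ a ≠ c ∧ b ≠ c ∧ a ≠ b := by
  revert i c
  decide

theorem sign_cases {D D' : LSimplex d} {n m : ℕ} (hd : d = 2 ∨ d = 3)
    (hK : AffineIndependent ℝ K.vert) (h : K.IsDescendant n D) (h' : D.IsDescendant m D')
    (i a c : Fin (d + 1)) (hL : allDesc (signOn i a c) n K.type (unitCoord d) = true) :
    ∃ φ : E d →ᵃ[ℝ] ℝ, (∀ x, φ x = 0 ↔ (K.basis hK).coord a x = (K.basis hK).coord c x) ∧
      ∀ x ∈ D'.carrier, (K.basis hK).coord i x = 0 → 0 ≤ φ x := by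
  rcases LSimplex.sign_of_isDescendant hd (K.basis hK) rfl h i a c hL with hs | hs
  · refine ⟨(K.basis hK).coord a - (K.basis hK).coord c, fun x => ?_, fun x hx hxi => ?_⟩
    · simp [sub_eq_zero]
    · simpa using hs x (h'.carrier_subset hx) hxi
  · refine ⟨(K.basis hK).coord c - (K.basis hK).coord a, fun x => ?_, fun x hx hxi => ?_⟩
    · rw [eq_comm (a := (K.basis hK).coord a x)]
      simp [sub_eq_zero]
    · simpa using hs x (h'.carrier_subset hx) hxi

/-- Suppose that the apices differ. The refinement of `K` resolves the median of the face through
its apex, that of `K'` another median. At the barycentre, where the medians meet, conformity makes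
the intersection of a descendant of `K` and one of `K'` the hull of common vertices. Restricting
this hull to the zeros of three affine functions of constant sign leaves a common vertex on the face
and on both medians, hence the barycentre itself. But vertices of descendants have dyadic
coordinates. -/
theorem apex_match {Ω : Set (E 3)} {M M' : Finset (LSimplex 3)} {K K' : LSimplex 3}
    (hM : IsTriangulation Ω M) (hM' : IsTriangulation Ω M')
    (href : ∀ D ∈ M', ∃ K ∈ M, ∃ m, K.IsDescendant m D) (hK : K ∈ M) (hK' : K' ∈ M)
    (hg : ∀ D ∈ M', ∀ m, K.IsDescendant m D → nBisect 3 ≤ m)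
    (hg' : ∀ D ∈ M', ∀ m, K'.IsDescendant m D → nBisect 3 ≤ m) {i j : Fin 4}
    (hS : K'.sideVert j = K.sideVert i) :
    K'.vert (apex K'.type j) = K.vert (apex K.type i) := by
  have nK := hM.nondegenerate K hK
  have nK' := hM.nondegenerate K' hK'
  by_contra hne
  set c := apex K.type i with hc
  have hci : c ≠ i := apex_ne _ _
  obtain ⟨e, hei, he⟩ := exists_match hS.symm (apex_ne K'.type j)
  have hec : e ≠ c := by
    rintro rfl
    exact hne he.symm
  obtain ⟨f, hfi, hfc, hfe, hall⟩ := exists_other_four i c e hci hei hec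
  obtain ⟨c', hc'j, hc'⟩ := exists_match hS hci
  obtain ⟨f', hf'j, hf'⟩ := exists_match hS hfi
  have hc'a : c' ≠ apex K'.type j := by
    intro h
    rw [h, ← he] at hc'
    exact hec (nK.injective hc')
  have hf'a : f' ≠ apex K'.type j := by
    intro h
    rw [h, ← he] at hf'
    exact hfe (nK.injective hf').symm
  -- The barycentre of the common face. In the labels of `K`, the face has the vertices `c` (apex of
  -- `K`), `e` (apex of `K'`) and `f`.
  let w : Fin 4 → ℝ := fun k => if k = i then 0 else 1 / 3
  have hw : ∑ k, w k = 1 := by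
    simp only [w]
    rw [Finset.sum_ite, Finset.sum_const_zero, zero_add, Finset.sum_const, Finset.filter_ne']
    simp
  set g := ∑ k, w k • K.vert k with hgdef
  have hgc : ∀ k, (K.basis nK).coord k g = w k := by
    intro k
    rw [hgdef, LSimplex.coord_sum (K.basis nK) w hw, Finset.sum_eq_single k]
    · rw [← LSimplex.coe_basis K nK, (K.basis nK).coord_apply_eq, mul_one]
    · intro l _ hl
      rw [← LSimplex.coe_basis K nK, (K.basis nK).coord_apply_ne hl.symm, mul_zero]
    · simp
  have hgi : (K.basis nK).coord i g = 0 := by rw [hgc]; simp [w]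
  have hgS : g ∈ K.side i := by
    rw [LSimplex.side_eq nK]
    refine ⟨hgi, ?_⟩
    rw [LSimplex.carrier_eq nK]
    intro k
    change 0 ≤ (K.basis nK).coord k g
    rw [hgc]
    simp only [w]
    split_ifs <;> norm_num
  have hgK : g ∈ K.carrier := by
    rw [LSimplex.side_eq nK] at hgS
    exact hgS.2
  have hgK' : g ∈ K'.carrier := by
    rw [LSimplex.side, ← hS] at hgS
    change g ∈ K'.side j at hgS
    rw [LSimplex.side_eq nK'] at hgS
    exact hgS.2
  obtain ⟨D, hD, m, hm, hgD⟩ := exists_descendant_mem hM hM' href hK hgK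
  obtain ⟨D', hD', m', hm', hgD'⟩ := exists_descendant_mem hM hM' href hK' hgK'
  -- The sign information is available for generation six; the finer elements `D` and `D'` inherit
  -- it from their ancestors of that generation.
  obtain ⟨D₁, h₁, h₁'⟩ := hm.exists_intermediate (hg D hD m hm)
  obtain ⟨D₂, h₂, h₂'⟩ := hm'.exists_intermediate (hg' D' hD' m' hm')
  obtain ⟨φ, hφ, hφ0⟩ := sign_cases (Or.inr rfl) nK h₁ h₁' i e f
    (allDesc_signOn K.type i e f hei hfi hec hfc)
  obtain ⟨φ', hφ', hφ0'⟩ := sign_cases (Or.inr rfl) nK' h₂ h₂' j c' f'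
    (allDesc_signOn K'.type j c' f' hc'j hf'j hc'a hf'a)
  have hgh : g ∈ D.carrier ∩ D'.carrier := ⟨hgD, hgD'⟩
  rw [hM'.conforming D hD D' hD'] at hgh
  have hvD : ∀ z ∈ Set.range D.vert, z ∈ D.carrier := fun z hz => subset_convexHull ℝ _ hz
  have hvD' : ∀ z ∈ Set.range D'.vert, z ∈ D'.carrier := fun z hz => subset_convexHull ℝ _ hz
  -- The common vertices are narrowed down in turn to the face, to the median of `K` and to the
  -- median of `K'`.
  have s1 := mem_convexHull_zeros (φ := (K.basis nK).coord i) (fun z hz => by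
    have h1 := hm.carrier_subset (hvD z hz.1)
    exact (LSimplex.coord_mem_Icc nK h1 i).1) hgh hgi
  have s2 := mem_convexHull_zeros (φ := φ) (fun z hz => hφ0 z (hvD z hz.1.1) hz.2) s1
    ((hφ g).2 (by rw [hgc, hgc]; simp [w, hei, hfi]))
  have hj0 : ∀ z, (K.basis nK).coord i z = 0 → (K'.basis nK').coord j z = 0 := fun z hz => by
    rw [coord_opposite nK nK' hS, hz, mul_zero]
  have s3 := mem_convexHull_zeros (φ := φ')
    (fun z hz => hφ0' z (hvD' z hz.1.1.2) (hj0 z hz.1.2)) s2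
    ((hφ' g).2 (by
      rw [coord_match nK nK' hS hc' hgi, coord_match nK nK' hS hf' hgi, hgc, hgc]
      simp [w, hci, hfi]))
  obtain ⟨z, ⟨⟨⟨⟨k, rfl⟩, -⟩, hz1⟩, hz2⟩, hz3⟩ := convexHull_nonempty_iff.1 ⟨g, s3⟩
  have q2 : (K.basis nK).coord e (D.vert k) = (K.basis nK).coord f (D.vert k) := (hφ _).1 hz2
  have q3 := (hφ' _).1 hz3
  rw [coord_match nK nK' hS hc' hz1, coord_match nK nK' hS hf' hz1] at q3
  have hz1' : (K.basis nK).coord i (D.vert k) = 0 := hz1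
  have hsum := (K.basis nK).sum_coord_apply_eq_one (D.vert k)
  have hsum4 : ∑ l, (K.basis nK).coord l (D.vert k) = (K.basis nK).coord i (D.vert k) +
      ((K.basis nK).coord c (D.vert k) + ((K.basis nK).coord e (D.vert k) +
        (K.basis nK).coord f (D.vert k))) := by
    have hun : (Finset.univ : Finset (Fin 4)) = {i, c, e, f} := by
      ext l
      simpa using hall l
    rw [hun, Finset.sum_insert (by simp [hci.symm, hei.symm, hfi.symm]),
      Finset.sum_insert (by simp [hec.symm, hfc.symm]), Finset.sum_pair hfe.symm]
  -- Integrality of `2 ^ m / 3` would make `3` divide a power of two.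
  obtain ⟨z, -, hz⟩ := LSimplex.exists_coord_of_isDescendant (Or.inr rfl) (K.basis nK) rfl hm
    (fun _ => true) (LSimplex.allDesc_true _ _ _)
  have hdy := hz k f
  rw [hsum4] at hsum
  have hthird : (3 : ℝ) * z k f = 2 ^ m := by
    rw [← hdy]
    have : (K.basis nK).coord f (D.vert k) = 1 / 3 := by linarith
    rw [this]
    ring
  have hthird' : (3 : ℤ) * z k f = 2 ^ m := by exact_mod_cast hthird
  have h3 : (3 : ℤ) ∣ 2 ^ m := ⟨_, hthird'.symm⟩
  have h4 : (3 : ℤ) ∣ 2 := Int.prime_three.dvd_of_dvd_pow h3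
  norm_num at h4

theorem sideBubble_trace_eq (hd : d = 2 ∨ d = 3) (hM : IsTriangulation Ω M)
    (hM' : IsTriangulation Ω M') (href : ∀ D ∈ M', ∃ K ∈ M, ∃ m, K.IsDescendant m D) (hK : K ∈ M)
    (hK' : K' ∈ M) (hg : ∀ D ∈ M', ∀ m, K.IsDescendant m D → nBisect d ≤ m)
    (hg' : ∀ D ∈ M', ∀ m, K'.IsDescendant m D → nBisect d ≤ m) {i j : Fin (d + 1)}
    (hS : K'.sideVert j = K.sideVert i) {x : E d}
    (hx : (K.basis (hM.nondegenerate K hK)).coord i x = 0) :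
    bubble (sideForms d K.type i) ((K.basis (hM.nondegenerate K hK)).coords x) =
      bubble (sideForms d K'.type j) ((K'.basis (hM.nondegenerate K' hK')).coords x) := by
  have nK := hM.nondegenerate K hK
  have nK' := hM.nondegenerate K' hK'
  have hx' : (K'.basis nK').coord j x = 0 := by rw [coord_opposite nK nK' hS, hx, mul_zero]
  rcases hd with rfl | rfl
  · obtain ⟨a, b, hai, hbi, hab⟩ := exists_other_two i
    obtain ⟨a', haj, ha⟩ := exists_match hS hai
    obtain ⟨b', hbj, hb⟩ := exists_match hS hbi
    have hab' : a' ≠ b' := by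
      rintro rfl
      exact hab (nK.injective (ha.symm.trans hb))
    rw [sideBubble_trace_two K.type i a b hai hbi hab _ hx,
      sideBubble_trace_two K'.type j a' b' haj hbj hab' _ hx']
    simp only [AffineBasis.coords_apply, coord_match nK nK' hS ha hx, coord_match nK nK' hS hb hx]
  · have hap := apex_match hM hM' href hK hK' hg hg' hS
    obtain ⟨a, b, hai, hbi, hac, hbc, hab⟩ := exists_other_three i _ (apex_ne K.type i)
    obtain ⟨a', haj, ha⟩ := exists_match hS hai
    obtain ⟨b', hbj, hb⟩ := exists_match hS hbi
    have hab' : a' ≠ b' := by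
      rintro rfl
      exact hab (nK.injective (ha.symm.trans hb))
    have hac' : a' ≠ apex K'.type j := by
      rintro rfl
      exact hac (nK.injective (ha.symm.trans hap))
    have hbc' : b' ≠ apex K'.type j := by
      rintro rfl
      exact hbc (nK.injective (hb.symm.trans hap))
    rw [sideBubble_trace_three K.type i a b hai hbi hac hbc hab _ hx,
      sideBubble_trace_three K'.type j a' b' haj hbj hac' hbc' hab' _ hx']
    simp only [AffineBasis.coords_apply, coord_match nK nK' hS ha hx, coord_match nK nK' hS hb hx,
      coord_match nK nK' hS hap hx]

end

section

/-! ### Testing with Lipschitz functions -/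

variable {Ω : Set (E d)} {M M' N : Finset (LSimplex d)}

theorem memLp_lipschitz {v : E d → ℝ} {C : ℝ≥0} (hv : LipschitzWith C v)
    (hvc : HasCompactSupport v) : MemLp v 2 (volume : Measure (E d)) ∧
      MemLp (gradient v) 2 (volume : Measure (E d)) := by
  obtain ⟨B, hB⟩ := hv.continuous.bounded_above_of_compact_support hvc
  obtain ⟨R, hR⟩ := hvc.isCompact.isBounded.subset_closedBall 0
  have hout : ∀ x : E d, R < ‖x‖ → x ∉ tsupport v := fun x hx h => by
    have := hR h
    rw [mem_closedBall_zero_iff] at this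
    linarith
  refine ⟨memLp_of_bound_of_eq_zero hv.continuous.aestronglyMeasurable hB fun x hx =>
    image_eq_zero_of_notMem_tsupport (hout x hx), memLp_of_bound_of_eq_zero (R := R)
    (measurable_gradient v).aestronglyMeasurable (norm_gradient_le hv) fun x hx => ?_⟩
  exact gradient_eq_zero_of_eventuallyEq (notMem_tsupport_iff_eventuallyEq.1 (hout x hx))

/-- The union of the interiors of the elements of `N`. -/
def openPatch (N : Finset (LSimplex d)) : Set (E d) := ⋃ K ∈ N, interior K.carrier

theorem isOpen_openPatch (N : Finset (LSimplex d)) : IsOpen (openPatch N) :=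
  isOpen_biUnion fun _ _ => isOpen_interior

theorem mem_openPatch {N : Finset (LSimplex d)} {x : E d} :
    x ∈ openPatch N ↔ ∃ K ∈ N, x ∈ interior K.carrier := by
  simp [openPatch]

theorem ae_mem_openPatch (N : Finset (LSimplex d)) :
    ∀ᵐ x, (∃ K ∈ N, x ∈ K.carrier) → x ∈ openPatch N := by
  have h : ∀ᵐ x, ∀ K ∈ N, x ∈ K.carrier → x ∈ interior K.carrier := by
    refine (ae_ball_iff N.countable_toSet).2 fun K _ => ?_
    filter_upwards [K.interior_ae_eq.mem_iff] with x hx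
    exact hx.2
  filter_upwards [h] with x hx
  rintro ⟨K, hK, hxK⟩
  exact mem_openPatch.2 ⟨K, hK, hx K hK hxK⟩

theorem setIntegral_openPatch (hM : IsTriangulation Ω M) (hN : N ⊆ M) {f : E d → ℝ}
    (hf : IntegrableOn f (openPatch N)) :
    ∫ x in openPatch N, f x = ∑ K ∈ N, ∫ x in K.carrier, f x := by
  rw [openPatch, integral_biUnion_finset N (fun K _ => isOpen_interior.measurableSet)]
  · exact Finset.sum_congr rfl fun K _ => by rw [K.restrict_interior]
  · intro K hK K' hK' hne
    rw [Function.onFun, Set.disjoint_left]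
    intro x hx hx'
    exact hM.notMem_of_mem_interior (hN hK) (hN hK') hne hx (interior_subset hx')
  · exact fun K hK => hf.mono_set (Set.subset_biUnion_of_mem (u := fun K : LSimplex d =>
      interior K.carrier) hK)

theorem integral_eq_sum (hM : IsTriangulation Ω M) (hN : N ⊆ M) {f : E d → ℝ} (hf : Integrable f)
    (h0 : ∀ᵐ x, x ∉ openPatch N → f x = 0) : ∫ x, f x = ∑ K ∈ N, ∫ x in K.carrier, f x := by
  rw [← setIntegral_openPatch hM hN hf.integrableOn]
  exact (setIntegral_eq_integral_of_ae_compl_eq_zero h0).symm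

theorem ae_eq_zero_off_openPatch {v : E d → ℝ} {C : ℝ≥0} (hv : LipschitzWith C v)
    (hvN : ∀ x, v x ≠ 0 → ∃ K ∈ N, x ∈ K.carrier) :
    ∀ᵐ x, x ∉ openPatch N → v x = 0 ∧ gradient v x = 0 := by
  filter_upwards [ae_mem_openPatch N, ae_gradient_eq_zero hv] with x h1 h2 hx
  have h3 : v x = 0 := by
    by_contra h
    exact hx (h1 (hvN x h))
  exact ⟨h3, h2 h3⟩

theorem l2norm_sq_eq_sum (hM : IsTriangulation Ω M) (hN : N ⊆ M) {v : E d → ℝ} {C : ℝ≥0}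
    (hv : LipschitzWith C v) (hvc : HasCompactSupport v)
    (hvN : ∀ x, v x ≠ 0 → ∃ K ∈ N, x ∈ K.carrier) :
    l2norm volume v ^ 2 = ∑ K ∈ N, ∫ x in K.carrier, v x ^ 2 ∧
      l2norm volume (gradient v) ^ 2 = ∑ K ∈ N, ∫ x in K.carrier, ‖gradient v x‖ ^ 2 := by
  obtain ⟨h1, h2⟩ := memLp_lipschitz hv hvc
  have h0 := ae_eq_zero_off_openPatch hv hvN
  constructor
  · rw [l2norm_sq h1, ← integral_eq_sum hM hN h1.integrable_sq]
    · simp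
    · exact h0.mono fun x hx hxN => by rw [(hx hxN).1]; simp
  · rw [l2norm_sq h2, ← integral_eq_sum hM hN h2.norm.integrable_sq]
    exact h0.mono fun x hx hxN => by rw [(hx hxN).2]; simp

/-- The set where `v` is nonzero is open and contained in `closure Ω`, hence in its interior, which
is `Ω`. -/
theorem support_subset_of_patch (hΩ : IsOpen Ω) (hlip : HasLipschitzBoundary Ω)
    (hM : IsTriangulation Ω M) (hN : N ⊆ M) {v : E d → ℝ} (hv : Continuous v)
    (hvN : ∀ x, v x ≠ 0 → ∃ K ∈ N, x ∈ K.carrier) : Function.support v ⊆ Ω := by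
  rw [← interior_closure_eq hΩ hlip]
  refine interior_maximal (fun x hx => ?_) (isOpen_ne_fun hv continuous_const)
  obtain ⟨K, hK, hxK⟩ := hvN x hx
  exact hM.carrier_subset (hN hK) hxK

/-- An element of the refinement inside the patch has an ancestor of generation exactly `n`, on
which `v` is a polynomial. On the elements descending from other parents `v` vanishes almost
everywhere. -/
theorem mem_feSpace_of_lipschitz (hΩ : IsOpen Ω) (hlip : HasLipschitzBoundary Ω)
    (hM : IsTriangulation Ω M) (href : ∀ D ∈ M', ∃ K ∈ M, ∃ m, K.IsDescendant m D)
    (hN : N ⊆ M) {n : ℕ} (hg : ∀ K ∈ N, ∀ D ∈ M', ∀ m, K.IsDescendant m D → n ≤ m)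
    {v : E d → ℝ} {C : ℝ≥0} (hv : LipschitzWith C v) (hvc : HasCompactSupport v)
    (hvN : ∀ x, v x ≠ 0 → ∃ K ∈ N, x ∈ K.carrier) {ℓ : ℕ}
    (hpoly : ∀ K ∈ N, ∀ D, K.IsDescendant n D → ∃ f ∈ polyFun d ℓ, ∀ x ∈ D.carrier, v x = f x)
    {p : L2Pair d} (hp1 : (p.1 : E d → ℝ) =ᵐ[volume] v)
    (hp2 : (p.2 : E d → E d) =ᵐ[volume] gradient v) : p ∈ feSpace Ω ℓ M' := by
  refine ⟨repH10_of_lipschitz hΩ hv hvc (support_subset_of_patch hΩ hlip hM hN hv.continuous hvN)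
    p hp1 hp2, fun D hD => ?_⟩
  obtain ⟨K, hK, m, hm⟩ := href D hD
  by_cases hKN : K ∈ N
  · obtain ⟨D₁, h1, h2⟩ := hm.exists_intermediate (hg K hKN D hD m hm)
    obtain ⟨f, hf, hfe⟩ := hpoly K hKN D₁ h1
    obtain ⟨q, hq, rfl⟩ := mem_polyFun.1 hf
    refine ⟨q, hq, ?_⟩
    filter_upwards [ae_restrict_of_ae hp1, ae_restrict_mem D.isCompact_carrier.measurableSet]
      with x hx hxD
    rw [hx, hfe x (h2.carrier_subset hxD)]
  · refine ⟨0, by simp, ?_⟩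
    have hsub := (hm.carrier_subset)
    filter_upwards [ae_restrict_of_ae hp1, ae_restrict_mem D.isCompact_carrier.measurableSet,
      ae_restrict_of_ae K.interior_ae_eq.mem_iff] with x hx hxD hxK
    rw [hx]
    have : v x = 0 := by
      by_contra h
      obtain ⟨K', hK', hx'⟩ := hvN x h
      refine hM.notMem_of_mem_interior hK (hN hK') ?_ (hxK.2 (hsub hxD)) hx'
      rintro rfl
      exact hKN hK'
    rw [this]
    simp [pval]

theorem continuousOn_openPatch {A : E d → Matrix (Fin d) (Fin d) ℝ} (hA : IsAligned M A)
    (hN : N ⊆ M) (i j : Fin d) : ContinuousOn (fun x => A x i j) (openPatch N) := by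
  intro x hx
  obtain ⟨K, hK, hxK⟩ := mem_openPatch.1 hx
  obtain ⟨L, hL⟩ := hA K (hN hK) i j
  exact (hL.continuousOn.continuousAt (isOpen_interior.mem_nhds hxK)).continuousWithinAt

/-- Measurability of the coefficient comes from its continuity inside the elements. This is the
reason for working with the union of the interiors, which differs from the patch by a null set. -/
theorem integrable_aForm {A : E d → Matrix (Fin d) (Fin d) ℝ} {a₁ a₂ : ℝ} (ha₁ : 0 < a₁)
    (hAe : IsUniformlyElliptic Ω A a₁ a₂) (hA : IsAligned M A) (hN : N ⊆ M)
    (hNΩ : openPatch N ⊆ Ω) {ξ η : E d → E d} (hξ : MemLp ξ 2 (volume.restrict (openPatch N)))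
    (hη : MemLp η 2 (volume.restrict (openPatch N))) :
    IntegrableOn (fun x => (A x).mulVec (ξ x).ofLp ⬝ᵥ (η x).ofLp) (openPatch N) := by
  have hc : ∀ (ζ : E d → E d), MemLp ζ 2 (volume.restrict (openPatch N)) → ∀ j,
      AEStronglyMeasurable (fun x => ζ x j) (volume.restrict (openPatch N)) := fun ζ hζ j =>
    (EuclideanSpace.proj j : E d →L[ℝ] ℝ).continuous.comp_aestronglyMeasurable hζ.1
  refine Integrable.mono' (g := fun x => |a₂| * (‖ξ x‖ * ‖η x‖))
    ((hξ.norm.integrable_mul hη.norm).const_mul _) ?_ ?_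
  · simp only [dotProduct, Matrix.mulVec]
    refine Finset.aestronglyMeasurable_fun_sum _ fun i _ => ?_
    refine AEStronglyMeasurable.mul ?_ (hc η hη i)
    refine Finset.aestronglyMeasurable_fun_sum _ fun j _ => ?_
    exact ((continuousOn_openPatch hA hN i j).aestronglyMeasurable
      (isOpen_openPatch N).measurableSet).mul (hc ξ hξ j)
  · filter_upwards [ae_restrict_mem (isOpen_openPatch N).measurableSet] with x hx
    exact abs_mulVec_dotProduct_le ha₁ hAe (hNΩ hx) _ _

theorem integrable_bForm {B : E d → ℝ} (hB : AEMeasurable B (volume.restrict Ω)) {b₂ : ℝ}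
    (hb : ∀ x ∈ Ω, |B x| ≤ b₂) (hNΩ : openPatch N ⊆ Ω) {f g : E d → ℝ}
    (hf : MemLp f 2 (volume.restrict (openPatch N)))
    (hg : MemLp g 2 (volume.restrict (openPatch N))) :
    IntegrableOn (fun x => B x * f x * g x) (openPatch N) := by
  refine Integrable.mono' (g := fun x => b₂ * (‖f x‖ * ‖g x‖))
    ((hf.norm.integrable_mul hg.norm).const_mul _) ?_ ?_
  · exact ((hB.mono_measure (Measure.restrict_mono hNΩ le_rfl)).aestronglyMeasurable.mul
      hf.1).mul hg.1
  · filter_upwards [ae_restrict_mem (isOpen_openPatch N).measurableSet] with x hx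
    rw [norm_mul, norm_mul, mul_assoc]
    exact mul_le_mul_of_nonneg_right (hb x (hNΩ hx)) (by positivity)

theorem localPoly_spec {ℓ : ℕ} {u : L2Pair d} (hu : u ∈ feSpace Ω ℓ M) {K : LSimplex d}
    (hK : K ∈ M) : (u.1 : E d → ℝ) =ᵐ[volume.restrict K.carrier] pval (localPoly u K) := by
  obtain ⟨p, -, hp⟩ := hu.2 K hK
  exact Classical.epsilon_spec
    (p := fun p => (u.1 : E d → ℝ) =ᵐ[volume.restrict K.carrier] pval p) ⟨p, hp⟩

/-- The test function is admissible in the equation for `w`. Subtracting that equation leaves only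
the errors `w - u` and `μ w - λ u` on the support of `v`, to which Cauchy–Schwarz applies.
Subsequent bounds result from choosing `v`. -/
theorem abs_residual_le (hΩ : IsOpen Ω) (hlip : HasLipschitzBoundary Ω)
    (hM : IsTriangulation Ω M) (href : ∀ D ∈ M', ∃ K ∈ M, ∃ m, K.IsDescendant m D)
    {A : E d → Matrix (Fin d) (Fin d) ℝ} {a₁ a₂ : ℝ} (ha₁ : 0 < a₁)
    (hAe : IsUniformlyElliptic Ω A a₁ a₂) (hA : IsAligned M A)
    {B : E d → ℝ} (hB : AEMeasurable B (volume.restrict Ω)) {b₂ : ℝ} (hb0 : 0 ≤ b₂)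
    (hb : ∀ x ∈ Ω, |B x| ≤ b₂)
    (hN : N ⊆ M) {n : ℕ} (hg : ∀ K ∈ N, ∀ D ∈ M', ∀ m, K.IsDescendant m D → n ≤ m)
    {ℓ : ℕ} {u w : L2Pair d} (hu : u ∈ feSpace Ω ℓ M) {lam μ : ℝ} {W : Submodule ℝ (L2Pair d)}
    (hW : feSpace Ω ℓ M' ≤ W) (hw : IsGalerkinEigenpair Ω A B W μ w)
    {P : Set (E d)} (hP : openPatch N ⊆ P)
    {v : E d → ℝ} {C : ℝ≥0} (hv : LipschitzWith C v) (hvc : HasCompactSupport v)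
    (hvN : ∀ x, v x ≠ 0 → ∃ K ∈ N, x ∈ K.carrier)
    (hpoly : ∀ K ∈ N, ∀ D, K.IsDescendant n D → ∃ f ∈ polyFun d ℓ, ∀ x ∈ D.carrier, v x = f x) :
    |∑ K ∈ N, ∫ x in K.carrier, ((A x).mulVec (pgrad (localPoly u K) x) ⬝ᵥ (gradient v x).ofLp
        - lam * (B x * pval (localPoly u K) x * v x))| ≤
      |a₂| * (l2norm (volume.restrict P) (w.2 - u.2) * l2norm volume (gradient v)) +
        b₂ * (l2norm (volume.restrict P) (μ • w.1 - lam • u.1) * l2norm volume v) := by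
  obtain ⟨hv1, hv2⟩ := memLp_lipschitz hv hvc
  set U := openPatch N with hU
  have hUm : MeasurableSet U := (isOpen_openPatch N).measurableSet
  have hUΩ : U ⊆ Ω := by
    intro x hx
    obtain ⟨K, hK, hxK⟩ := mem_openPatch.1 hx
    exact hM.interior_subset hΩ hlip (hN hK) hxK
  let p : L2Pair d := (hv1.toLp v, hv2.toLp (gradient v))
  have hp1 : (p.1 : E d → ℝ) =ᵐ[volume] v := hv1.coeFn_toLp
  have hp2 : (p.2 : E d → E d) =ᵐ[volume] gradient v := hv2.coeFn_toLp
  have hpW : p ∈ W :=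
    hW (mem_feSpace_of_lipschitz hΩ hlip hM href hN hg hv hvc hvN hpoly hp1 hp2)
  have heig := hw.2.1 p hpW
  have hoff := ae_eq_zero_off_openPatch hv hvN
  have ha : aForm Ω A w p = ∫ x in U, (A x).mulVec (w.2 x).ofLp ⬝ᵥ (gradient v x).ofLp := by
    rw [aForm, ← setIntegral_eq_of_subset_of_ae_sdiff_eq_zero hΩ.measurableSet.nullMeasurableSet
      hUΩ (f := fun x => (A x).mulVec (w.2 x).ofLp ⬝ᵥ (gradient v x).ofLp)]
    · refine integral_congr_ae (ae_restrict_of_ae ?_)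
      filter_upwards [hp2] with x hx
      rw [hx]
    · filter_upwards [hoff] with x hx hxd
      rw [(hx hxd.2).2]
      simp
  have hbf : bForm Ω B w p = ∫ x in U, B x * w.1 x * v x := by
    rw [bForm, ← setIntegral_eq_of_subset_of_ae_sdiff_eq_zero hΩ.measurableSet.nullMeasurableSet
      hUΩ (f := fun x => B x * w.1 x * v x)]
    · refine integral_congr_ae (ae_restrict_of_ae ?_)
      filter_upwards [hp1] with x hx
      rw [hx]
    · filter_upwards [hoff] with x hx hxd
      rw [(hx hxd.2).1]
      simp
  rw [ha, hbf] at heig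
  have mv := hv1.mono_measure (Measure.restrict_le_self (s := U))
  have mgv := hv2.mono_measure (Measure.restrict_le_self (s := U))
  have mem2 : ∀ f : Lp (E d) 2 (volume : Measure (E d)), MemLp f 2 (volume.restrict U) := fun f =>
    (Lp.memLp f).mono_measure Measure.restrict_le_self
  have mem1 : ∀ f : Lp ℝ 2 (volume : Measure (E d)), MemLp f 2 (volume.restrict U) := fun f =>
    (Lp.memLp f).mono_measure Measure.restrict_le_self
  have ia := fun f : Lp (E d) 2 (volume : Measure (E d)) =>
    integrable_aForm ha₁ hAe hA hN hUΩ (mem2 f) mgv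
  have ib := fun f : Lp ℝ 2 (volume : Measure (E d)) => integrable_bForm hB hb hUΩ (mem1 f) mv
  have hsum : ∑ K ∈ N, ∫ x in K.carrier, ((A x).mulVec (pgrad (localPoly u K) x) ⬝ᵥ
        (gradient v x).ofLp - lam * (B x * pval (localPoly u K) x * v x)) =
      ∫ x in U, ((A x).mulVec (u.2 x).ofLp ⬝ᵥ (gradient v x).ofLp - lam * (B x * u.1 x * v x)) := by
    have hi : IntegrableOn (fun x => (A x).mulVec (u.2 x).ofLp ⬝ᵥ (gradient v x).ofLp
        - lam * (B x * u.1 x * v x)) (openPatch N) := (ia u.2).sub ((ib u.1).const_mul lam)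
    rw [setIntegral_openPatch hM hN hi]
    refine Finset.sum_congr rfl fun K hK => ?_
    have hq := localPoly_spec hu (hN hK)
    have hq' := hq
    rw [← K.restrict_interior] at hq'
    have hq2 := ae_snd_eq_pgrad isOpen_interior hu.1 _ hq'
    rw [K.restrict_interior] at hq2
    refine integral_congr_ae ?_
    filter_upwards [hq, hq2] with x h1 h2
    rw [h1, h2]
  -- By `heig` the terms `∫ A∇w·∇v` and `μ ∫ B w v` are equal, so they may be inserted with opposite
  -- signs.
  have hsplit : ∫ x in U, ((A x).mulVec (u.2 x).ofLp ⬝ᵥ (gradient v x).ofLp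
        - lam * (B x * u.1 x * v x)) =
      -(∫ x in U, (A x).mulVec ((w.2 - u.2 : Lp (E d) 2 (volume : Measure (E d))) x).ofLp ⬝ᵥ
        (gradient v x).ofLp) +
      ∫ x in U, B x * (μ • w.1 - lam • u.1 : Lp ℝ 2 (volume : Measure (E d))) x * v x := by
    have e1 : ∫ x in U, (A x).mulVec ((w.2 - u.2 : Lp (E d) 2 (volume : Measure (E d))) x).ofLp ⬝ᵥ
        (gradient v x).ofLp = (∫ x in U, (A x).mulVec (w.2 x).ofLp ⬝ᵥ (gradient v x).ofLp) -
        ∫ x in U, (A x).mulVec (u.2 x).ofLp ⬝ᵥ (gradient v x).ofLp := by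
      rw [← integral_sub (ia w.2) (ia u.2)]
      refine integral_congr_ae (ae_restrict_of_ae ?_)
      filter_upwards [Lp.coeFn_sub w.2 u.2] with x hx
      rw [hx, Pi.sub_apply, WithLp.ofLp_sub, Matrix.mulVec_sub, sub_dotProduct]
    have e2 : ∫ x in U, B x * (μ • w.1 - lam • u.1 : Lp ℝ 2 (volume : Measure (E d))) x * v x =
        μ * (∫ x in U, B x * w.1 x * v x) - lam * ∫ x in U, B x * u.1 x * v x := by
      rw [← integral_const_mul, ← integral_const_mul,
        ← integral_sub ((ib w.1).const_mul μ) ((ib u.1).const_mul lam)]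
      refine integral_congr_ae (ae_restrict_of_ae ?_)
      filter_upwards [Lp.coeFn_sub (μ • w.1) (lam • u.1), Lp.coeFn_smul μ w.1,
        Lp.coeFn_smul lam u.1] with x hx h1 h2
      rw [hx, Pi.sub_apply, h1, h2]
      simp only [Pi.smul_apply, smul_eq_mul]
      ring
    rw [integral_sub (ia u.2) ((ib u.1).const_mul lam), integral_const_mul, e1, e2, heig]
    ring
  rw [hsum, hsplit]
  have hle : (volume : Measure (E d)).restrict U ≤ volume.restrict P :=
    Measure.restrict_mono hP le_rfl
  have f1 := abs_integral_le_l2norm (c := |a₂|) (mem2 (w.2 - u.2)) mgv (abs_nonneg _)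
    (H := fun x => (A x).mulVec ((w.2 - u.2 : Lp (E d) 2 (volume : Measure (E d))) x).ofLp ⬝ᵥ
        (gradient v x).ofLp) (by
      filter_upwards [ae_restrict_mem hUm] with x hx
      exact abs_mulVec_dotProduct_le ha₁ hAe (hUΩ hx) _ _)
  have f2 := abs_integral_le_l2norm (c := b₂) (mem1 (μ • w.1 - lam • u.1)) mv hb0
    (H := fun x => B x * (μ • w.1 - lam • u.1 : Lp ℝ 2 (volume : Measure (E d))) x * v x) (by
      filter_upwards [ae_restrict_mem hUm] with x hx
      rw [abs_mul, abs_mul, mul_assoc]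
      exact mul_le_mul_of_nonneg_right (hb x (hUΩ hx)) (by positivity))
  have g1 := l2norm_mono_measure hle ((Lp.memLp (w.2 - u.2)).mono_measure
    (Measure.restrict_le_self (s := P)))
  have g2 := l2norm_mono_measure hle ((Lp.memLp (μ • w.1 - lam • u.1)).mono_measure
    (Measure.restrict_le_self (s := P)))
  have g3 := l2norm_mono_measure (Measure.restrict_le_self (s := U)) hv1
  have g4 := l2norm_mono_measure (Measure.restrict_le_self (s := U)) hv2
  refine (abs_add_le _ _).trans (add_le_add ?_ ?_)
  · rw [abs_neg]
    refine f1.trans ?_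
    have := l2norm_nonneg (ν := volume.restrict U) (gradient v)
    have := l2norm_nonneg (ν := volume.restrict P) (w.2 - u.2 : Lp (E d) 2 (volume : Measure (E d)))
    gcongr
  · refine f2.trans ?_
    have := l2norm_nonneg (ν := volume.restrict U) v
    have := l2norm_nonneg (ν := volume.restrict P)
      (μ • w.1 - lam • u.1 : Lp ℝ 2 (volume : Measure (E d)))
    gcongr

end

section

/-! ### The bubble test functions -/

theorem formVal_coords_mem_polyFun (b : AffineBasis (Fin (d + 1)) ℝ (E d))
    (f : Fin (d + 1) → ℤ) : (fun x => formVal f (b.coords x)) ∈ polyFun d 1 := by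
  have h : (fun x => formVal f (b.coords x)) = ∑ j, (f j : ℝ) • ⇑(b.coord j) := by
    funext x
    simp [formVal]
  rw [h]
  exact Submodule.sum_mem _ fun j _ => Submodule.smul_mem _ _ (affineMap_mem_polyFun _)

/-- On a descendant the bubble is linear. This is why the projections use degree `ℓ - 1`, and since
`1 ≤ ℓ` the truncated subtraction is harmless. -/
theorem exists_poly_on_descendant (hd : d = 2 ∨ d = 3) {K D : LSimplex d}
    (hK : AffineIndependent ℝ K.vert) {n : ℕ} (h : K.IsDescendant n D)
    {L : List (Fin (d + 1) → ℤ)}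
    (hL : allDesc (linearOn L (2 ^ n)) n K.type (unitCoord d) = true) {ℓ : ℕ} (hℓ : 1 ≤ ℓ)
    {f : E d → ℝ} (hf : f ∈ polyFun d (ℓ - 1)) :
    ∃ g ∈ polyFun d ℓ, ∀ x ∈ D.carrier, bubble L ((K.basis hK).coords x) * f x = g x := by
  obtain ⟨F, hF⟩ := LSimplex.bubble_eq_formVal hd (K.basis hK) rfl h L hL
  refine ⟨fun x => formVal F ((K.basis hK).coords x) * f x, ?_, fun x hx => by rw [hF x hx]⟩
  have := mul_mem_polyFun (formVal_coords_mem_polyFun (K.basis hK) F) hf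
  rwa [Nat.add_sub_cancel' hℓ] at this

theorem lipschitzWith_bubble_mul (b : AffineBasis (Fin (d + 1)) ℝ (E d))
    (L : List (Fin (d + 1) → ℤ)) {g : E d → ℝ} (hg : ContDiff ℝ 1 g) (hgc : HasCompactSupport g) :
    ∃ C : ℝ≥0, LipschitzWith C fun x => bubble L (b.coords x) * g x := by
  obtain ⟨C, hC⟩ := exists_lipschitzWith_bubble b L
  exact exists_lipschitzWith_mul_contDiff (B := 1) hC
    (fun x => by rw [abs_of_nonneg (bubble_nonneg _ _)]; exact bubble_le_one _ _) hg hgc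

/-- For points on different sides, the segment meets the hyperplane `φ = 0` in a point where both
functions agree; the two Lipschitz estimates add up along the segment. -/
theorem lipschitzWith_glue {φ : E d →ᵃ[ℝ] ℝ} {g₁ g₂ : E d → ℝ} {C₁ C₂ : ℝ≥0}
    (h₁ : LipschitzWith C₁ g₁) (h₂ : LipschitzWith C₂ g₂) (h : ∀ x, φ x = 0 → g₁ x = g₂ x) :
    LipschitzWith (max C₁ C₂) fun x => if 0 ≤ φ x then g₁ x else g₂ x := by
  have h₁' := h₁.weaken (le_max_left C₁ C₂)
  have h₂' := h₂.weaken (le_max_right C₁ C₂)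
  set C := max C₁ C₂
  have key : ∀ x y, 0 ≤ φ x → φ y < 0 → dist (g₁ x) (g₂ y) ≤ C * dist x y := by
    intro x y hx hy
    set t := φ x / (φ x - φ y) with ht
    have hpos : 0 < φ x - φ y := by linarith
    have ht0 : 0 ≤ t := div_nonneg hx hpos.le
    have ht1 : t ≤ 1 := by
      rw [ht, div_le_one hpos]
      linarith
    set z := AffineMap.lineMap x y t with hz
    have hφz : φ z = 0 := by
      rw [hz, AffineMap.apply_lineMap, AffineMap.lineMap_apply_module, ht]
      simp only [smul_eq_mul]
      field_simp
      ring
    have e1 : dist x z = t * dist x y := by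
      rw [hz, dist_left_lineMap, Real.norm_eq_abs, abs_of_nonneg ht0]
    have e2 : dist z y = (1 - t) * dist x y := by
      rw [hz, dist_lineMap_right, Real.norm_eq_abs, abs_of_nonneg (by linarith)]
    calc dist (g₁ x) (g₂ y) ≤ dist (g₁ x) (g₁ z) + dist (g₁ z) (g₂ y) := dist_triangle _ _ _
      _ ≤ C * dist x z + C * dist z y := by
        rw [h z hφz] at *
        refine add_le_add ?_ (h₂'.dist_le_mul z y)
        rw [← h z hφz]
        exact h₁'.dist_le_mul x z
      _ = C * dist x y := by rw [e1, e2]; ring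
  refine LipschitzWith.of_dist_le_mul fun x y => ?_
  by_cases hx : 0 ≤ φ x <;> by_cases hy : 0 ≤ φ y
  · simp only [if_pos hx, if_pos hy]
    exact h₁'.dist_le_mul x y
  · simp only [if_pos hx, if_neg hy]
    exact key x y hx (not_le.1 hy)
  · simp only [if_neg hx, if_pos hy]
    rw [dist_comm, dist_comm x]
    exact key y x hy (not_le.1 hx)
  · simp only [if_neg hx, if_neg hy]
    exact h₂'.dist_le_mul x y

/-- The data of the local lower bound: a triangulation, a refinement of it, a finite element
function on the triangulation and a Galerkin eigenpair of a space that contains the finite element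
space of the refinement. -/
structure IsDiscreteProblem (Ω : Set (E d)) (ℓ : ℕ) (A : E d → Matrix (Fin d) (Fin d) ℝ)
    (B : E d → ℝ) (a₁ a₂ b₂ : ℝ) (M M' : Finset (LSimplex d)) (W : Submodule ℝ (L2Pair d))
    (μ : ℝ) (u w : L2Pair d) : Prop where
  dim : d = 2 ∨ d = 3
  degree : 1 ≤ ℓ
  isOpen : IsOpen Ω
  lipschitz : HasLipschitzBoundary Ω
  triangulation : IsTriangulation Ω M
  triangulation' : IsTriangulation Ω M'
  refinement : ∀ D ∈ M', ∃ K ∈ M, ∃ m, K.IsDescendant m D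
  pos : 0 < a₁
  elliptic : IsUniformlyElliptic Ω A a₁ a₂
  aligned : IsAligned M A
  measurable : AEMeasurable B (volume.restrict Ω)
  bound_nonneg : 0 ≤ b₂
  bound : ∀ x ∈ Ω, |B x| ≤ b₂
  mem : u ∈ feSpace Ω ℓ M
  le : feSpace Ω ℓ M' ≤ W
  eigenpair : IsGalerkinEigenpair Ω A B W μ w

/-- All descendants of `K` in `M'` have at least the generation `n`. -/
def IsBisected (M' : Finset (LSimplex d)) (n : ℕ) (K : LSimplex d) : Prop :=
  ∀ D ∈ M', ∀ m, K.IsDescendant m D → n ≤ m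

/-! ### The bound for the element residual -/

section Bounds

variable {Ω : Set (E d)} {ℓ : ℕ} {A : E d → Matrix (Fin d) (Fin d) ℝ} {B : E d → ℝ}
  {a₁ a₂ b₂ : ℝ} {M M' : Finset (LSimplex d)} {W : Submodule ℝ (L2Pair d)} {μ : ℝ} {u w : L2Pair d}
  {K : LSimplex d}

theorem le_of_sq_le_mul_self {s t : ℝ} (ht : 0 ≤ t) (h : s ^ 2 ≤ t * s) : s ≤ t := by
  by_contra hst
  nlinarith [not_le.1 hst]

theorem le_sqrt_mul {C g s x : ℝ} (hC : 0 ≤ C) (hg : 0 ≤ g) (hs : 0 ≤ s)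
    (h : x ^ 2 ≤ C * g ^ 2 * s ^ 2) : x ≤ √C * g * s := by
  refine le_of_sq_le_sq ?_ (by positivity)
  rw [mul_pow, mul_pow, Real.sq_sqrt hC]
  exact h

theorem isFiniteMeasure_carrier (K : LSimplex d) :
    IsFiniteMeasure ((volume : Measure (E d)).restrict K.carrier) :=
  ⟨by simpa using K.isCompact_carrier.measure_lt_top⟩

theorem IsDiscreteProblem.memLp_elemResidual
    (h : IsDiscreteProblem Ω ℓ A B a₁ a₂ b₂ M M' W μ u w) (hK : K ∈ M) (lam : ℝ) :
    MemLp (elemResidual A B lam u K) 2 (volume.restrict K.carrier) :=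
  EigenFEM.memLp_elemResidual (h.triangulation.nondegenerate K hK)
    (h.triangulation.interior_subset h.isOpen h.lipschitz hK) (h.aligned K hK) h.measurable
    h.bound lam u

/-- The test function is the element bubble times the projection `f` of the residual. The
bubble-weighted norm of `f` equals `∫ R v` minus an oscillation term, `∫ R v` is controlled by
`abs_residual_le`, and every term is linear in `‖f‖`, which is divided out. The triangle inequality
returns from `f` to the residual. -/
theorem IsDiscreteProblem.elem_bound (h : IsDiscreteProblem Ω ℓ A B a₁ a₂ b₂ M M' W μ u w)
    (hK : K ∈ M) (hg : IsBisected M' (nBisect d) K) {P : Set (E d)} (hP : K.carrier ⊆ P) {C G : ℝ}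
    (hC : 0 ≤ C)
    (hest : BubbleEstimates (ℓ - 1) C K.type (K.basis (h.triangulation.nondegenerate K hK)))
    (hG : CoordLip (K.basis (h.triangulation.nondegenerate K hK)) G) (lam : ℝ) :
    l2norm (volume.restrict K.carrier) (elemResidual A B lam u K) ≤
      C * (|a₂| * (l2norm (volume.restrict P) (w.2 - u.2) * (√C * G)) +
        b₂ * l2norm (volume.restrict P) (μ • w.1 - lam • u.1)) +
      (C + 1) * l2norm (volume.restrict K.carrier) (elemResidual A B lam u K -
        l2proj (volume.restrict K.carrier) (ℓ - 1) (elemResidual A B lam u K)) := by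
  have hd0 : 0 < d := by have := h.dim; omega
  have nK := h.triangulation.nondegenerate K hK
  haveI := isFiniteMeasure_carrier K
  have hmeas := K.isCompact_carrier.measurableSet
  have haeK : ∀ᵐ x ∂volume.restrict K.carrier, x ∈ K.carrier := ae_restrict_mem hmeas
  have hR := h.memLp_elemResidual hK lam
  set R := elemResidual A B lam u K
  have hfpoly := l2proj_mem_polyFun K.isCompact_carrier haeK (ℓ - 1) hR
  set f := l2proj (volume.restrict K.carrier) (ℓ - 1) R with hf
  have hfC : ContDiff ℝ ∞ f := contDiff_of_mem_polyFun hfpoly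
  have hf2 : MemLp f 2 (volume.restrict K.carrier) :=
    memLp_of_continuous K.isCompact_carrier haeK hfC.continuous
  set L := elemForms d K.type
  set b := K.basis nK with hb
  set v : E d → ℝ := fun x => bubble L (b.coords x) * f x with hvdef
  have hvint : ∀ x, v x ≠ 0 → ∀ j, 0 < b.coord j x := by
    intro x hx j
    exact elemBubble_pos h.dim K.type (b.coords x) (left_ne_zero_of_mul hx) j
  have hvK : ∀ x, v x ≠ 0 → x ∈ K.carrier := by
    intro x hx
    rw [LSimplex.carrier_eq nK]
    exact fun j => (hvint x hx j).le
  have hvc : HasCompactSupport v := HasCompactSupport.intro K.isCompact_carrier fun x hx => by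
    by_contra hne
    exact hx (hvK x hne)
  obtain ⟨Cv, hv⟩ : ∃ Cv : ℝ≥0, LipschitzWith Cv v := by
    obtain ⟨ψ, hψ, hψc, hψ1, -⟩ := exists_cutoff K.isCompact_carrier
    obtain ⟨Cv, hCv⟩ := lipschitzWith_bubble_mul b L
      ((hfC.mul hψ).of_le (by norm_cast : (1 : WithTop ℕ∞) ≤ ∞)) hψc.mul_left
    refine ⟨Cv, ?_⟩
    convert! hCv using 2 with x
    by_cases hx : x ∈ K.carrier
    · simp [hvdef, (hψ1 x hx).self_of_nhds]
    · have h0 : v x = 0 := by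
        by_contra hne
        exact hx (hvK x hne)
      rw [h0, ← mul_assoc]
      change _ = v x * ψ x
      rw [h0, zero_mul]
  have hvN : ∀ x, v x ≠ 0 → ∃ K' ∈ ({K} : Finset (LSimplex d)), x ∈ K'.carrier :=
    fun x hx => ⟨K, by simp, hvK x hx⟩
  have hNM : ({K} : Finset (LSimplex d)) ⊆ M := by simpa using hK
  have hres := abs_residual_le h.isOpen h.lipschitz h.triangulation h.refinement h.pos h.elliptic
    h.aligned h.measurable h.bound_nonneg h.bound hNM (n := nBisect d)
    (fun K' hK' => by rw [Finset.mem_singleton.1 hK']; exact hg) h.mem (lam := lam) h.le h.eigenpair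
    (P := P) (by
      intro x hx
      obtain ⟨K', hK', hx'⟩ := mem_openPatch.1 hx
      rw [Finset.mem_singleton.1 hK'] at hx'
      exact hP (interior_subset hx')) hv hvc hvN (by
      intro K' hK' D hD
      obtain rfl := Finset.mem_singleton.1 hK'
      exact exists_poly_on_descendant h.dim nK hD (allDesc_elemForms h.dim _) h.degree hfpoly)
  rw [Finset.sum_singleton, integral_parts_elem nK hd0
    (h.triangulation.interior_subset h.isOpen h.lipschitz hK) (h.aligned K hK) h.measurable h.bound
    lam u 0 hv hvc (fun x _ hx => hvK x hx)] at hres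
  -- The choice of the side `0` is immaterial, since `v` vanishes on all sides.
  have hflux : ∫ x, flux A u K 0 x * v x ∂sideMeasure K 0 = 0 := by
    rw [LSimplex.sideMeasure_eq nK]
    refine integral_eq_zero_of_ae ?_
    filter_upwards [ae_faceMeasure (K.basis nK)] with x hx
    have : v x = 0 := by
      by_contra hne
      exact (hvint x hne 0).ne' hx.1
    simp [this]
  rw [hflux, add_zero] at hres
  obtain ⟨n1, n2⟩ := l2norm_sq_eq_sum h.triangulation hNM hv hvc hvN
  rw [Finset.sum_singleton] at n1 n2
  obtain ⟨⟨e1, e2⟩, -⟩ := hest G hG f hfpoly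
  rw [LSimplex.hull_basis] at e1 e2
  set r := l2norm (volume.restrict K.carrier) f with hr
  have hr0 : 0 ≤ r := l2norm_nonneg f
  have hr2 : r ^ 2 = ∫ x in K.carrier, f x ^ 2 := by
    rw [hr, l2norm_sq hf2]
    simp
  have hvr : l2norm volume v ≤ r := by
    refine le_of_sq_le_sq ?_ hr0
    rw [n1, hr2]
    refine integral_mono_of_nonneg (Filter.Eventually.of_forall fun x => sq_nonneg _)
      hf2.integrable_sq (Filter.Eventually.of_forall fun x => ?_)
    simp only [hvdef, mul_pow]
    refine mul_le_of_le_one_left (sq_nonneg _) ?_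
    exact pow_le_one₀ (bubble_nonneg _ _) (bubble_le_one _ _)
  have hgr : l2norm volume (gradient v) ≤ √C * G * r := by
    refine le_sqrt_mul hC hG.1 hr0 ?_
    rw [n2, hr2]
    exact e2
  have hv2 : MemLp v 2 (volume.restrict K.carrier) :=
    (memLp_lipschitz hv hvc).1.mono_measure Measure.restrict_le_self
  have hvr' : l2norm (volume.restrict K.carrier) v ≤ r :=
    (l2norm_mono_measure Measure.restrict_le_self (memLp_lipschitz hv hvc).1).trans hvr
  have hosc := abs_integral_le_l2norm (c := 1) (hR.sub hf2) hv2 zero_le_one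
    (H := fun x => (R x - f x) * v x) (Filter.Eventually.of_forall fun x => by
      rw [abs_mul, one_mul]
      rfl)
  have hid : ∫ x in K.carrier, bubble L (b.coords x) * f x ^ 2 =
      (∫ x in K.carrier, R x * v x) - ∫ x in K.carrier, (R x - f x) * v x := by
    have i1 : Integrable (fun x => R x * v x) (volume.restrict K.carrier) := hR.integrable_mul hv2
    have i2 : Integrable (fun x => (R x - f x) * v x) (volume.restrict K.carrier) :=
      (hR.sub hf2).integrable_mul hv2
    rw [← integral_sub i1 i2]
    congr 1
    funext x
    simp only [hvdef]
    ring
  set X := l2norm (volume.restrict P) (w.2 - u.2)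
  set Y := l2norm (volume.restrict P) (μ • w.1 - lam • u.1)
  set O := l2norm (volume.restrict K.carrier) (R - f)
  have hX : 0 ≤ X := l2norm_nonneg _
  have hY : 0 ≤ Y := l2norm_nonneg _
  have hO : 0 ≤ O := l2norm_nonneg _
  have hb0 := h.bound_nonneg
  have hfinal : r ^ 2 ≤ C * (|a₂| * (X * (√C * G)) + b₂ * Y + O) * r := by
    rw [hr2]
    refine e1.trans ?_
    rw [hid, mul_assoc]
    refine mul_le_mul_of_nonneg_left ?_ hC
    have k1 := (le_abs_self _).trans hres
    have k2 := (neg_le_abs _).trans hosc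
    have k3 : |a₂| * (X * l2norm volume (gradient v)) ≤ |a₂| * (X * (√C * G * r)) := by gcongr
    have k4 : b₂ * (Y * l2norm volume v) ≤ b₂ * (Y * r) := by gcongr
    have k5 : 1 * (O * l2norm (volume.restrict K.carrier) v) ≤ O * r := by
      rw [one_mul]
      gcongr
    linarith
  have hG0 := hG.1
  have hrle := le_of_sq_le_mul_self (by positivity) hfinal
  have htri := l2norm_le_add_sub hR hf2
  linarith

end Bounds

end

section

/-! ### The bound for the jumps -/

variable {Ω : Set (E d)} {ℓ : ℕ} {A : E d → Matrix (Fin d) (Fin d) ℝ} {B : E d → ℝ}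
  {a₁ a₂ b₂ : ℝ} {M M' : Finset (LSimplex d)} {W : Submodule ℝ (L2Pair d)} {μ : ℝ} {u w : L2Pair d}
  {K K' : LSimplex d} {i j : Fin (d + 1)}

theorem sideMeasure_congr (hS : K'.sideVert j = K.sideVert i) :
    sideMeasure K' j = sideMeasure K i := by
  rw [sideMeasure, sideMeasure, LSimplex.side, LSimplex.side, hS]

/-- The two halves of the side test function. -/
def halfBubble (b : AffineBasis (Fin (d + 1)) ℝ (E d)) (t : Fin 3) (i k : Fin (d + 1))
    (f : E d → ℝ) (x : E d) : ℝ :=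
  bubble (sideForms d t i) (b.coords x) * f (sideProj b i k x)

theorem halfBubble_ne_zero (hd : d = 2 ∨ d = 3) (hK : AffineIndependent ℝ K.vert)
    {k : Fin (d + 1)} {f : E d → ℝ} {x : E d} (hx : 0 ≤ (K.basis hK).coord i x)
    (hne : halfBubble (K.basis hK) K.type i k f x ≠ 0) : x ∈ K.carrier := by
  rw [LSimplex.carrier_eq hK]
  intro l
  by_cases hl : l = i
  · rw [hl]
    exact hx
  · exact (sideBubble_pos hd K.type i _ hx (left_ne_zero_of_mul hne) l hl).le

theorem integral_halfBubble_sq_le (hK : AffineIndependent ℝ K.vert) {k : Fin (d + 1)} {f : E d → ℝ}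
    (hf : Continuous f) : ∫ x in K.carrier, halfBubble (K.basis hK) K.type i k f x ^ 2 ≤
      ∫ x in K.carrier, f (sideProj (K.basis hK) i k x) ^ 2 := by
  have hc : Continuous fun x => f (sideProj (K.basis hK) i k x) ^ 2 :=
    (hf.comp (continuous_sideProj (K.basis hK))).pow 2
  refine integral_mono_of_nonneg (Filter.Eventually.of_forall fun x => sq_nonneg _)
    (hc.continuousOn.integrableOn_compact K.isCompact_carrier)
    (Filter.Eventually.of_forall fun x => ?_)
  simp only [halfBubble, mul_pow]
  exact mul_le_of_le_one_left (sq_nonneg _) (pow_le_one₀ (bubble_nonneg _ _) (bubble_le_one _ _))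

/-- Gradients depend on neighbourhoods, while the glued test function agrees with each half only on
a closed half-space. Passing to the interior of the element resolves this. -/
theorem integral_congr_interior {v g : E d → ℝ}
    (h : ∀ x ∈ interior K.carrier, v =ᶠ[𝓝 x] g) :
    ∫ x in K.carrier, v x ^ 2 = ∫ x in K.carrier, g x ^ 2 ∧
      ∫ x in K.carrier, ‖gradient v x‖ ^ 2 = ∫ x in K.carrier, ‖gradient g x‖ ^ 2 := by
  rw [← K.restrict_interior]
  constructor
  · refine setIntegral_congr_fun isOpen_interior.measurableSet fun x hx => ?_
    simp only [(h x hx).self_of_nhds]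
  · refine setIntegral_congr_fun isOpen_interior.measurableSet fun x hx => ?_
    simp only [gradient_congr (h x hx)]

theorem IsDiscreteProblem.memLp_jump (h : IsDiscreteProblem Ω ℓ A B a₁ a₂ b₂ M M' W μ u w)
    (hK : K ∈ M) (hK' : K' ∈ M) (hne : K ≠ K') (hS : K'.sideVert j = K.sideVert i) :
    MemLp (jump A M u K i) 2 (sideMeasure K i) ∧
    ∀ v : E d → ℝ, Continuous v →
      Integrable (fun x => flux A u K i x * v x) (sideMeasure K i) ∧
      Integrable (fun x => flux A u K' j x * v x) (sideMeasure K i) := by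
  have hd0 : 0 < d := by have := h.dim; omega
  have nK := h.triangulation.nondegenerate K hK
  have nK' := h.triangulation.nondegenerate K' hK'
  haveI : IsFiniteMeasure (sideMeasure K i) := by
    rw [LSimplex.sideMeasure_eq nK]
    exact isFiniteMeasure_faceMeasure _ hd0 i
  have hae : ∀ᵐ x ∂sideMeasure K i, x ∈ K.carrier := by
    rw [LSimplex.sideMeasure_eq nK]
    exact (ae_faceMeasure (K.basis nK)).mono fun x hx => hx.2
  have hae' : ∀ᵐ x ∂sideMeasure K i, x ∈ K'.carrier := by
    rw [← sideMeasure_congr hS, LSimplex.sideMeasure_eq nK']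
    exact (ae_faceMeasure (K'.basis nK')).mono fun x hx => hx.2
  obtain ⟨Φ, hΦ, hΦe⟩ := exists_continuous_flux nK (h.aligned K hK) u i
  obtain ⟨Φ', hΦ', hΦe'⟩ := exists_continuous_flux nK' (h.aligned K' hK') u j
  have hinteg : ∀ g : E d → ℝ, Continuous g → Integrable g (sideMeasure K i) := by
    intro g hg
    rw [LSimplex.sideMeasure_eq nK]
    exact integrable_faceMeasure _ hd0 hg
  refine ⟨?_, fun v hv => ⟨?_, ?_⟩⟩
  · refine (memLp_congr_ae ?_).1 (memLp_of_continuous K.isCompact_carrier hae (hΦ.add hΦ'))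
    filter_upwards [hae, hae'] with x hx hx'
    rw [jump_eq hd0 h.triangulation hK hK' hne hS, hΦe x hx, hΦe' x hx', Pi.add_apply]
  · refine (integrable_congr ?_).1 (hinteg _ (hΦ.mul hv))
    filter_upwards [hae] with x hx
    rw [hΦe x hx, Pi.mul_apply]
  · refine (integrable_congr ?_).1 (hinteg _ (hΦ'.mul hv))
    filter_upwards [hae'] with x hx
    rw [hΦe' x hx, Pi.mul_apply]

/-- A Lipschitz function that on two elements with a common side is a side bubble times an
extension of `f` from that side. -/
theorem IsDiscreteProblem.exists_side_test
    (h : IsDiscreteProblem Ω ℓ A B a₁ a₂ b₂ M M' W μ u w) (hK : K ∈ M) (hK' : K' ∈ M)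
    (hne : K ≠ K') (hS : K'.sideVert j = K.sideVert i) (hg : IsBisected M' (nBisect d) K)
    (hg' : IsBisected M' (nBisect d) K') {k k' : Fin (d + 1)} {f : E d → ℝ} (hf : ContDiff ℝ ∞ f) :
    ∃ v : E d → ℝ, (∃ C : ℝ≥0, LipschitzWith C v) ∧ HasCompactSupport v ∧
      (∀ x, 0 ≤ (K.basis (h.triangulation.nondegenerate K hK)).coord i x →
        v x = halfBubble (K.basis (h.triangulation.nondegenerate K hK)) K.type i k f x) ∧
      ∀ x, 0 ≤ (K'.basis (h.triangulation.nondegenerate K' hK')).coord j x →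
        v x = halfBubble (K'.basis (h.triangulation.nondegenerate K' hK')) K'.type j k' f x := by
  have hd0 : 0 < d := by have := h.dim; omega
  have nK := h.triangulation.nondegenerate K hK
  have nK' := h.triangulation.nondegenerate K' hK'
  have hneg := h.triangulation.coord_opposite_neg hd0 hK hK' hne hS
  have hopp := coord_opposite nK nK' hS
  set b := K.basis nK
  set b' := K'.basis nK'
  -- On the wrong side of the plane neither half need have bounded support. The cutoff makes both
  -- globally Lipschitz, and it equals `1` wherever a half is nonzero on its own side.
  obtain ⟨ψ, hψ, hψc, hψ1, -⟩ := exists_cutoff (K.isCompact_carrier.union K'.isCompact_carrier)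
  have hsm : ∀ (c : AffineBasis (Fin (d + 1)) ℝ (E d)) (i k : Fin (d + 1)),
      ContDiff ℝ 1 fun x => f (sideProj c i k x) * ψ x := by
    intro c i k
    have h1 : ContDiff ℝ ∞ (sideProj c i k) :=
      (⟨sideProj c i k, continuous_sideProj c⟩ : E d →ᴬ[ℝ] E d).contDiff
    exact ((hf.comp h1).mul hψ).of_le (by norm_cast)
  obtain ⟨C₁, h₁⟩ := lipschitzWith_bubble_mul b (sideForms d K.type i) (hsm b i k) hψc.mul_left
  obtain ⟨C₂, h₂⟩ := lipschitzWith_bubble_mul b' (sideForms d K'.type j) (hsm b' j k') hψc.mul_left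
  have e₁ : ∀ x, 0 ≤ b.coord i x → bubble (sideForms d K.type i) (b.coords x) *
      (f (sideProj b i k x) * ψ x) = halfBubble b K.type i k f x := by
    intro x hx
    rw [← mul_assoc]
    change halfBubble b K.type i k f x * ψ x = _
    by_cases h0 : halfBubble b K.type i k f x = 0
    · rw [h0, zero_mul]
    · rw [(hψ1 x (Or.inl (halfBubble_ne_zero h.dim nK hx h0))).self_of_nhds, mul_one]
  have e₂ : ∀ x, 0 ≤ b'.coord j x → bubble (sideForms d K'.type j) (b'.coords x) *
      (f (sideProj b' j k' x) * ψ x) = halfBubble b' K'.type j k' f x := by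
    intro x hx
    rw [← mul_assoc]
    change halfBubble b' K'.type j k' f x * ψ x = _
    by_cases h0 : halfBubble b' K'.type j k' f x = 0
    · rw [h0, zero_mul]
    · rw [(hψ1 x (Or.inr (halfBubble_ne_zero h.dim nK' hx h0))).self_of_nhds, mul_one]
  have hmatch : ∀ x, b.coord i x = 0 → bubble (sideForms d K.type i) (b.coords x) *
      (f (sideProj b i k x) * ψ x) = bubble (sideForms d K'.type j) (b'.coords x) *
      (f (sideProj b' j k' x) * ψ x) := by
    intro x hx
    have hx' : b'.coord j x = 0 := by rw [hopp, hx, mul_zero]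
    rw [sideProj_eq_self hx, sideProj_eq_self hx', sideBubble_trace_eq h.dim h.triangulation
      h.triangulation' h.refinement hK hK' hg hg' hS hx]
  refine ⟨_, ⟨_, lipschitzWith_glue (φ := b.coord i) h₁ h₂ hmatch⟩, ?_, ?_, ?_⟩
  · refine HasCompactSupport.intro hψc.isCompact fun x hx => ?_
    rw [image_eq_zero_of_notMem_tsupport hx]
    simp
  · intro x hx
    rw [if_pos hx]
    exact e₁ x hx
  · intro x hx
    rw [← e₂ x hx]
    split_ifs with h0
    -- The opposite coordinates differ by a negative factor, so both are nonnegative only on the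
    -- common plane, where the halves agree.
    · refine hmatch x ?_
      rw [hopp] at hx
      nlinarith
    · rfl

/-- The test function is the side bubble times the projected jump, extended into both elements.
After integration by parts the two fluxes add up to the jump. The element residuals appear on the
right-hand side and are bounded separately. The extension contributes `√δ` to the `L²` norm and `G *
√δ` to that of the gradient; the factor `2` under the root in `√(2 * C)` counts the elements. -/
theorem IsDiscreteProblem.side_bound (h : IsDiscreteProblem Ω ℓ A B a₁ a₂ b₂ M M' W μ u w)
    (hK : K ∈ M) (hK' : K' ∈ M) (hne : K ≠ K') (hS : K'.sideVert j = K.sideVert i)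
    (hg : IsBisected M' (nBisect d) K) (hg' : IsBisected M' (nBisect d) K')
    {P : Set (E d)} (hP : K.carrier ⊆ P) (hP' : K'.carrier ⊆ P) {C G δ : ℝ} (hC : 0 ≤ C)
    (hest : ∀ (t : Fin 3) (b : AffineBasis (Fin (d + 1)) ℝ (E d)), BubbleEstimates (ℓ - 1) C t b)
    (hG : CoordLip (K.basis (h.triangulation.nondegenerate K hK)) G)
    (hG' : CoordLip (K'.basis (h.triangulation.nondegenerate K' hK')) G)
    (hδ : Metric.diam K.carrier ≤ δ) (hδ' : Metric.diam K'.carrier ≤ δ) (lam : ℝ) :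
    l2norm (sideMeasure K i) (jump A M u K i) ≤
      C * (|a₂| * (l2norm (volume.restrict P) (w.2 - u.2) * (√(2 * C) * G * √δ)) +
        (b₂ * l2norm (volume.restrict P) (μ • w.1 - lam • u.1) +
          l2norm (volume.restrict K.carrier) (elemResidual A B lam u K) +
          l2norm (volume.restrict K'.carrier) (elemResidual A B lam u K')) * (√(2 * C) * √δ)) +
      (C + 1) * l2norm (sideMeasure K i) (jump A M u K i -
        l2proj (sideMeasure K i) (ℓ - 1) (jump A M u K i)) := by
  classical
  have hd0 : 0 < d := by have := h.dim; omega
  have nK := h.triangulation.nondegenerate K hK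
  have nK' := h.triangulation.nondegenerate K' hK'
  have hneg := h.triangulation.coord_opposite_neg hd0 hK hK' hne hS
  have hopp := coord_opposite nK nK' hS
  haveI : IsFiniteMeasure (sideMeasure K i) := by
    rw [LSimplex.sideMeasure_eq nK]
    exact isFiniteMeasure_faceMeasure _ hd0 i
  have hae : ∀ᵐ x ∂sideMeasure K i, (K.basis nK).coord i x = 0 ∧ x ∈ K.carrier := by
    rw [LSimplex.sideMeasure_eq nK]
    exact ae_faceMeasure (K.basis nK)
  obtain ⟨hJ, hfl⟩ := h.memLp_jump hK hK' hne hS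
  set J := jump A M u K i with hJdef
  have hfpoly := l2proj_mem_polyFun K.isCompact_carrier (hae.mono fun x hx => hx.2) (ℓ - 1) hJ
  set f := l2proj (sideMeasure K i) (ℓ - 1) J with hf
  have hfC : ContDiff ℝ ∞ f := contDiff_of_mem_polyFun hfpoly
  have hf2 : MemLp f 2 (sideMeasure K i) :=
    memLp_of_continuous K.isCompact_carrier (hae.mono fun x hx => hx.2) hfC.continuous
  haveI : Nontrivial (Fin (d + 1)) := Fin.nontrivial_iff_two_le.2 (by omega)
  obtain ⟨k, hk⟩ := exists_ne i
  obtain ⟨k', hk'⟩ := exists_ne j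
  obtain ⟨v, ⟨Cv, hv⟩, hvc, hv1, hv2⟩ := h.exists_side_test hK hK' hne hS hg hg' (k := k) (k' := k')
    hfC
  set b := K.basis nK with hb
  set b' := K'.basis nK' with hb'
  have hvK : ∀ x, 0 ≤ b.coord i x → v x ≠ 0 → x ∈ K.carrier := fun x hx hne0 => by
    rw [hv1 x hx] at hne0
    exact halfBubble_ne_zero h.dim nK hx hne0
  have hvK' : ∀ x, 0 ≤ b'.coord j x → v x ≠ 0 → x ∈ K'.carrier := fun x hx hne0 => by
    rw [hv2 x hx] at hne0
    exact halfBubble_ne_zero h.dim nK' hx hne0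
  have hvN : ∀ x, v x ≠ 0 → ∃ D ∈ ({K, K'} : Finset (LSimplex d)), x ∈ D.carrier := by
    intro x hx
    rcases le_total 0 (b.coord i x) with h0 | h0
    · exact ⟨K, by simp, hvK x h0 hx⟩
    · refine ⟨K', by simp, hvK' x ?_ hx⟩
      rw [hopp]
      exact mul_nonneg_of_nonpos_of_nonpos hneg.le h0
  have hNM : ({K, K'} : Finset (LSimplex d)) ⊆ M := by
    intro D hD
    rcases Finset.mem_insert.1 hD with rfl | hD
    · exact hK
    · rw [Finset.mem_singleton.1 hD]
      exact hK'
  have hpoly : ∀ D ∈ ({K, K'} : Finset (LSimplex d)), ∀ D', D.IsDescendant (nBisect d) D' →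
      ∃ f ∈ polyFun d ℓ, ∀ x ∈ D'.carrier, v x = f x := by
    intro D hD D' hD'
    rcases Finset.mem_insert.1 hD with rfl | hD
    · obtain ⟨g, hg1, hg2⟩ := exists_poly_on_descendant h.dim nK hD'
        (allDesc_sideForms h.dim D.type i) h.degree (comp_mem_polyFun hfpoly (sideProj b i k))
      refine ⟨g, hg1, fun x hx => ?_⟩
      rw [← hg2 x hx, hv1 x (LSimplex.coord_mem_Icc nK (hD'.carrier_subset hx) i).1]
      rfl
    · obtain rfl := Finset.mem_singleton.1 hD
      obtain ⟨g, hg1, hg2⟩ := exists_poly_on_descendant h.dim nK' hD'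
        (allDesc_sideForms h.dim D.type j) h.degree (comp_mem_polyFun hfpoly (sideProj b' j k'))
      refine ⟨g, hg1, fun x hx => ?_⟩
      rw [← hg2 x hx, hv2 x (LSimplex.coord_mem_Icc nK' (hD'.carrier_subset hx) j).1]
      rfl
  have hres := abs_residual_le h.isOpen h.lipschitz h.triangulation h.refinement h.pos h.elliptic
    h.aligned h.measurable h.bound_nonneg h.bound hNM (n := nBisect d)
    (fun D hD => by
      rcases Finset.mem_insert.1 hD with rfl | hD
      · exact hg
      · rw [Finset.mem_singleton.1 hD]
        exact hg') h.mem (lam := lam) h.le h.eigenpair (P := P) (by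
      intro x hx
      obtain ⟨D, hD, hx'⟩ := mem_openPatch.1 hx
      rcases Finset.mem_insert.1 hD with rfl | hD
      · exact hP (interior_subset hx')
      · rw [Finset.mem_singleton.1 hD] at hx'
        exact hP' (interior_subset hx')) hv hvc hvN hpoly
  rw [Finset.sum_pair hne,
    integral_parts_elem nK hd0 (h.triangulation.interior_subset h.isOpen h.lipschitz hK)
      (h.aligned K hK) h.measurable h.bound lam u i hv hvc hvK,
    integral_parts_elem nK' hd0 (h.triangulation.interior_subset h.isOpen h.lipschitz hK')
      (h.aligned K' hK') h.measurable h.bound lam u j hv hvc hvK', sideMeasure_congr hS] at hres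
  obtain ⟨n1, n2⟩ := l2norm_sq_eq_sum h.triangulation hNM hv hvc hvN
  rw [Finset.sum_pair hne] at n1 n2
  have hev : ∀ x ∈ interior K.carrier, v =ᶠ[𝓝 x] halfBubble b K.type i k f := by
    intro x hx
    filter_upwards [isOpen_interior.mem_nhds hx] with y hy
    exact hv1 y (LSimplex.coord_mem_Icc nK (interior_subset hy) i).1
  have hev' : ∀ x ∈ interior K'.carrier, v =ᶠ[𝓝 x] halfBubble b' K'.type j k' f := by
    intro x hx
    filter_upwards [isOpen_interior.mem_nhds hx] with y hy
    exact hv2 y (LSimplex.coord_mem_Icc nK' (interior_subset hy) j).1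
  obtain ⟨c1, c2⟩ := integral_congr_interior hev
  obtain ⟨c1', c2'⟩ := integral_congr_interior hev'
  rw [c1, c1'] at n1
  rw [c2, c2'] at n2
  obtain ⟨s1, s2, s3⟩ := (hest K.type b G hG f hfpoly).2 i k hk
  obtain ⟨-, s2', s3'⟩ := (hest K'.type b' G hG' f hfpoly).2 j k' hk'
  rw [← LSimplex.sideMeasure_eq nK] at s1 s2 s3
  rw [← LSimplex.sideMeasure_eq nK', sideMeasure_congr hS] at s2' s3'
  rw [LSimplex.hull_basis] at s2 s3 s2' s3'
  set σ := l2norm (sideMeasure K i) f with hσ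
  have hσ0 : 0 ≤ σ := l2norm_nonneg f
  have hσ2 : σ ^ 2 = ∫ x, f x ^ 2 ∂sideMeasure K i := by
    rw [hσ, l2norm_sq hf2]
    simp
  rw [← hσ2] at s1 s2 s3 s2' s3'
  have hδ0 : 0 ≤ δ := Metric.diam_nonneg.trans hδ
  have hG0 := hG.1
  have hvσ : l2norm volume v ≤ √(2 * C) * √δ * σ := by
    refine le_sqrt_mul (by positivity) (by positivity) hσ0 ?_
    rw [n1, Real.sq_sqrt hδ0]
    have k1 := (integral_halfBubble_sq_le nK (i := i) (k := k) hfC.continuous).trans s2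
    have k2 := (integral_halfBubble_sq_le nK' (i := j) (k := k') hfC.continuous).trans s2'
    have k3 : C * Metric.diam K.carrier * σ ^ 2 ≤ C * δ * σ ^ 2 := by gcongr
    have k4 : C * Metric.diam K'.carrier * σ ^ 2 ≤ C * δ * σ ^ 2 := by gcongr
    linarith
  have hgσ : l2norm volume (gradient v) ≤ √(2 * C) * (G * √δ) * σ := by
    refine le_sqrt_mul (by positivity) (by positivity) hσ0 ?_
    rw [n2, mul_pow, Real.sq_sqrt hδ0]
    have k3 : C * G ^ 2 * Metric.diam K.carrier * σ ^ 2 ≤ C * G ^ 2 * δ * σ ^ 2 := by gcongr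
    have k4 : C * G ^ 2 * Metric.diam K'.carrier * σ ^ 2 ≤ C * G ^ 2 * δ * σ ^ 2 := by gcongr
    have k5 := s3.trans k3
    have k6 := s3'.trans k4
    change (∫ x in K.carrier, ‖gradient (halfBubble b K.type i k f) x‖ ^ 2) +
      (∫ x in K'.carrier, ‖gradient (halfBubble b' K'.type j k' f) x‖ ^ 2) ≤ _
    change (∫ x in K.carrier, ‖gradient (halfBubble b K.type i k f) x‖ ^ 2) ≤ _ at k5
    change (∫ x in K'.carrier, ‖gradient (halfBubble b' K'.type j k' f) x‖ ^ 2) ≤ _ at k6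
    linarith
  have hvL := (memLp_lipschitz hv hvc).1
  have hvS : MemLp v 2 (sideMeasure K i) :=
    memLp_of_continuous K.isCompact_carrier (hae.mono fun x hx => hx.2) hv.continuous
  have hvbub : ∀ᵐ x ∂sideMeasure K i, v x = bubble (sideForms d K.type i) (b.coords x) * f x := by
    filter_upwards [hae] with x hx
    rw [hv1 x hx.1.ge, halfBubble, sideProj_eq_self hx.1]
  have hvSσ : l2norm (sideMeasure K i) v ≤ σ := by
    refine le_of_sq_le_sq ?_ hσ0
    rw [l2norm_sq hvS, hσ2]
    refine integral_mono_of_nonneg (Filter.Eventually.of_forall fun x => sq_nonneg _)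
      hf2.integrable_sq ?_
    filter_upwards [hvbub] with x hx
    simp only [hx, norm_mul, Real.norm_eq_abs, mul_pow, sq_abs]
    exact mul_le_of_le_one_left (sq_nonneg _)
      (pow_le_one₀ (bubble_nonneg _ _) (bubble_le_one _ _))
  have hRv : ∀ D ∈ M, |∫ x in D.carrier, elemResidual A B lam u D x * v x| ≤
      l2norm (volume.restrict D.carrier) (elemResidual A B lam u D) * (√(2 * C) * √δ * σ) := by
    intro D hD
    have k1 := abs_integral_le_l2norm (c := 1) (h.memLp_elemResidual hD lam)
      (hvL.mono_measure (Measure.restrict_le_self (s := D.carrier))) zero_le_one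
      (H := fun x => elemResidual A B lam u D x * v x) (Filter.Eventually.of_forall fun x => by
        rw [abs_mul, one_mul]
        rfl)
    rw [one_mul] at k1
    refine k1.trans (mul_le_mul_of_nonneg_left ?_ (l2norm_nonneg _))
    exact (l2norm_mono_measure Measure.restrict_le_self hvL).trans hvσ
  have hRvK := hRv K hK
  have hRvK' := hRv K' hK'
  have hosc := abs_integral_le_l2norm (c := 1) (hJ.sub hf2) hvS zero_le_one
    (H := fun x => (J x - f x) * v x) (Filter.Eventually.of_forall fun x => by
      rw [abs_mul, one_mul]
      rfl)
  -- On the side `v` is the bubble times `f`, and the sum of the fluxes is `J`; replacing `f` by `J`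
  -- in one factor leaves the oscillation.
  have hid : ∫ x, bubble (sideForms d K.type i) (b.coords x) * f x ^ 2 ∂sideMeasure K i =
      (∫ x, flux A u K i x * v x ∂sideMeasure K i) +
      (∫ x, flux A u K' j x * v x ∂sideMeasure K i) -
        ∫ x, (J x - f x) * v x ∂sideMeasure K i := by
    have i2 : Integrable (fun x => (J x - f x) * v x) (sideMeasure K i) :=
      (hJ.sub hf2).integrable_mul hvS
    obtain ⟨i3, i4⟩ := hfl v hv.continuous
    have i5 : Integrable (fun x => flux A u K i x * v x + flux A u K' j x * v x)
      (sideMeasure K i) := i3.add i4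
    rw [← integral_add i3 i4, ← integral_sub i5 i2]
    refine integral_congr_ae ?_
    filter_upwards [hvbub] with x hx
    rw [hJdef, jump_eq hd0 h.triangulation hK hK' hne hS, hx]
    ring
  set X := l2norm (volume.restrict P) (w.2 - u.2)
  set Y := l2norm (volume.restrict P) (μ • w.1 - lam • u.1)
  set O := l2norm (sideMeasure K i) (J - f)
  set r := l2norm (volume.restrict K.carrier) (elemResidual A B lam u K) with hr
  set r' := l2norm (volume.restrict K'.carrier) (elemResidual A B lam u K') with hr'
  have hX : 0 ≤ X := l2norm_nonneg _
  have hY : 0 ≤ Y := l2norm_nonneg _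
  have hO : 0 ≤ O := l2norm_nonneg _
  have hr0 : 0 ≤ r := l2norm_nonneg _
  have hr0' : 0 ≤ r' := l2norm_nonneg _
  have hb0 := h.bound_nonneg
  set q := √(2 * C) with hq
  have hq0 : 0 ≤ q := Real.sqrt_nonneg _
  have hfinal : σ ^ 2 ≤ C * (|a₂| * (X * (q * G * √δ)) + (b₂ * Y + r + r') * (q * √δ) + O) * σ := by
    refine s1.trans ?_
    rw [hid, mul_assoc]
    refine mul_le_mul_of_nonneg_left ?_ hC
    have k1 := (abs_le.1 hres).2
    have k2 := (abs_le.1 hosc).1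
    have k3 : |a₂| * (X * l2norm volume (gradient v)) ≤ |a₂| * (X * (q * (G * √δ) * σ)) := by gcongr
    have k4 : b₂ * (Y * l2norm volume v) ≤ b₂ * (Y * (q * √δ * σ)) := by gcongr
    have k5 : 1 * (O * l2norm (sideMeasure K i) v) ≤ O * σ := by
      rw [one_mul]
      gcongr
    have k6 := (abs_le.1 hRvK).1
    have k7 := (abs_le.1 hRvK').1
    have k8 : (|a₂| * (X * (q * G * √δ)) + (b₂ * Y + r + r') * (q * √δ) + O) * σ =
      |a₂| * (X * (q * (G * √δ) * σ)) + b₂ * (Y * (q * √δ * σ)) + r * (q * √δ * σ) +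
        r' * (q * √δ * σ) + O * σ := by ring
    rw [k8]
    linarith
  have hnn : 0 ≤ C * (|a₂| * (X * (q * G * √δ)) + (b₂ * Y + r + r') * (q * √δ) + O) := by
    have := Real.sqrt_nonneg δ
    exact mul_nonneg hC (add_nonneg (add_nonneg (mul_nonneg (abs_nonneg _)
      (mul_nonneg hX (mul_nonneg (mul_nonneg hq0 hG0) this)))
      (mul_nonneg (add_nonneg (add_nonneg (mul_nonneg hb0 hY) hr0) hr0') (mul_nonneg hq0 this))) hO)
  have hσle := le_of_sq_le_mul_self hnn hfinal
  have htri := l2norm_le_add_sub hJ hf2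
  linarith

end

section

/-! ### The local lower bound -/

variable {Ω : Set (E d)} {ℓ : ℕ} {A : E d → Matrix (Fin d) (Fin d) ℝ} {B : E d → ℝ}
  {a₁ a₂ b₂ : ℝ} {M M' : Finset (LSimplex d)} {W : Submodule ℝ (L2Pair d)} {μ : ℝ} {u w : L2Pair d}
  {K T : LSimplex d}

theorem CoordLip.mono {b : AffineBasis (Fin (d + 1)) ℝ (E d)} {G G' : ℝ} (h : CoordLip b G)
    (hG : G ≤ G') : CoordLip b G' :=
  ⟨h.1.trans hG, fun j x y => (h.2 j x y).trans (by gcongr)⟩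

theorem mem_neighbors :
    K ∈ neighbors M T ↔ K ∈ M ∧ (K.carrier ∩ T.carrier).Nonempty := by
  classical
  exact Finset.mem_filter

theorem carrier_subset_patch (hK : K ∈ neighbors M T) : K.carrier ⊆ patch M T :=
  Set.subset_biUnion_of_mem (u := fun K : LSimplex d => K.carrier) hK

theorem self_mem_neighbors (hT : T ∈ M) : T ∈ neighbors M T :=
  mem_neighbors.2 ⟨hT, T.vert 0, T.vert_mem_carrier 0, T.vert_mem_carrier 0⟩

theorem exists_pair_ne_ne (hd : d = 2 ∨ d = 3) (i : Fin (d + 1)) :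
    ∃ a b : Fin (d + 1), a ≠ i ∧ b ≠ i ∧ a ≠ b := by
  rcases hd with rfl | rfl
  · exact exists_other_two i
  · obtain ⟨c, hc⟩ := exists_ne i
    obtain ⟨a, b, ha, hb, -, -, hab⟩ := exists_other_three i c hc
    exact ⟨a, b, ha, hb, hab⟩

theorem mem_neighbors_of_sideVert (hd : d = 2 ∨ d = 3) (hK : K ∈ M) {i j : Fin (d + 1)}
    (hS : K.sideVert j = T.sideVert i) : K ∈ neighbors M T := by
  obtain ⟨a, -, ha, -⟩ := exists_pair_ne_ne hd i
  obtain ⟨a', -, ha'⟩ := exists_match hS ha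
  refine mem_neighbors.2 ⟨hK, T.vert a, ?_, T.vert_mem_carrier a⟩
  rw [← ha']
  exact K.vert_mem_carrier a'

theorem le_sqrt_sum_sq {ι : Type*} {s : Finset ι} {f : ι → ℝ} {i : ι} (hi : i ∈ s) :
    f i ≤ √(∑ i ∈ s, f i ^ 2) :=
  Real.le_sqrt_of_sq_le (Finset.single_le_sum (f := fun i => f i ^ 2) (fun _ _ => sq_nonneg _) hi)

/-- The factor `d + 1` is the number of sides of the element. -/
theorem sqrt_sq_mul_add_mul_sum_le {h r S c₁ c₂ : ℝ} {f : Fin (d + 1) → ℝ} (hh : 0 ≤ h)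
    (hr : 0 ≤ r) (hf : ∀ i, 0 ≤ f i) (hS : 0 ≤ S) (hc₁ : 0 ≤ c₁) (hc₂ : 0 ≤ c₂)
    (h₁ : h * r ≤ c₁ * S) (h₂ : ∀ i, √h * f i ≤ c₂ * S) :
    √(h ^ 2 * r ^ 2 + h * ∑ i, f i ^ 2) ≤ (c₁ + (d + 1) * c₂) * S := by
  refine (Real.sqrt_le_left (by positivity)).2 ?_
  have k1 : h ^ 2 * r ^ 2 ≤ (c₁ * S) ^ 2 := by
    rw [← mul_pow]
    exact pow_le_pow_left₀ (by positivity) h₁ 2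
  have k2 : h * ∑ i, f i ^ 2 ≤ (d + 1) * (c₂ * S) ^ 2 := by
    rw [Finset.mul_sum]
    have k3 : ∀ i ∈ (Finset.univ : Finset (Fin (d + 1))), h * f i ^ 2 ≤ (c₂ * S) ^ 2 := by
      intro i _
      have := pow_le_pow_left₀ (mul_nonneg (Real.sqrt_nonneg _) (hf i)) (h₂ i) 2
      rwa [mul_pow, Real.sq_sqrt hh] at this
    refine (Finset.sum_le_card_nsmul _ _ _ k3).trans ?_
    simp
  refine (add_le_add k1 k2).trans ?_
  have hdR : (0 : ℝ) ≤ d := Nat.cast_nonneg d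
  have k4 : (0 : ℝ) ≤ c₁ * S := by positivity
  have k5 : (0 : ℝ) ≤ c₂ * S := by positivity
  have k6 : (c₁ + (d + 1) * c₂) * S = c₁ * S + (d + 1) * (c₂ * S) := by ring
  rw [k6]
  nlinarith [mul_nonneg k4 k5, mul_nonneg hdR (mul_nonneg k4 k5), sq_nonneg (c₂ * S),
    mul_nonneg hdR (sq_nonneg (c₂ * S)), mul_nonneg (mul_nonneg hdR hdR) (sq_nonneg (c₂ * S))]

/-- The weight is `T.h` although the residual is that of a neighbour; comparability of sizes keeps
`T.h * G` bounded. The bound is needed for neighbours because their residuals enter `side_bound`. -/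
theorem IsDiscreteProblem.scaled_elem_bound
    (h : IsDiscreteProblem Ω ℓ A B a₁ a₂ b₂ M M' W μ u w) (hK : K ∈ neighbors M T) (hKM : K ∈ M)
    (hg : IsBisected M' (nBisect d) K) {C s G : ℝ} (hC : 0 ≤ C) (hs : 0 ≤ s)
    (hest : ∀ (t : Fin 3) (b : AffineBasis (Fin (d + 1)) ℝ (E d)), BubbleEstimates (ℓ - 1) C t b)
    (hG : CoordLip (K.basis (h.triangulation.nondegenerate K hKM)) G) (hGs : T.h * G ≤ s)
    (lam : ℝ) :
    T.h * l2norm (volume.restrict K.carrier) (elemResidual A B lam u K) ≤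
      (C * |a₂| * √C * s + C * b₂ + (C + 1)) *
        (l2norm (volume.restrict (patch M T)) (w.2 - u.2) +
          T.h * l2norm (volume.restrict (patch M T)) (μ • w.1 - lam • u.1) +
          T.h * elemOsc A B M (ℓ - 1) lam u T) := by
  have hb := h.elem_bound hKM hg (carrier_subset_patch hK) hC (hest _ _) hG lam
  have ho : l2norm (volume.restrict K.carrier) (elemResidual A B lam u K -
      l2proj (volume.restrict K.carrier) (ℓ - 1) (elemResidual A B lam u K)) ≤
      elemOsc A B M (ℓ - 1) lam u T :=
    le_sqrt_sum_sq (f := fun K => l2norm (volume.restrict K.carrier) (elemResidual A B lam u K -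
      l2proj (volume.restrict K.carrier) (ℓ - 1) (elemResidual A B lam u K))) hK
  have hO0 : 0 ≤ elemOsc A B M (ℓ - 1) lam u T := Real.sqrt_nonneg _
  have hh := T.h_nonneg
  have hb0 := h.bound_nonneg
  set X := l2norm (volume.restrict (patch M T)) (w.2 - u.2)
  set Y := l2norm (volume.restrict (patch M T)) (μ • w.1 - lam • u.1)
  set O := elemOsc A B M (ℓ - 1) lam u T
  set r := l2norm (volume.restrict K.carrier) (elemResidual A B lam u K)
  have hX : 0 ≤ X := l2norm_nonneg _
  have hY : 0 ≤ Y := l2norm_nonneg _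
  have hq : 0 ≤ √C := Real.sqrt_nonneg _
  have h1 : r ≤ C * (|a₂| * (X * (√C * G)) + b₂ * Y) + (C + 1) * O := by
    refine hb.trans ?_
    gcongr
  have hα : 0 ≤ C * |a₂| * √C * s := by positivity
  have hβ : 0 ≤ C * b₂ := by positivity
  calc T.h * r ≤ T.h * (C * (|a₂| * (X * (√C * G)) + b₂ * Y) + (C + 1) * O) := by gcongr
    _ = C * |a₂| * √C * (T.h * G) * X + C * b₂ * (T.h * Y) + (C + 1) * (T.h * O) := by ring
    _ ≤ C * |a₂| * √C * s * X + C * b₂ * (T.h * Y) + (C + 1) * (T.h * O) := by gcongr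
    _ ≤ _ := by
      have hhY : 0 ≤ T.h * Y := by positivity
      have hhO : 0 ≤ T.h * O := by positivity
      nlinarith [mul_nonneg hα hhY, mul_nonneg hα hhO, mul_nonneg hβ hX, mul_nonneg hβ hhO,
        mul_nonneg hC hX, mul_nonneg hC hhY]

theorem IsDiscreteProblem.scaled_side_bound
    (h : IsDiscreteProblem Ω ℓ A B a₁ a₂ b₂ M M' W μ u w) (hT : T ∈ M) (hK : K ∈ M) (hne : T ≠ K)
    {i j : Fin (d + 1)} (hS : K.sideVert j = T.sideVert i)
    (hg : ∀ K ∈ neighbors M T, IsBisected M' (nBisect d) K) {C s G : ℝ} (hC : 0 ≤ C) (hs : 0 ≤ s)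
    (hest : ∀ (t : Fin 3) (b : AffineBasis (Fin (d + 1)) ℝ (E d)), BubbleEstimates (ℓ - 1) C t b)
    (hGT : CoordLip (T.basis (h.triangulation.nondegenerate T hT)) G)
    (hGK : CoordLip (K.basis (h.triangulation.nondegenerate K hK)) G) (hGs : T.h * G ≤ s)
    (hdT : Metric.diam T.carrier ≤ s * T.h) (hdK : Metric.diam K.carrier ≤ s * T.h)
    {c : ℝ} (hc : c = C * |a₂| * √C * s + C * b₂ + (C + 1)) (lam : ℝ) :
    √T.h * l2norm (sideMeasure T i) (jump A M u T i) ≤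
      (C * (|a₂| * √(2 * C) * √s * s + (b₂ + 2 * c) * (√(2 * C) * √s)) + (C + 1)) *
        (l2norm (volume.restrict (patch M T)) (w.2 - u.2) +
          T.h * l2norm (volume.restrict (patch M T)) (μ • w.1 - lam • u.1) +
          T.h * elemOsc A B M (ℓ - 1) lam u T + √T.h * jumpOsc A M (ℓ - 1) u T) := by
  have hTn := self_mem_neighbors hT
  have hKn := mem_neighbors_of_sideVert h.dim hK hS
  have eT := h.scaled_elem_bound hTn hT (hg T hTn) hC hs hest hGT hGs lam
  have eK := h.scaled_elem_bound hKn hK (hg K hKn) hC hs hest hGK hGs lam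
  rw [← hc] at eT eK
  have hb := h.side_bound hT hK hne hS (hg T hTn) (hg K hKn) (carrier_subset_patch hTn)
    (carrier_subset_patch hKn) hC hest hGT hGK hdT hdK lam
  have ho : l2norm (sideMeasure T i) (jump A M u T i -
      l2proj (sideMeasure T i) (ℓ - 1) (jump A M u T i)) ≤ jumpOsc A M (ℓ - 1) u T :=
    le_sqrt_sum_sq (f := fun i => l2norm (sideMeasure T i) (jump A M u T i -
      l2proj (sideMeasure T i) (ℓ - 1) (jump A M u T i))) (Finset.mem_univ i)
  have hO0 : 0 ≤ elemOsc A B M (ℓ - 1) lam u T := Real.sqrt_nonneg _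
  have hZ0 : 0 ≤ jumpOsc A M (ℓ - 1) u T := Real.sqrt_nonneg _
  have hh := T.h_nonneg
  have hb0 := h.bound_nonneg
  have hG0 := hGT.1
  set X := l2norm (volume.restrict (patch M T)) (w.2 - u.2)
  set Y := l2norm (volume.restrict (patch M T)) (μ • w.1 - lam • u.1)
  set O := elemOsc A B M (ℓ - 1) lam u T
  set Z := jumpOsc A M (ℓ - 1) u T
  set r := l2norm (volume.restrict T.carrier) (elemResidual A B lam u T)
  set r' := l2norm (volume.restrict K.carrier) (elemResidual A B lam u K)
  set t := l2norm (sideMeasure T i) (jump A M u T i)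
  have hX : 0 ≤ X := l2norm_nonneg _
  have hY : 0 ≤ Y := l2norm_nonneg _
  set q := √(2 * C)
  have hq : 0 ≤ q := Real.sqrt_nonneg _
  have hc0 : 0 ≤ c := by rw [hc]; positivity
  -- The weight `√h` of the jump and the factor `√δ` with `δ = s * h` combine to one full power of
  -- `h`, which absorbs `G` and gives the element residuals their weight.
  have hsq : √T.h * √(s * T.h) = √s * T.h := by
    rw [Real.sqrt_mul hs, mul_left_comm, Real.mul_self_sqrt hh]
  set S := X + T.h * Y + T.h * O + √T.h * Z with hSdef
  have hS1 : X ≤ S := by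
    have : 0 ≤ T.h * Y := by positivity
    have : 0 ≤ T.h * O := by positivity
    have : 0 ≤ √T.h * Z := by positivity
    linarith
  have hS2 : T.h * Y ≤ S := by
    have : 0 ≤ T.h * O := by positivity
    have : 0 ≤ √T.h * Z := by positivity
    linarith
  have hS3 : X + T.h * Y + T.h * O ≤ S := by
    have : 0 ≤ √T.h * Z := by positivity
    linarith
  have hS4 : √T.h * Z ≤ S := by
    have : 0 ≤ T.h * Y := by positivity
    have : 0 ≤ T.h * O := by positivity
    linarith
  have eT' : T.h * r ≤ c * S := eT.trans (by gcongr)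
  have eK' : T.h * r' ≤ c * S := eK.trans (by gcongr)
  calc √T.h * t ≤ √T.h * (C * (|a₂| * (X * (q * G * √(s * T.h))) +
          (b₂ * Y + r + r') * (q * √(s * T.h))) + (C + 1) * Z) := by
        refine mul_le_mul_of_nonneg_left (hb.trans ?_) (Real.sqrt_nonneg _)
        gcongr
    _ = C * (|a₂| * q * G * (√T.h * √(s * T.h)) * X + (b₂ * Y + r + r') * (q *
          (√T.h * √(s * T.h)))) + (C + 1) * (√T.h * Z) := by ring
    _ = C * (|a₂| * q * √s * (T.h * G) * X + (b₂ * (T.h * Y) + T.h * r + T.h * r') * (q * √s)) +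
          (C + 1) * (√T.h * Z) := by
        rw [hsq]
        ring
    _ ≤ C * (|a₂| * q * √s * s * S + (b₂ * S + c * S + c * S) * (q * √s)) + (C + 1) * S := by
        gcongr
    _ = _ := by ring

theorem exists_local_lower_bound (hd : d = 2 ∨ d = 3) (a₂ : ℝ) (hb₂ : 0 ≤ b₂) (κ : ℝ) :
    ∃ c : ℝ, ∀ (A : E d → Matrix (Fin d) (Fin d) ℝ) (B : E d → ℝ) (a₁ : ℝ)
      (M M' : Finset (LSimplex d)) (W : Submodule ℝ (L2Pair d)) (μ lam : ℝ) (u w : L2Pair d),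
      IsDiscreteProblem Ω ℓ A B a₁ a₂ b₂ M M' W μ u w → regularity M ≤ κ → ∀ T ∈ M,
      (∀ K ∈ neighbors M T, IsBisected M' (nBisect d) K) →
      estimator A B M lam u T ≤ c * (l2norm (volume.restrict (patch M T)) (w.2 - u.2) +
          T.h * l2norm (volume.restrict (patch M T)) (μ • w.1 - lam • u.1) +
          T.h * elemOsc A B M (ℓ - 1) lam u T + √T.h * jumpOsc A M (ℓ - 1) u T) := by
  have hd0 : 0 < d := by omega
  obtain ⟨C, hC, hest⟩ := exists_bubbleEstimates hd (ℓ - 1)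
  obtain ⟨s, hs, hshape⟩ := LSimplex.exists_shape_constant hd0 κ
  set c₁ := C * |a₂| * √C * s + C * b₂ + (C + 1) with hc₁
  have hc₁0 : 0 ≤ c₁ := by positivity
  -- The term `2 * c₁` accounts for the element residuals on both elements next to the side.
  set c₂ := C * (|a₂| * √(2 * C) * √s * s + (b₂ + 2 * c₁) * (√(2 * C) * √s)) + (C + 1)
  have hc₂0 : 0 ≤ c₂ := by positivity
  refine ⟨c₁ + (d + 1) * c₂, fun A B a₁ M M' W μ lam u w h hκ T hT hg => ?_⟩
  have nT := h.triangulation.nondegenerate T hT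
  have dT := diam_le_of_regularity hκ hT (LSimplex.rho_pos hd0 nT)
  have hTn := self_mem_neighbors hT
  have hh := T.h_nonneg
  have hO0 : 0 ≤ elemOsc A B M (ℓ - 1) lam u T := Real.sqrt_nonneg _
  have hZ0 : 0 ≤ jumpOsc A M (ℓ - 1) u T := Real.sqrt_nonneg _
  obtain ⟨i₀, j₀, -, -, hij₀⟩ := exists_pair_ne_ne hd 0
  -- The element shares an edge with itself, so the comparison of neighbours also covers it.
  obtain ⟨gT, hdT⟩ := hshape T T nT nT dT dT ⟨i₀, j₀, i₀, j₀, hij₀, hij₀, rfl, rfl⟩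
  have eT := h.scaled_elem_bound hTn hT (hg T hTn) hC hs hest (LSimplex.coordLip_rho hd0 nT) gT lam
  have hX := l2norm_nonneg (ν := volume.restrict (patch M T))
    (w.2 - u.2 : Lp (E d) 2 (volume : Measure (E d)))
  have hY := l2norm_nonneg (ν := volume.restrict (patch M T))
    (μ • w.1 - lam • u.1 : Lp ℝ 2 (volume : Measure (E d)))
  have hhZ := mul_nonneg (Real.sqrt_nonneg T.h) hZ0
  have hS0 := add_nonneg (add_nonneg (add_nonneg hX (mul_nonneg hh hY)) (mul_nonneg hh hO0)) hhZ
  have hside : ∀ i, √T.h * l2norm (sideMeasure T i) (jump A M u T i) ≤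
      c₂ * (l2norm (volume.restrict (patch M T)) (w.2 - u.2) +
          T.h * l2norm (volume.restrict (patch M T)) (μ • w.1 - lam • u.1) +
          T.h * elemOsc A B M (ℓ - 1) lam u T + √T.h * jumpOsc A M (ℓ - 1) u T) := by
    intro i
    by_cases hex : ∃ K ∈ M, K ≠ T ∧ ∃ j, K.sideVert j = T.sideVert i
    · obtain ⟨K, hK, hne, j, hS⟩ := hex
      have nK := h.triangulation.nondegenerate K hK
      have dK := diam_le_of_regularity hκ hK (LSimplex.rho_pos hd0 nK)
      obtain ⟨a, b, ha, hb, hab⟩ := exists_pair_ne_ne hd i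
      obtain ⟨a', -, ha'⟩ := exists_match hS ha
      obtain ⟨b', -, hb'⟩ := exists_match hS hb
      have hab' : a' ≠ b' := by
        rintro rfl
        exact hab (nT.injective (ha'.symm.trans hb'))
      obtain ⟨gK, hdK⟩ := hshape K T nK nT dK dT ⟨a', b', a, b, hab', hab, ha', hb'⟩
      refine h.scaled_side_bound hT hK hne.symm hS hg hC hs hest
        -- One Lipschitz constant for the barycentric coordinates of both elements next to the side.
        (G := max (1 / (2 * T.rho)) (1 / (2 * K.rho)))
        ((LSimplex.coordLip_rho hd0 nT).mono (le_max_left _ _))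
        ((LSimplex.coordLip_rho hd0 nK).mono (le_max_right _ _)) ?_ hdT hdK hc₁ lam
      rw [mul_max_of_nonneg _ _ hh]
      exact max_le gT gK
    · have h0 : jump A M u T i = 0 := by
        funext x
        exact if_neg hex
      have h1 : l2norm (sideMeasure T i) (jump A M u T i) = 0 := by
        rw [h0]
        simp [l2norm]
      rw [h1, mul_zero]
      exact mul_nonneg hc₂0 hS0
  refine sqrt_sq_mul_add_mul_sum_le hh (l2norm_nonneg _) (fun _ => l2norm_nonneg _) hS0
    hc₁0 hc₂0 (eT.trans (mul_le_mul_of_nonneg_left (le_add_of_nonneg_right hhZ) hc₁0)) hside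

end

end EigenFEM

end

theorem mainTheorem6 (d : ℕ) (hd : d = 2 ∨ d = 3) (ℓ : ℕ) (hℓ : 1 ≤ ℓ)
    (Ω : Set (EigenFEM.E d)) (hΩ_open : IsOpen Ω) (hΩ_bdd : Bornology.IsBounded Ω)
    (hΩ_lip : EigenFEM.HasLipschitzBoundary Ω)
    (A : EigenFEM.E d → Matrix (Fin d) (Fin d) ℝ) (a₁ a₂ : ℝ) (ha₁ : 0 < a₁) (ha₂ : 0 < a₂)
    (hA : EigenFEM.IsUniformlyElliptic Ω A a₁ a₂)
    (B : EigenFEM.E d → ℝ) (hB_meas : AEMeasurable B (volume.restrict Ω))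
    (b₁ b₂ : ℝ) (hb₁ : 0 < b₁) (hb₂ : 0 < b₂) (hB : ∀ x ∈ Ω, b₁ ≤ B x ∧ B x ≤ b₂)
    (κ : ℝ) :
    ∃ C : ℝ, ∀ M : Finset (EigenFEM.LSimplex d), EigenFEM.IsTriangulation Ω M →
      EigenFEM.IsAligned M A → EigenFEM.regularity M ≤ κ →
      ∀ T ∈ M, ∀ M' : Finset (EigenFEM.LSimplex d), EigenFEM.IsTriangulation Ω M' →
      EigenFEM.IsBisectionRefinement M M' (EigenFEM.neighbors M T) (EigenFEM.nBisect d) →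
      ∀ (lam : ℝ) (u : EigenFEM.L2Pair d),
      EigenFEM.IsGalerkinEigenpair Ω A B (EigenFEM.feSpace Ω ℓ M) lam u →
      ∀ W : Submodule ℝ (EigenFEM.L2Pair d), W ≤ EigenFEM.H10 Ω →
      EigenFEM.feSpace Ω ℓ M' ≤ W →
      ∀ (μ : ℝ) (w : EigenFEM.L2Pair d), EigenFEM.IsGalerkinEigenpair Ω A B W μ w →
      EigenFEM.estimator A B M lam u T ≤
        C * (EigenFEM.l2norm (volume.restrict (EigenFEM.patch M T)) (w.2 - u.2)
          + T.h * EigenFEM.l2norm (volume.restrict (EigenFEM.patch M T))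
              (μ • w.1 - lam • u.1)
          + T.h * EigenFEM.elemOsc A B M (ℓ - 1) lam u T
          + √T.h * EigenFEM.jumpOsc A M (ℓ - 1) u T) := by
  obtain ⟨C, hC⟩ := EigenFEM.exists_local_lower_bound (Ω := Ω) (ℓ := ℓ) hd a₂ hb₂.le κ
  refine ⟨C, fun M hM hal hκ T hT M' hM' href lam u hu W _ hWle μ w hw => ?_⟩
  have hBabs : ∀ x ∈ Ω, |B x| ≤ b₂ := fun x hx => by
    rw [abs_of_nonneg (hb₁.le.trans (hB x hx).1)]
    exact (hB x hx).2
  exact hC A B a₁ M M' W μ lam u w ⟨hd, hℓ, hΩ_open, hΩ_lip, hM, hM', href.1, ha₁, hA, hal,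
    hB_meas, hb₂.le, hBabs, hu.1, hWle, hw⟩ hκ T hT href.2
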